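/- **Notation.** Powers of complex numbers are principal, $\arg\in(-\pi,\pi]$, unless stated otherwise. Let $\Gamma=\mathrm{SL}_2(\mathbb Z)$, let $\mathbb H^{\pm}$ be the upper and lower half-plane, and $\rho=e^{\pi i/3}$. For $r\in\mathbb R$ and $v:\Gamma\to\mathbb C^\ast$ let $A_r(v)$ be the space of holomorphic $f:\mathbb H^+\to\mathbb C$ with $f(\gamma z)=v(\gamma)(cz+d)^rf(z)$ for all $\gamma=\begin{pmatrix}a&b\\c&d\end{pmatrix}\in\Gamma$ (no growth condition). We call $v$ a multiplier system for the weight $r$ if $A_r(v)\ne\{0\}$. The entire modular forms $M_r(v)\subset A_r(v)$ are those with $f(z)=O(1)$ as $\mathrm{Im}\,z\to\infty$, and the cusp forms $S_r(v)\subset M_r(v)$ are those with $f(z)=O((\mathrm{Im}\,z)^{-a})$ as $\mathrm{Im}\,z\to\infty$ for all $a$. For $t\in\mathbb H^-$ put $c_f(z_1,z_2;t)=\int_{z_1}^{z_2}f(z)(z-t)^{r-2}\,dz$, for $f\in A_r(v)$ and $z_1,z_2\in\mathbb H^+$, and also for $f\in S_r(v)$ with $z_2=\infty$. **Duality.** Let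 $r\in\mathbb R\setminus\mathbb Z_{\le 0}$. For $f:\mathbb H^-\to\mathbb C$ and $h:\mathbb H^+\to\mathbb C$ put $f^-(t)=(i-t)^rf(t)$ and $h^+(z)=(-i-z)^rh(z)$. Let $D^\omega_r$ (respectively $D^\infty_r$) be the space of holomorphic $f$ on $\mathbb H^-$ for which $f^-$ extends holomorphically to a neighbourhood of $\mathbb H^-\cup\mathbb P^1_{\mathbb R}$ in $\mathbb P^1_{\mathbb C}$ (respectively extends to a $C^\infty$ function on $\mathbb H^-\cup\mathbb P^1_{\mathbb R}$). Give $D^\infty_r$ the topology defined by the supremum norms over $\theta\in\mathbb R/\pi\mathbb Z$ of all derivatives with respect to $\theta$ of the extension of $f^-$ at $t=-\cot\theta$. For $h$ holomorphic on $\mathbb H^+$ and $f\in D^\omega_r$ let $$[h,f]_r=\frac1\pi\int_{C_2}h^+(z)\,(\sigma_rf^-)(z)\,\frac{dz}{(z+i)^2},\qquad \sigma_rf^-(z)=\frac1\pi\,\frac{z+i}{z-i}\int_{C_1}f^-(\tau)\;{}_2F_1\Bigl(1,1;r;\frac{(\tau-i)(z+i)}{(\tau+i)(z-i)}\Bigr)\frac{d\tau}{\tau^2+1},$$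 where $C_j$ is the positively oriented circle $\bigl|\frac{z-i}{z+i}\bigr|=c_j$ in $\mathbb H^+$, $0<c_1<c_2<1$, and $f^-$ extends holomorphically to $\bigl\{\bigl|\frac{\tau-i}{\tau+i}\bigr|>c_1'\bigr\}\subset\mathbb P^1_{\mathbb C}$ for some $0<c_1'<c_1$. For $f\in D_r^\infty$, $[h,f]_r$ denotes the limit of $[h,g]_r$ as $g\in D^\omega_r$ tends to $f$ in $D^\infty_r$, whenever this limit exists. **Theorem.** Let $r_1,r_2,r_3\in\mathbb R$ with $r_1+r_2+r_3=4$, $r_1<2$, $0<r_2<2$, and let $v_j$ be a multiplier system for the weight $r_j$, with $v_1v_2v_3=1$. Let $f_1\in A_{r_1}(v_1)$, $f_2\in S_{r_2}(v_2)$ and $f_3\in M_{r_3}(v_3)$. Then $t\mapsto c_{f_1}(\rho-1,\rho;t)\,c_{f_2}(i,\infty;t)$ is an element of $D^\infty_{r_3}$, the duality $$T(f_1,f_2,f_3)=\bigl[f_3,\;c_{f_1}(\rho-1,\rho)\cdot c_{f_2}(i,\infty)\bigr]_{r_3}$$ exists (as the limit above, the function being in the closure of $D^\omega_{r_3}$),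 and $$T(f_1,f_2,f_3)=\frac{(-2i)^{r_3}\,\Gamma(r_3)}{\Gamma(2-r_1)\Gamma(2-r_2)}\int_{\tau_1=\rho-1}^{\rho}f_1(\tau_1)\int_{\tau_2=i}^{\infty}f_2(\tau_2)\int_{u=0}^1f_3\bigl(\tau_1+u(\tau_2-\tau_1)\bigr)u^{1-r_2}(1-u)^{1-r_1}\,du\,d\tau_2\,d\tau_1 ,$$ where the triple integral converges absolutely. Moreover $$T(f_1,f_2,f_3)=\frac{(-2i)^{r_3}\,\Gamma(r_3)}{\Gamma(2-r_1)\Gamma(2-r_2)}\int_{\tau_1=\rho-1}^{\rho}f_1(\tau_1)\int_{\tau_2=i}^{\infty}f_2(\tau_2)\int_{z=\tau_1}^{\tau_2}f_3(z)\Bigl(\frac{z-\tau_1}{\tau_2-\tau_1}\Bigr)^{1-r_2}\Bigl(\frac{\tau_2-z}{\tau_2-\tau_1}\Bigr)^{1-r_1}\frac{dz}{\tau_2-\tau_1}\,d\tau_2\,d\tau_1 .$$ The paths of $\tau_1$ and $\tau_2$ are geodesic segments. The path of $z$ may be the geodesic segment $s_{\tau_1,\tau_2}$ from $\tau_1$ to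 $\tau_2$, with principal powers. More generally, for each $(\tau_1,\tau_2)$ it may be any piecewise $C^1$ regular path in $\mathbb H^+$ from $\tau_1$ to $\tau_2$ that does not meet $\ell_{\tau_1,\tau_2}\setminus s_{\tau_1,\tau_2}$, where $\ell_{\tau_1,\tau_2}$ is the geodesic line through $\tau_1$ and $\tau_2$; the two powers are then continued from $s_{\tau_1,\tau_2}$ to $\mathbb H^+\setminus(\ell_{\tau_1,\tau_2}\setminus s_{\tau_1,\tau_2})$. In both cases the integral over $z$ converges absolutely. -/

import Mathlib

open Complex Set Filter Topology MeasureTheory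
open UpperHalfPlane hiding I
open scoped MatrixGroups ContDiff Manifold ComplexConjugate

noncomputable section

namespace ModularCup

/-! ## Modular forms of real weight on `SL(2, ℤ)`

Real powers of complex numbers are Mathlib's principal powers, so `arg (c z + d) ∈ (-π, π]`. -/

/-- The space `A_r(v)` of all holomorphic `f : ℍ → ℂ` with `f (γ z) = v(γ) (c z + d)^r f z`;
there is no growth condition. -/
def modularForms (r : ℝ) (v : SL(2, ℤ) → ℂˣ) : Set (ℍ → ℂ) :=
  {f | MDifferentiable 𝓘(ℂ) 𝓘(ℂ) f ∧
    ∀ (γ : SL(2, ℤ)) (z : ℍ),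
      f (γ • z) = v γ * (((γ 1 0 : ℤ) : ℂ) * z + ((γ 1 1 : ℤ) : ℂ)) ^ (r : ℂ) * f z}

/-- The space `M_r(v)` of entire modular forms: `f z = O(1)` as `Im z → ∞`. -/
def entireForms (r : ℝ) (v : SL(2, ℤ) → ℂˣ) : Set (ℍ → ℂ) :=
  {f | f ∈ modularForms r v ∧ IsBoundedAtImInfty f}

/-- The space of cusp forms: `f z = O((Im z)^(-a))` as `Im z → ∞`, for every `a`. -/
def cuspForms (r : ℝ) (v : SL(2, ℤ) → ℂˣ) : Set (ℍ → ℂ) :=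
  {f | f ∈ entireForms r v ∧ ∀ a : ℝ, f =O[atImInfty] fun z : ℍ => z.im ^ (-a)}

/-- `v` is a multiplier system for the weight `r`: the transformation law has a non-zero
holomorphic solution. -/
def IsMultiplierSystem (r : ℝ) (v : SL(2, ℤ) → ℂˣ) : Prop :=
  ∃ f ∈ modularForms r v, f ≠ 0

/-! ## Paths -/

/-- The integral of `F` along `γ : [0, 1] → ℂ`. -/
def pathIntegral (γ : ℝ → ℂ) (F : ℂ → ℂ) : ℂ :=
  ∫ s in (0 : ℝ)..1, F (γ s) * deriv γ s

/-- The integral of `F` along the geodesic half-line from `i` to `∞`. -/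
def integralToInfty (F : ℂ → ℂ) : ℂ :=
  ∫ y in Ioi (1 : ℝ), F (I * y) * I

/-- The map `z ↦ (z - a) / (z - conj a)`; for `a ∈ ℍ` it is an isometry of `ℍ` onto the unit disk
that sends `a` to `0`, and so it sends the geodesics through `a` to the diameters of the disk. -/
def toDiskAt (a z : ℂ) : ℂ := (z - a) / (z - conj a)

/-- Geodesic through `a` and `b`: the point `z` with `toDiskAt a z = u * toDiskAt a b`.
It runs from `a` (at `u = 0`) to `b` (at `u = 1`). -/
def geodesic (a b : ℂ) (u : ℝ) : ℂ :=
  (a - conj a * (toDiskAt a b * u)) / (1 - toDiskAt a b * u)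

/-- The geodesic segment from `a` to `b`. -/
def geodesicSegment (a b : ℂ) : Set ℂ := geodesic a b '' Icc 0 1

/-- The complete geodesic line in `ℍ` through `a ≠ b`. -/
def geodesicLine (a b : ℂ) : Set ℂ := {z | 0 < z.im ∧ ∃ u : ℝ, geodesic a b u = z}

/-- Piecewise continuously differentiable regular paths `γ : [0, 1] → ℍ` from `a` to `b`
that do not meet the line through `a` and `b` outside the segment from `a` to `b`. -/
structure IsAdmissiblePath (a b : ℂ) (γ : ℝ → ℂ) : Prop where
  source : γ 0 = a
  target : γ 1 = b
  continuousOn : ContinuousOn γ (Icc 0 1)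
  im_pos : ∀ s ∈ Icc (0 : ℝ) 1, 0 < (γ s).im
  avoids : ∀ s ∈ Icc (0 : ℝ) 1, γ s ∉ geodesicLine a b \ geodesicSegment a b
  piecewise : ∃ (n : ℕ) (p : ℕ → ℝ), StrictMono p ∧ p 0 = 0 ∧ p n = 1 ∧
    ∀ k < n, ContDiffOn ℝ 1 γ (Icc (p k) (p (k + 1))) ∧
      ∀ s ∈ Icc (p k) (p (k + 1)), derivWithin γ (Icc (p k) (p (k + 1))) s ≠ 0

/-- The logarithm of `(z - a) / (b - a)` on `ℍ` minus the half-line that starts in `a` on the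
geodesic line through `a` and `b` and points away from `b`; on the segment from `a` to `b` it is
the principal logarithm. With `u = toDiskAt a z / toDiskAt a b` one has
`(z - a) / (b - a) = u * ((z - conj a) / (b - conj a))`; the half-line is `u < 0`, and the second
factor is a quotient of two elements of `ℍ`, hence never a negative real number. -/
def branchLog (a b z : ℂ) : ℂ :=
  log (toDiskAt a z / toDiskAt a b) + log ((z - conj a) / (b - conj a))

/-- `branchLog a b z` is indeed a logarithm of `(z - a) / (b - a)`. -/
theorem exp_branchLog {a b z : ℂ} (ha : 0 < a.im) (hb : 0 < b.im) (hz : 0 < z.im)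
    (hab : b ≠ a) (hza : z ≠ a) : exp (branchLog a b z) = (z - a) / (b - a) := by
  have h : ∀ w : ℂ, 0 < w.im → w - conj a ≠ 0 := by
    intro w hw h0
    have := congrArg Complex.im h0
    simp at this
    linarith
  have h1 := h b hb
  have h2 := h z hz
  have h3 := sub_ne_zero.2 hab
  have h4 := sub_ne_zero.2 hza
  have h5 : toDiskAt a z / toDiskAt a b ≠ 0 := by
    unfold toDiskAt; exact div_ne_zero (div_ne_zero h4 h2) (div_ne_zero h3 h1)
  rw [branchLog, exp_add, exp_log h5, exp_log (div_ne_zero h2 h1)]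
  unfold toDiskAt
  field_simp

/-- The branch of `((z - a) / (b - a))^s` that belongs to `branchLog`. -/
def branchPow (a b : ℂ) (s : ℝ) (z : ℂ) : ℂ := exp (s * branchLog a b z)

/-! ## Eichler integrals and their product -/

/-- The corner `ρ = e^{π i / 3}` of the fundamental domain. -/
def rho : ℂ := exp (Real.pi * I / 3)

/-- The lower half-plane. -/
def LowerHalfPlane : Type := {t : ℂ // t.im < 0}

/-- `c_f(z₁, z₂; t) = ∫_{z₁}^{z₂} f(z) (z - t)^{r-2} dz` for `z₁, z₂ ∈ ℍ`. For `z ∈ ℍ` and `t` in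
the lower half-plane `z - t ∈ ℍ`, and the principal argument is used. -/
def eichler (f : ℍ → ℂ) (r : ℝ) (z₁ z₂ : ℂ) (t : LowerHalfPlane) : ℂ :=
  pathIntegral (geodesic z₁ z₂) fun z => f (ofComplex z) * (z - t.1) ^ ((r - 2 : ℝ) : ℂ)

/-- `c_f(i, ∞; t) = ∫_i^∞ f(z) (z - t)^{r-2} dz`. -/
def eichlerToInfty (f : ℍ → ℂ) (r : ℝ) (t : LowerHalfPlane) : ℂ :=
  integralToInfty fun z => f (ofComplex z) * (z - t.1) ^ ((r - 2 : ℝ) : ℂ)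

/-- The product `c_{f₁}(ρ - 1, ρ) · c_{f₂}(i, ∞)` of values of Eichler cocycles. -/
def cupProduct (r₁ r₂ : ℝ) (f₁ f₂ : ℍ → ℂ) (t : LowerHalfPlane) : ℂ :=
  eichler f₁ r₁ (rho - 1) rho t * eichlerToInfty f₂ r₂ t

/-! ## Modules of functions on the lower half-plane -/

/-- Extension by zero of a function on the lower half-plane. -/
def extendLower (f : LowerHalfPlane → ℂ) (t : ℂ) : ℂ :=
  if h : t.im < 0 then f ⟨t, h⟩ else 0

/-- `f⁻(t) = (i - t)^r f(t)` for `t` in the lower half-plane. -/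
def minusPart (r : ℝ) (f : LowerHalfPlane → ℂ) (t : ℂ) : ℂ :=
  (I - t) ^ (r : ℂ) * extendLower f t

/-- `f⁻` as a function of `x = (t + i) / (t - i)`, that is, `t = -i (1 + x) / (1 - x)`. This
coordinate sends the lower half-plane to the open unit disk and its closure in the Riemann sphere,
the lower half-plane together with the real projective line, to the closed unit disk. -/
def diskMinus (r : ℝ) (f : LowerHalfPlane → ℂ) (x : ℂ) : ℂ :=
  minusPart r f (-I * (1 + x) / (1 - x))

/-- The module of the `f` for which `f⁻` extends holomorphically to a neighbourhood, in the Riemann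
sphere, of the union of the lower half-plane and the real projective line. (In the coordinate `x`
such a neighbourhood contains a disk `‖x‖ < R` with `R > 1`.) -/
def analyticModule (r : ℝ) : Set (LowerHalfPlane → ℂ) :=
  {f | ∃ R > 1, ∃ F : ℂ → ℂ, DifferentiableOn ℂ F (Metric.ball 0 R) ∧
    EqOn F (diskMinus r f) (Metric.ball 0 1)}

/-- The module of the holomorphic `f` for which `f⁻` extends to a `C^∞` function on the union of the
lower half-plane and the real projective line. -/
def smoothModule (r : ℝ) : Set (LowerHalfPlane → ℂ) :=
  {f | DifferentiableOn ℂ (diskMinus r f) (Metric.ball 0 1) ∧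
    ∃ F : ℂ → ℂ, ContDiffOn ℝ ∞ F (Metric.closedBall 0 1) ∧
      EqOn F (diskMinus r f) (Metric.ball 0 1)}

/-- The boundary value of `f⁻` in the point `t = - cot θ` of the real projective line, as a limit
from the lower half-plane; in the coordinate `x` this point is `e^{-2 i θ}`. -/
def boundaryValue (r : ℝ) (f : LowerHalfPlane → ℂ) (θ : ℝ) : ℂ :=
  extendFrom (Metric.ball (0 : ℂ) 1) (diskMinus r f) (exp (-2 * I * θ))

/-- The topology of uniform convergence on the real projective line of all derivatives with respect
to `θ` of the boundary values. On `smoothModule r` this is the natural topology, given by the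
supremum norms of all derivatives. -/
@[reducible] def smoothTopology (r : ℝ) : TopologicalSpace (LowerHalfPlane → ℂ) :=
  ⨅ k : ℕ, TopologicalSpace.induced
    (fun f => UniformFun.ofFun (iteratedDeriv k (boundaryValue r f))) inferInstance

/-! ## The duality -/

/-- `h⁺(z) = (-i - z)^r h(z)` for `z ∈ ℍ`. -/
def plusPart (r : ℝ) (h : ℍ → ℂ) (z : ℂ) : ℂ := (-I - z) ^ (r : ℂ) * h (ofComplex z)

/-- The integral over the positively oriented circle `‖(z - i) / (z + i)‖ = c` in `ℍ`, where
`0 < c < 1`. -/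
def diskCircleIntegral (c : ℝ) (F : ℂ → ℂ) : ℂ :=
  ∮ z in C(I * ((1 + c ^ 2) / (1 - c ^ 2) : ℝ), 2 * c / (1 - c ^ 2)), F z

/-- The operator `σ_r`, applied to a function `g` that is holomorphic on the part
`‖(τ - i) / (τ + i)‖ ≥ c` of the Riemann sphere, in a point `z` with `‖(z - i) / (z + i)‖ > c`. -/
def sigma (r : ℝ) (g : ℂ → ℂ) (c : ℝ) (z : ℂ) : ℂ :=
  1 / Real.pi * ((z + I) / (z - I)) *
    diskCircleIntegral c fun τ =>
      g τ * ₂F₁ (1 : ℂ) 1 (r : ℂ) ((τ - I) * (z + I) / ((τ + I) * (z - I))) * (1 / (τ ^ 2 + 1))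

/-- `B` is the value `(1/π) ∫_C h⁺(z) (σ_r f⁻)(z) dz / (z + i)²`, computed with a holomorphic
extension `F` of `f⁻` (in the coordinate `x`) to a disk of radius `R > 1`, the circle
`‖(τ - i) / (τ + i)‖ = c₁` as the contour in `σ_r` and the circle
`‖(z - i) / (z + i)‖ = c₂` as the outer contour. -/
def IsDualityValue (r : ℝ) (h : ℍ → ℂ) (f : LowerHalfPlane → ℂ) (B : ℂ) : Prop :=
  ∃ (R : ℝ) (F : ℂ → ℂ) (c₁ c₂ : ℝ), 1 < R ∧ DifferentiableOn ℂ F (Metric.ball 0 R) ∧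
    EqOn F (diskMinus r f) (Metric.ball 0 1) ∧ 1 / R < c₁ ∧ c₁ < c₂ ∧ c₂ < 1 ∧
    B = 1 / Real.pi * diskCircleIntegral c₂ fun z =>
      plusPart r h z * sigma r (fun τ => F ((τ + I) / (τ - I))) c₁ z / (z + I) ^ 2

/-- The duality `[h, f]_r` for `h` holomorphic on `ℍ`, `f ∈ analyticModule r`, and `r` not in
`{0, -1, -2, …}`. By Cauchy's theorem the value does not depend on the choices of the extension
and of the contours. -/
def analyticPairing (r : ℝ) (h : ℍ → ℂ) (f : LowerHalfPlane → ℂ) : ℂ :=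
  Classical.epsilon (IsDualityValue r h f)

/-- The filter of neighbourhoods of `f` in the natural topology, restricted to the functions in
`analyticModule r`. -/
def analyticNhds (r : ℝ) (f : LowerHalfPlane → ℂ) : Filter (LowerHalfPlane → ℂ) :=
  @nhdsWithin _ (smoothTopology r) f (analyticModule r)

/-- The extension by continuity of `[h, ·]_r` from `analyticModule r` to `smoothModule r`. -/
def pairing (r : ℝ) (h : ℍ → ℂ) (f : LowerHalfPlane → ℂ) : ℂ :=
  limUnder (analyticNhds r f) (analyticPairing r h)

/-- The trilinear form `T(f₁, f₂, f₃) = [f₃, c_{f₁}(ρ - 1, ρ) · c_{f₂}(i, ∞)]_{r₃}`. -/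
def trilinearForm (r₁ r₂ r₃ : ℝ) (f₁ f₂ f₃ : ℍ → ℂ) : ℂ :=
  pairing r₃ f₃ (cupProduct r₁ r₂ f₁ f₂)

/-! ## The integrands -/

/-- `∫_{τ₁=ρ-1}^{ρ} f₁(τ₁) ∫_{τ₂=i}^{∞} f₂(τ₂) K(τ₁, τ₂) dτ₂ dτ₁`, over geodesic segments. -/
def outerIntegral (f₁ f₂ : ℍ → ℂ) (K : ℂ → ℂ → ℂ) : ℂ :=
  pathIntegral (geodesic (rho - 1) rho) fun τ₁ => f₁ (ofComplex τ₁) *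
    integralToInfty fun τ₂ => f₂ (ofComplex τ₂) * K τ₁ τ₂

/-- The constant `(-2i)^{r₃} Γ(r₃) / (Γ(2 - r₁) Γ(2 - r₂))`. -/
def tripleConst (r₁ r₂ r₃ : ℝ) : ℂ :=
  (-2 * I) ^ (r₃ : ℂ) * (Real.Gamma r₃ / (Real.Gamma (2 - r₁) * Real.Gamma (2 - r₂)) : ℝ)

/-- `f₃(τ₁ + u (τ₂ - τ₁)) u^{1-r₂} (1-u)^{1-r₁}`. -/
def segmentKernel (r₁ r₂ : ℝ) (f₃ : ℍ → ℂ) (τ₁ τ₂ : ℂ) (u : ℝ) : ℂ :=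
  f₃ (ofComplex (τ₁ + u * (τ₂ - τ₁))) * ((u ^ (1 - r₂) * (1 - u) ^ (1 - r₁) : ℝ) : ℂ)

/-- `f₃(z) ((z-τ₁)/(τ₂-τ₁))^{1-r₂} ((τ₂-z)/(τ₂-τ₁))^{1-r₁} / (τ₂-τ₁)` with principal powers. -/
def principalKernel (r₁ r₂ : ℝ) (f₃ : ℍ → ℂ) (τ₁ τ₂ z : ℂ) : ℂ :=
  f₃ (ofComplex z) * ((z - τ₁) / (τ₂ - τ₁)) ^ ((1 - r₂ : ℝ) : ℂ) *
    ((τ₂ - z) / (τ₂ - τ₁)) ^ ((1 - r₁ : ℝ) : ℂ) / (τ₂ - τ₁)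

/-- The same function, with the powers continued holomorphically from the geodesic segment between
`τ₁` and `τ₂` to the complement in `ℍ` of the rest of the geodesic line; note that
`(τ₂ - z) / (τ₂ - τ₁) = (z - τ₂) / (τ₁ - τ₂)`. -/
def branchKernel (r₁ r₂ : ℝ) (f₃ : ℍ → ℂ) (τ₁ τ₂ z : ℂ) : ℂ :=
  f₃ (ofComplex z) * branchPow τ₁ τ₂ (1 - r₂) z * branchPow τ₂ τ₁ (1 - r₁) z / (τ₂ - τ₁)

end ModularCup

end

noncomputable section

namespace ModularCup

/-! ## Binomial and hypergeometric coefficients -/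

/-! Everything is read off from power series in the disk coordinates `x = (t + i)/(t - i)` of the
lower half-plane and `w = (z - i)/(z + i)` of the upper one. Write `f⁻ = ∑ aₙ xⁿ` and `h⁺ = ∑ bₙ
wⁿ`. The series of `₂F₁(1,1;r;·)` has coefficients `n!/(r)ₙ`, and `dz/(z² + 1) = dw/(2iw)`, so both
contour integrals select diagonals of products of series. The duality becomes `[h, f]_r = ∑ bₙ
(n!/(r)ₙ) aₙ` (`isDualityValue_eq`). For an entire form `h` of weight `r > 0` the bound `|h| ≤ C
max(1, 1/y)^r` makes `bₙ` polynomially bounded. The functional is then continuous for the smooth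
topology (`IsDiskSeries.tendsto_functional`), and truncating power series shows that the analytic
module accumulates at every `f` with rapidly decreasing `aₙ` (`IsDiskSeries.neBot`), so the limit
exists and is unique.

For fixed `z` the function `(z - t)^(-r)` corresponds to a multiple of `(1 - xw)^(-r)`, with
coefficients `((r)ₙ/n!) wⁿ`. The factors `(r)ₙ/n!` cancel in the duality, and the value is `(-2i)^r
h(z)`: the kernel `(z - t)^(-r)` reproduces `h` (`HasMoments.tsum_eq`, `cpow_mul_inDisk_plusPart`).

Put `α = 2 - r₁` and `β = 2 - r₂`, so `α + β = r₃`. Feynman's formula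
(`integral_betaKernel_mul_cpow`) writes `(τ₁ - t)^(-α) (τ₂ - t)^(-β)` as a beta integral over `u` of
`(z - t)^(-r₃)` with `z = τ₁ + u(τ₂ - τ₁)`. The product of Eichler integrals is therefore a
superposition of reproducing kernels, and pairing it with `f₃` gives the first formula. Termwise
integration is allowed because `Im z` stays bounded below and the cusp form `f₂` decays faster than
any power of `Im τ₂`, which controls all powers of `1/(1 - |w|)` (`TripleData.hasMoments`).

For the second formula the `u`-integral is an integral along the Euclidean chord. In the coordinate
`U` centred at `τ₁` and scaled so that `τ₂` is `U = 1`, the geodesic line is real and the integrand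
is `H(U) U^(β-1) (1-U)^(α-1)` with `H` holomorphic on a disk of radius above 1. On that disk cut
along the rest of the line there is a primitive, continuous up to `0` and `1` since `α, β > 0`
(`exists_primitive_betaIntegrand`). All admissible paths, the chord and the geodesic segment among
them, give the same value. -/

/-- The coefficient `(r)_n / n!` of `x ^ n` in `(1 - x) ^ (-r)`. -/
def binomCoeff (r : ℝ) (n : ℕ) : ℝ := (ascPochhammer ℝ n).eval r / n.factorial

theorem binomCoeff_zero (r : ℝ) : binomCoeff r 0 = 1 := by simp [binomCoeff]

theorem binomCoeff_succ (r : ℝ) (n : ℕ) :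
    binomCoeff r (n + 1) = binomCoeff r n * ((r + n) / (n + 1)) := by
  rw [binomCoeff, binomCoeff, ascPochhammer_succ_eval, Nat.factorial_succ]
  push_cast
  field_simp

theorem binomCoeff_pos {r : ℝ} (hr : 0 < r) (n : ℕ) : 0 < binomCoeff r n :=
  div_pos (ascPochhammer_pos n r hr) (by positivity)

/-- The ratio of consecutive coefficients is `(r + n)/(n + 1) ≤ 1 + k/(n + 1)` for `k ≥ r`, and
Bernoulli's inequality bounds this by `((n + 2)/(n + 1))^k`, which telescopes. -/
theorem exists_binomCoeff_le {r : ℝ} (hr : 0 < r) :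
    ∃ k : ℕ, ∀ n : ℕ, binomCoeff r n ≤ (n + 1 : ℝ) ^ k := by
  obtain ⟨k, hk⟩ := exists_nat_ge r
  refine ⟨k, fun n => ?_⟩
  induction n with
  | zero => simp [binomCoeff_zero]
  | succ n ih =>
    have hn : (0 : ℝ) < n + 1 := by positivity
    have hb : 1 + (k : ℝ) * (1 / (n + 1)) ≤ (1 + 1 / (n + 1 : ℝ)) ^ k :=
      one_add_mul_le_pow (by have : (0 : ℝ) < 1 / (n + 1) := by positivity
                             linarith) k
    have h2 : (r + n) / (n + 1) ≤ (1 + 1 / (n + 1 : ℝ)) ^ k := by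
      refine le_trans ?_ hb
      rw [div_le_iff₀ hn]
      field_simp
      linarith
    calc binomCoeff r (n + 1) = binomCoeff r n * ((r + n) / (n + 1)) := binomCoeff_succ r n
      _ ≤ (n + 1 : ℝ) ^ k * (1 + 1 / (n + 1 : ℝ)) ^ k := by
        gcongr
      _ = ((n + 1 : ℕ) + 1 : ℝ) ^ k := by
        rw [← mul_pow]; congr 1; push_cast; field_simp

/-- The inverse ratios `(n + 1)/(r + n)` are below `(n + 1)/n`, so their product from `n = 1` on
telescopes and leaves the bound `n/r`. The summand `1` in the constant covers `n = 0`. -/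
theorem binomCoeff_inv_le {r : ℝ} (hr : 0 < r) (n : ℕ) :
    (binomCoeff r n)⁻¹ ≤ (1 + r⁻¹) * (n + 1 : ℝ) := by
  have key : ∀ n : ℕ, (binomCoeff r (n + 1))⁻¹ ≤ r⁻¹ * (n + 1 : ℝ) := by
    intro n
    induction n with
    | zero => simp [binomCoeff_succ, binomCoeff_zero]
    | succ n ih =>
      rw [binomCoeff_succ, mul_inv, inv_div]
      have h : (((n + 1 : ℕ) : ℝ) + 1) / (r + (n + 1 : ℕ)) ≤ (n + 2) / (n + 1) := by
        push_cast
        rw [div_le_div_iff₀ (by positivity) (by positivity)]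
        nlinarith [(by positivity : (0 : ℝ) ≤ n)]
      calc _ ≤ (r⁻¹ * (n + 1 : ℝ)) * ((n + 2) / (n + 1)) := by
            gcongr
        _ = _ := by push_cast; field_simp; ring
  rcases n with _ | n
  · simp [binomCoeff_zero, hr.le]
  · refine (key n).trans ?_
    have : (0 : ℝ) < r⁻¹ := by positivity
    push_cast
    nlinarith [(by positivity : (0 : ℝ) ≤ n)]

theorem hasSum_binomCoeff (r : ℝ) {x : ℂ} (hx : ‖x‖ < 1) :
    HasSum (fun n => (binomCoeff r n : ℂ) * x ^ n) ((1 - x) ^ (-r : ℂ)) := by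
  have h := (one_div_one_sub_cpow_hasFPowerSeriesOnBall_zero (r : ℂ)).hasSum (y := x)
    (by rw [Metric.mem_eball, edist_zero_right, ← ofReal_norm, ENNReal.ofReal_lt_one]; exact hx)
  rw [zero_add, one_div, ← cpow_neg] at h
  -- The library series has the generalized binomial coefficients `(r + n - 1 choose n)`, which are
  -- `(r)ₙ/n!`.
  have hc : ∀ n : ℕ, (binomCoeff r n : ℂ) = Ring.choose ((r : ℂ) + n - 1) n := by
    intro n
    rw [binomCoeff, Ring.choose]
    have h2 := Ring.factorial_nsmul_multichoose_eq_ascPochhammer (r : ℂ) n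
    rw [show (r : ℂ) + n - 1 - n + 1 = r by ring]
    rw [nsmul_eq_mul, Polynomial.ascPochhammer_smeval_eq_eval] at h2
    push_cast
    have h4 : ((Polynomial.eval r (ascPochhammer ℝ n) : ℝ) : ℂ)
        = Polynomial.eval (r : ℂ) (ascPochhammer ℂ n) := by
      rw [← ascPochhammer_map (algebraMap ℝ ℂ) n]
      exact (Polynomial.eval_map_apply (algebraMap ℝ ℂ) r).symm
    rw [h4, div_eq_iff (by exact_mod_cast n.factorial_ne_zero), mul_comm, ← h2]
  simp_rw [hc]
  simpa only [FormalMultilinearSeries.ofScalars_apply_eq, smul_eq_mul] using h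

theorem summable_poly_mul_geometric (k : ℕ) {c : ℝ} (h0 : 0 ≤ c) (hc : c < 1) :
    Summable fun n : ℕ => (n + 1 : ℝ) ^ k * c ^ n := by
  have h := (summable_nat_add_iff 1).2
    (summable_pow_mul_geometric_of_norm_lt_one k (r := c) (by rwa [Real.norm_of_nonneg h0]))
  rcases h0.eq_or_lt with rfl | h0
  · refine summable_of_hasFiniteSupport ((Set.finite_singleton 0).subset ?_)
    intro n hn
    by_contra h
    simp_all
  · refine (h.mul_left c⁻¹).congr fun n => ?_
    push_cast
    rw [pow_succ]
    field_simp

/-- The series of `₂F₁(1, 1; r; x)`. -/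
theorem hasSum_hypergeometric {r : ℝ} (hr : 0 < r) {x : ℂ} (hx : ‖x‖ < 1) :
    HasSum (fun n => ((binomCoeff r n)⁻¹ : ℂ) * x ^ n) (₂F₁ (1 : ℂ) 1 (r : ℂ) x) := by
  have hs : Summable (fun n => ((binomCoeff r n)⁻¹ : ℂ) * x ^ n) := by
    refine Summable.of_norm_bounded
      ((summable_poly_mul_geometric 1 (norm_nonneg x) hx).mul_left (1 + r⁻¹)) fun n => ?_
    rw [norm_mul, norm_pow, norm_inv, norm_real, Real.norm_of_nonneg (binomCoeff_pos hr n).le,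
      ← mul_assoc, pow_one]
    gcongr
    exact binomCoeff_inv_le hr n
  convert hs.hasSum
  rw [ordinaryHypergeometric_eq_tsum]
  refine tsum_congr fun n => ?_
  rw [smul_eq_mul]
  congr 1
  have h4 : ((Polynomial.eval r (ascPochhammer ℝ n) : ℝ) : ℂ)
      = Polynomial.eval (r : ℂ) (ascPochhammer ℂ n) := by
    rw [← ascPochhammer_map (algebraMap ℝ ℂ) n]
    exact (Polynomial.eval_map_apply (algebraMap ℝ ℂ) r).symm
  rw [binomCoeff, ascPochhammer_eval_one]
  have : (n.factorial : ℂ) ≠ 0 := by exact_mod_cast n.factorial_ne_zero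
  push_cast
  rw [h4, inv_div]
  field_simp

/-! ## Rapidly decreasing sequences and their power series -/

/-- Rapidly decreasing sequences. -/
def RapidDecay (a : ℕ → ℂ) : Prop := ∀ k : ℕ, Summable fun n : ℕ => ‖a n‖ * (n + 1 : ℝ) ^ k

/-- The sum of the power series with coefficients `a`. -/
def powerSum (a : ℕ → ℂ) (x : ℂ) : ℂ := ∑' n, a n * x ^ n

theorem RapidDecay.summable_norm {a : ℕ → ℂ} (ha : RapidDecay a) : Summable fun n => ‖a n‖ := by
  simpa using ha 0

theorem RapidDecay.hasSum {a : ℕ → ℂ} (ha : RapidDecay a) {x : ℂ} (hx : ‖x‖ ≤ 1) :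
    HasSum (fun n => a n * x ^ n) (powerSum a x) := by
  refine (Summable.of_norm_bounded ha.summable_norm fun n => ?_).hasSum
  rw [norm_mul, norm_pow]
  exact mul_le_of_le_one_right (norm_nonneg _) (pow_le_one₀ (norm_nonneg _) hx)

theorem RapidDecay.shift {a : ℕ → ℂ} (ha : RapidDecay a) :
    RapidDecay fun n => (n + 1) * a (n + 1) := by
  intro k
  refine Summable.of_nonneg_of_le (fun n => by positivity) (fun n => ?_)
    ((summable_nat_add_iff 1).2 (ha (k + 1)))
  rw [norm_mul]
  have : ‖(n + 1 : ℂ)‖ = n + 1 := by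
    have := norm_natCast (n + 1) (α := ℂ)
    push_cast at this
    exact this
  rw [this, pow_succ]
  push_cast
  calc (n + 1 : ℝ) * ‖a (n + 1)‖ * (n + 1 : ℝ) ^ k
      ≤ (n + 1 + 1 : ℝ) * ‖a (n + 1)‖ * (n + 1 + 1 : ℝ) ^ k := by gcongr <;> linarith
    _ = _ := by ring

theorem norm_pow_sub_pow_le {x y : ℂ} (hx : ‖x‖ ≤ 1) (hy : ‖y‖ ≤ 1) (n : ℕ) :
    ‖x ^ n - y ^ n‖ ≤ n * ‖x - y‖ := by
  induction n with
  | zero => simp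
  | succ n ih =>
    have : x ^ (n + 1) - y ^ (n + 1) = (x ^ n - y ^ n) * x + y ^ n * (x - y) := by ring
    rw [this]
    refine (norm_add_le _ _).trans ?_
    rw [norm_mul, norm_mul, norm_pow]
    have h1 : ‖x ^ n - y ^ n‖ * ‖x‖ ≤ n * ‖x - y‖ :=
      (mul_le_of_le_one_right (norm_nonneg _) hx).trans ih
    have h2 : ‖y‖ ^ n * ‖x - y‖ ≤ ‖x - y‖ :=
      mul_le_of_le_one_left (norm_nonneg _) (pow_le_one₀ (norm_nonneg _) hy)
    push_cast
    linarith

/-- A second-order remainder valid up to the boundary of the disk. Its constant grows only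
quadratically in `n`, so rapid decay of the coefficients absorbs it. -/
theorem norm_pow_taylor_le {x y : ℂ} (hx : ‖x‖ ≤ 1) (hy : ‖y‖ ≤ 1) (n : ℕ) :
    ‖x ^ (n + 1) - y ^ (n + 1) - (n + 1) * y ^ n * (x - y)‖ ≤ (n + 1 : ℝ) ^ 2 * ‖x - y‖ ^ 2 := by
  induction n with
  | zero => simp
  | succ n ih =>
    have : x ^ (n + 1 + 1) - y ^ (n + 1 + 1) - ((n + 1 : ℕ) + 1) * y ^ (n + 1) * (x - y) =
      (x ^ (n + 1) - y ^ (n + 1) - (n + 1) * y ^ n * (x - y)) * y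
        + (x ^ (n + 1) - y ^ (n + 1)) * (x - y) := by push_cast; ring
    rw [this]
    refine (norm_add_le _ _).trans ?_
    rw [norm_mul, norm_mul]
    have h1 := (mul_le_of_le_one_right (norm_nonneg _) hy).trans ih
    have h2 := mul_le_mul_of_nonneg_right (norm_pow_sub_pow_le hx hy (n + 1)) (norm_nonneg (x - y))
    push_cast at h2 ⊢
    nlinarith [sq_nonneg ‖x - y‖, (by positivity : (0 : ℝ) ≤ n)]

/-- The general theory of power series differentiates only in the open disk. Boundary points are
reached by summing the quadratic remainders of the monomials, with total constant `∑ ‖aₙ‖ (n + 1)²`.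
-/
theorem RapidDecay.hasDerivWithinAt {a : ℕ → ℂ} (ha : RapidDecay a) {y : ℂ} (hy : ‖y‖ ≤ 1) :
    HasDerivWithinAt (powerSum a) (powerSum (fun n => (n + 1) * a (n + 1)) y)
      (Metric.closedBall 0 1) y := by
  rw [hasDerivWithinAt_iff_isLittleO]
  set C := ∑' n, ‖a n‖ * (n + 1 : ℝ) ^ 2
  have key : ∀ x ∈ Metric.closedBall (0 : ℂ) 1,
      ‖powerSum a x - powerSum a y - (x - y) • powerSum (fun n => (n + 1) * a (n + 1)) y‖
        ≤ C * ‖x - y‖ ^ 2 := by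
    intro x hx
    have hx : ‖x‖ ≤ 1 := by simpa using hx
    have h1 := (ha.hasSum hx).sub (ha.hasSum hy)
    rw [← hasSum_nat_add_iff' 1] at h1
    have h2 := h1.sub ((ha.shift.hasSum hy).mul_left (x - y))
    simp only [Finset.range_one, Finset.sum_singleton, pow_zero, sub_self, sub_zero] at h2
    rw [smul_eq_mul]
    have hs := (summable_nat_add_iff 1).2 (ha 2)
    have hC : ∑' n : ℕ, ‖a (n + 1)‖ * ((n + 1 : ℕ) + 1 : ℝ) ^ 2 ≤ C := by
      have := (ha 2).sum_add_tsum_nat_add 1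
      have h0 : 0 ≤ ‖a 0‖ := norm_nonneg _
      simp only [C, ← this]
      simp
    refine le_trans (h2.norm_le_of_bounded (hs.hasSum.mul_right (‖x - y‖ ^ 2)) fun n => ?_)
      (mul_le_mul_of_nonneg_right hC (by positivity))
    have : a (n + 1) * x ^ (n + 1) - a (n + 1) * y ^ (n + 1)
        - (x - y) * ((n + 1) * a (n + 1) * y ^ n)
        = a (n + 1) * (x ^ (n + 1) - y ^ (n + 1) - (n + 1) * y ^ n * (x - y)) := by ring
    rw [this, norm_mul, mul_assoc ‖a (n + 1)‖]
    have h3 : (n + 1 : ℝ) ^ 2 * ‖x - y‖ ^ 2 ≤ ((n + 1 : ℕ) + 1 : ℝ) ^ 2 * ‖x - y‖ ^ 2 := by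
      gcongr
      linarith
    exact mul_le_mul_of_nonneg_left ((norm_pow_taylor_le hx hy n).trans h3)
      (norm_nonneg (a (n + 1)))
  have h1 : (fun x => powerSum a x - powerSum a y - (x - y) • powerSum (fun n => (n + 1) * a (n + 1)) y)
      =O[𝓝[Metric.closedBall 0 1] y] fun x => ‖x - y‖ ^ 2 := by
    refine Asymptotics.IsBigO.of_bound C ?_
    filter_upwards [self_mem_nhdsWithin] with x hx
    rw [norm_pow, norm_norm]
    exact key x hx
  refine h1.trans_isLittleO ?_
  have h2 : (fun x : ℂ => ‖x - y‖ ^ 2) =o[𝓝 y] fun x => x - y := by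
    have := (Asymptotics.isLittleO_pow_sub_sub y (m := 2) (by norm_num)).norm_left
    simpa using this
  exact h2.mono nhdsWithin_le_nhds

/-- The derivative is again a power series with rapidly decreasing coefficients, so induction on the
order works once `a` is left arbitrary. -/
theorem RapidDecay.contDiffOn {a : ℕ → ℂ} (ha : RapidDecay a) :
    ContDiffOn ℂ ∞ (powerSum a) (Metric.closedBall 0 1) := by
  rw [contDiffOn_infty]
  intro k
  induction k generalizing a with
  | zero =>
    simp only [Nat.cast_zero, contDiffOn_zero]
    exact fun x hx => (ha.hasDerivWithinAt (by simpa using hx)).continuousWithinAt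
  | succ k ih =>
    push_cast
    rw [contDiffOn_succ_iff_hasFDerivWithinAt (by simp)]
    intro x hx
    refine ⟨Metric.closedBall 0 1, by rw [insert_eq_of_mem hx]; exact self_mem_nhdsWithin, by simp,
      fun y => ContinuousLinearMap.toSpanSingleton ℂ
        (powerSum (fun n => (n + 1) * a (n + 1)) y), fun y hy => ?_, ?_⟩
    · exact (ha.hasDerivWithinAt (by simpa using hy)).hasFDerivWithinAt
    · exact (ContinuousLinearMap.toSpanSingletonCLE (𝕜 := ℂ) (E := ℂ)).contDiff.comp_contDiffOn
        (ih ha.shift)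

/-! ## Boundary values of power series -/

/-- The restriction of a power series to the unit circle, at `x = e^{-2 i θ}`. -/
def circleSum (a : ℕ → ℂ) (θ : ℝ) : ℂ := ∑' n, a n * exp (-2 * I * n * θ)

theorem norm_exp_circle (n : ℕ) (θ : ℝ) : ‖exp (-2 * I * n * θ)‖ = 1 := by
  have : -2 * I * n * θ = ((-2 * n * θ : ℝ) : ℂ) * I := by push_cast; ring
  rw [this, norm_exp_ofReal_mul_I]

theorem hasSum_circleSum {a : ℕ → ℂ} (ha : Summable fun n => ‖a n‖) (θ : ℝ) :
    HasSum (fun n => a n * exp (-2 * I * n * θ)) (circleSum a θ) := by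
  refine (Summable.of_norm_bounded ha fun n => ?_).hasSum
  rw [norm_mul, norm_exp_circle, mul_one]

theorem RapidDecay.fourier {a : ℕ → ℂ} (ha : RapidDecay a) (k : ℕ) :
    RapidDecay fun n => (-2 * I * n) ^ k * a n := by
  intro m
  refine Summable.of_nonneg_of_le (fun n => by positivity) (fun n => ?_)
    ((ha (k + m)).mul_left (2 ^ k))
  rw [norm_mul, norm_pow, norm_mul, norm_mul, norm_neg, norm_I, norm_natCast, pow_add]
  simp only [Complex.norm_ofNat, mul_one, mul_pow]
  calc 2 ^ k * (n : ℝ) ^ k * ‖a n‖ * (n + 1) ^ m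
      ≤ 2 ^ k * (n + 1 : ℝ) ^ k * ‖a n‖ * (n + 1) ^ m := by gcongr; linarith
    _ = _ := by ring

theorem RapidDecay.iteratedDeriv_circleSum {a : ℕ → ℂ} (ha : RapidDecay a) (k : ℕ) :
    iteratedDeriv k (circleSum a) = circleSum fun n => (-2 * I * n) ^ k * a n := by
  have hb := ha.fourier
  induction k with
  | zero => simp
  | succ k ih =>
    rw [iteratedDeriv_succ, ih]
    funext θ
    refine HasDerivAt.deriv ?_
    unfold circleSum
    refine hasDerivAt_tsum (𝕜 := ℝ) (u := fun n : ℕ => ‖(-2 * I * n) ^ (k + 1) * a n‖)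
      (g := fun (n : ℕ) (θ : ℝ) => (-2 * I * n) ^ k * a n * exp (-2 * I * n * θ))
      (g' := fun (n : ℕ) (θ : ℝ) => (-2 * I * n) ^ (k + 1) * a n * exp (-2 * I * n * θ))
      ?_ ?_ ?_ (y₀ := 0) ?_ θ
    · exact (hb (k + 1)).summable_norm
    · intro n θ
      have h1 : HasDerivAt (fun θ : ℝ => (-2 * I * n) * (θ : ℂ)) (-2 * I * n) θ := by
        simpa using (Complex.ofRealCLM.hasDerivAt (x := θ)).const_mul (-2 * I * n : ℂ)
      exact (h1.cexp.const_mul ((-2 * I * n) ^ k * a n)).congr_deriv (by ring)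
    · intro n θ
      rw [norm_mul _ (exp _), norm_exp_circle, mul_one]
    · exact (hasSum_circleSum (hb k).summable_norm 0).summable

/-- The coefficient is the mean of the sum against `e^(2imθ)`. A period has length `π` because the
variable is `e^(-2iθ)`. -/
theorem norm_coeff_le_of_circleSum_le {a : ℕ → ℂ} (ha : Summable fun n => ‖a n‖) {ε : ℝ}
    (h : ∀ θ : ℝ, ‖circleSum a θ‖ ≤ ε) (m : ℕ) : ‖a m‖ ≤ ε := by
  have hint : HasSum (fun n => ∫ θ in (0 : ℝ)..Real.pi,
        a n * exp (-2 * I * n * θ) * exp (2 * I * m * θ))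
      (∫ θ in (0 : ℝ)..Real.pi, circleSum a θ * exp (2 * I * m * θ)) := by
    have hexp : ∀ θ : ℝ, ‖exp (2 * I * m * θ)‖ = 1 := fun θ => by
      have : 2 * I * m * θ = ((2 * m * θ : ℝ) : ℂ) * I := by push_cast; ring
      rw [this, norm_exp_ofReal_mul_I]
    refine intervalIntegral.hasSum_integral_of_dominated_convergence (fun n _ => ‖a n‖) ?_ ?_ ?_ ?_ ?_
    · exact fun n => (by fun_prop : Continuous _).aestronglyMeasurable
    · intro n
      refine Eventually.of_forall fun θ _ => ?_
      rw [norm_mul, norm_mul, norm_exp_circle, hexp, mul_one, mul_one]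
    · exact Eventually.of_forall fun θ _ => ha
    · exact intervalIntegrable_const
    · exact Eventually.of_forall fun θ _ => (hasSum_circleSum ha θ).mul_right _
  have hterm : ∀ n, ∫ θ in (0 : ℝ)..Real.pi, a n * exp (-2 * I * n * θ) * exp (2 * I * m * θ)
      = if n = m then Real.pi * a n else 0 := by
    intro n
    simp_rw [mul_assoc (a n), ← exp_add]
    rw [intervalIntegral.integral_const_mul]
    split_ifs with hnm
    · subst hnm
      have : ∀ θ : ℝ, -2 * I * n * θ + 2 * I * n * θ = 0 := fun θ => by ring
      simp_rw [this]
      simp [mul_comm]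
    · have hne : (2 * I * (m - n : ℂ)) ≠ 0 := by
        refine mul_ne_zero (by simp) (sub_ne_zero.2 ?_)
        exact_mod_cast Ne.symm hnm
      have : ∀ θ : ℝ, -2 * I * n * θ + 2 * I * m * θ = (2 * I * (m - n : ℂ)) * θ := fun θ => by ring
      simp_rw [this]
      rw [integral_exp_mul_complex hne]
      have h1 : 2 * I * (m - n : ℂ) * (Real.pi : ℝ) = ((m - n : ℤ) : ℂ) * (2 * Real.pi * I) := by
        push_cast; ring
      rw [h1, exp_int_mul_two_pi_mul_I]
      simp
  simp_rw [hterm] at hint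
  have hone : HasSum (fun n => if n = m then Real.pi * a n else 0) (Real.pi * a m) := by
    convert hasSum_single (f := fun n => if n = m then Real.pi * a n else 0) m
      (fun n hn => if_neg hn)
    simp
  have heq := hint.unique hone
  have hb := intervalIntegral.norm_integral_le_of_norm_le_const (a := (0 : ℝ)) (b := Real.pi)
    (C := ε) (f := fun θ : ℝ => circleSum a θ * exp (2 * I * m * θ)) (fun θ _ => by
      have : 2 * I * m * θ = ((2 * m * θ : ℝ) : ℂ) * I := by push_cast; ring
      rw [norm_mul, this, norm_exp_ofReal_mul_I, mul_one]
      exact h θ)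
  rw [heq, norm_mul, norm_real, sub_zero, Real.norm_of_nonneg Real.pi_pos.le,
    abs_of_pos Real.pi_pos, mul_comm] at hb
  exact le_of_mul_le_mul_right hb Real.pi_pos

/-! ## Functions on the lower half-plane given by power series in the disk -/

theorem cayley_im_neg {x : ℂ} (hx : ‖x‖ < 1) : (-I * (1 + x) / (1 - x)).im < 0 := by
  have h1 : normSq x < 1 := by
    rw [normSq_eq_norm_sq]
    nlinarith [norm_nonneg x]
  have h2 : 0 < normSq (1 - x) := by
    rw [Complex.normSq_pos, sub_ne_zero]
    rintro rfl
    simp at hx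
  rw [div_im, ← sub_div]
  apply div_neg_of_neg_of_pos _ h2
  simp [normSq_apply] at h1 ⊢
  nlinarith

/-- The point of the lower half-plane with coordinate `x` in the unit disk. -/
def lowerPoint (x : ℂ) (hx : ‖x‖ < 1) : LowerHalfPlane := ⟨-I * (1 + x) / (1 - x), cayley_im_neg hx⟩

theorem I_sub_cayley {x : ℂ} (hx : x ≠ 1) : I - -I * (1 + x) / (1 - x) = 2 * I / (1 - x) := by
  have : 1 - x ≠ 0 := sub_ne_zero.2 hx.symm
  field_simp
  ring

theorem ne_one_of_norm_lt {x : ℂ} (hx : ‖x‖ < 1) : x ≠ 1 := by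
  rintro rfl
  simp at hx

theorem diskMinus_eq (r : ℝ) (f : LowerHalfPlane → ℂ) {x : ℂ} (hx : ‖x‖ < 1) :
    diskMinus r f x = (2 * I / (1 - x)) ^ (r : ℂ) * f (lowerPoint x hx) := by
  rw [diskMinus, minusPart, extendLower, dif_pos (cayley_im_neg hx),
    I_sub_cayley (ne_one_of_norm_lt hx)]
  rfl

/-- `f⁻` is given on the disk by the power series with rapidly decreasing coefficients `a`. -/
structure IsDiskSeries (r : ℝ) (f : LowerHalfPlane → ℂ) (a : ℕ → ℂ) : Prop where
  rapidDecay : RapidDecay a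
  eqOn : EqOn (powerSum a) (diskMinus r f) (Metric.ball 0 1)

variable {r : ℝ} {f : LowerHalfPlane → ℂ} {a : ℕ → ℂ}

theorem IsDiskSeries.mem_smoothModule (h : IsDiskSeries r f a) : f ∈ smoothModule r := by
  refine ⟨?_, powerSum a, h.rapidDecay.contDiffOn.restrict_scalars ℝ, h.eqOn⟩
  refine DifferentiableOn.congr ?_ fun x hx => (h.eqOn hx).symm
  exact (h.rapidDecay.contDiffOn.differentiableOn (by simp)).mono Metric.ball_subset_closedBall

/-- The power series is continuous on the closed disk, so the limit from inside is its value on the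
circle. Boundary values are thereby Fourier series, and derivatives in `θ` multiply the coefficients
by powers of `-2in`. -/
theorem IsDiskSeries.boundaryValue_eq (h : IsDiskSeries r f a) :
    boundaryValue r f = circleSum a := by
  funext θ
  have hn : ‖exp (-2 * I * θ)‖ = 1 := by simpa using norm_exp_circle 1 θ
  have hps : powerSum a (exp (-2 * I * θ)) = circleSum a θ := by
    rw [powerSum, circleSum]
    refine tsum_congr fun n => ?_
    rw [← exp_nat_mul]
    congr 2
    ring
  rw [boundaryValue, ← hps]
  refine extendFrom_eq ?_ ?_
  · rw [closure_ball _ one_ne_zero]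
    simpa using hn.le
  · have hc := (h.rapidDecay.contDiffOn.continuousOn (exp (-2 * I * θ)) (by simpa using hn.le)).mono
      Metric.ball_subset_closedBall
    refine Tendsto.congr' ?_ hc
    filter_upwards [self_mem_nhdsWithin] with x hx using h.eqOn hx

theorem IsDiskSeries.iteratedDeriv_boundaryValue (h : IsDiskSeries r f a) (k : ℕ) :
    iteratedDeriv k (boundaryValue r f) = circleSum fun n => (-2 * I * n) ^ k * a n := by
  rw [h.boundaryValue_eq, h.rapidDecay.iteratedDeriv_circleSum]

/-- The function on the lower half-plane that belongs to a power series in the disk. -/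
def ofDisk (r : ℝ) (a : ℕ → ℂ) (t : LowerHalfPlane) : ℂ :=
  (I - t.1) ^ (-r : ℂ) * powerSum a ((t.1 + I) / (t.1 - I))

theorem isDiskSeries_ofDisk (ha : RapidDecay a) : IsDiskSeries r (ofDisk r a) a := by
  refine ⟨ha, fun x hx => ?_⟩
  have hx : ‖x‖ < 1 := by simpa using hx
  have h1 : 1 - x ≠ 0 := sub_ne_zero.2 (ne_one_of_norm_lt hx).symm
  have h2 : 2 * I / (1 - x) ≠ 0 := div_ne_zero (by simp) h1
  rw [diskMinus_eq r _ hx, ofDisk]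
  simp only [lowerPoint]
  rw [I_sub_cayley (ne_one_of_norm_lt hx), ← mul_assoc, ← cpow_add _ _ h2, add_neg_cancel,
    cpow_zero, one_mul]
  congr 1
  have h3 : -I * (1 + x) / (1 - x) - I ≠ 0 := by
    rw [← neg_ne_zero, neg_sub, I_sub_cayley (ne_one_of_norm_lt hx)]
    exact h2
  rw [eq_div_iff h3]
  field_simp
  ring

/-- Truncation of a sequence. -/
def truncate (N : ℕ) (a : ℕ → ℂ) (n : ℕ) : ℂ := if n < N then a n else 0

theorem rapidDecay_truncate (N : ℕ) (a : ℕ → ℂ) : RapidDecay (truncate N a) := by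
  intro k
  refine summable_of_ne_finset_zero (s := Finset.range N) fun n hn => ?_
  rw [truncate, if_neg (by simpa using hn)]
  simp

theorem ofDisk_truncate_mem_analyticModule (N : ℕ) (a : ℕ → ℂ) :
    ofDisk r (truncate N a) ∈ analyticModule r := by
  -- A truncated series is a polynomial, so any radius above `1` would serve.
  refine ⟨2, by norm_num, powerSum (truncate N a), ?_,
    (isDiskSeries_ofDisk (rapidDecay_truncate N a)).eqOn⟩
  have : powerSum (truncate N a) = fun x => ∑ n ∈ Finset.range N, truncate N a n * x ^ n := by
    funext x
    refine tsum_eq_sum fun n hn => ?_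
    rw [truncate, if_neg (by simpa using hn), zero_mul]
  rw [this]
  fun_prop

/-- The topology is an infimum of induced ones, so its neighbourhood filter lies below that of the
`k`-th one, which is uniform convergence of the `k`-th derivative. -/
theorem eventually_iteratedDeriv_sub_lt (r : ℝ) (f : LowerHalfPlane → ℂ) (k : ℕ) {ε : ℝ}
    (hε : 0 < ε) : ∀ᶠ g in analyticNhds r f, ∀ θ : ℝ,
      ‖iteratedDeriv k (boundaryValue r g) θ - iteratedDeriv k (boundaryValue r f) θ‖ < ε := by
  let φ : (LowerHalfPlane → ℂ) → UniformFun ℝ ℂ :=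
    fun f => UniformFun.ofFun (iteratedDeriv k (boundaryValue r f))
  have h1 : analyticNhds r f ≤ comap φ (𝓝 (φ f)) := by
    rw [← nhds_induced]
    refine (@nhdsWithin_le_nhds _ (smoothTopology r) f _).trans ?_
    exact nhds_mono (iInf_le _ k)
  have h2 : Tendsto φ (analyticNhds r f) (𝓝 (φ f)) := tendsto_comap.mono_left h1
  rw [UniformFun.tendsto_iff_tendstoUniformly] at h2
  filter_upwards [Metric.tendstoUniformly_iff.1 h2 ε hε] with g hg θ
  rw [← dist_eq_norm, dist_comm]
  exact hg θ

/-- Truncations of the power series belong to the analytic module, and by the M-test all their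
boundary derivatives converge uniformly. This is the closure statement, and it makes the limit
defining `pairing` unique. -/
theorem IsDiskSeries.neBot (h : IsDiskSeries r f a) : (analyticNhds r f).NeBot := by
  have key : Tendsto (fun N => ofDisk r (truncate N a)) atTop (analyticNhds r f) := by
    refine @tendsto_nhdsWithin_of_tendsto_nhds_of_eventually_within _ _ (smoothTopology r) _ _ _ _ ?_
      (Eventually.of_forall fun N => ofDisk_truncate_mem_analyticModule N a)
    rw [smoothTopology, nhds_iInf, tendsto_iInf]
    intro k
    rw [nhds_induced, tendsto_comap_iff, UniformFun.tendsto_iff_tendstoUniformly]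
    have hs := (h.rapidDecay.fourier k).summable_norm
    have ht := tendstoUniformly_tsum_nat (f := fun (n : ℕ) (θ : ℝ) =>
        ((-2 * I * n) ^ k * a n) * exp (-2 * I * n * θ)) hs (fun n θ => by
      rw [norm_mul _ (exp _), norm_exp_circle, mul_one])
    have h1 : (fun θ : ℝ => ∑' n : ℕ, ((-2 * I * n) ^ k * a n) * exp (-2 * I * n * θ))
        = iteratedDeriv k (boundaryValue r f) := (h.iteratedDeriv_boundaryValue k).symm
    rw [h1] at ht
    convert ht using 1
    swap
    · rfl
    funext N θ
    have h2 := (isDiskSeries_ofDisk (r := r)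
      (rapidDecay_truncate N a)).iteratedDeriv_boundaryValue k
    change iteratedDeriv k (boundaryValue r (ofDisk r (truncate N a))) θ = _
    rw [h2]
    unfold circleSum
    rw [tsum_eq_sum (s := Finset.range N) fun n hn => by
      simp only [truncate, if_neg (by simpa using hn : ¬ n < N)]; simp]
    refine Finset.sum_congr rfl fun n hn => ?_
    simp only [truncate, if_pos (by simpa using hn : n < N)]
  exact key.neBot

/-! ## Taylor coefficients -/

/-- The Taylor coefficients of a function at the origin. -/
def taylorCoeff (F : ℂ → ℂ) (n : ℕ) : ℂ := (n.factorial : ℂ)⁻¹ * iteratedDeriv n F 0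

theorem hasSum_taylorCoeff {F : ℂ → ℂ} {R : ℝ} (hF : DifferentiableOn ℂ F (Metric.ball 0 R))
    {x : ℂ} (hx : ‖x‖ < R) : HasSum (fun n => taylorCoeff F n * x ^ n) (F x) := by
  have h := hasSum_taylorSeries_on_ball (c := 0) (z := x) (r := R) hF (by simpa using hx)
  simp only [sub_zero, smul_eq_mul] at h
  simpa only [taylorCoeff, mul_assoc, mul_comm (x ^ _)] using h

theorem summable_norm_taylorCoeff {F : ℂ → ℂ} {R : ℝ}
    (hF : DifferentiableOn ℂ F (Metric.ball 0 R)) {c : ℝ} (h0 : 0 ≤ c) (hc : c < R) :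
    Summable fun n => ‖taylorCoeff F n‖ * c ^ n := by
  have h := (hasSum_taylorCoeff hF (x := c) (by rwa [norm_real, Real.norm_of_nonneg h0])).summable
  simpa [norm_mul, abs_of_nonneg h0] using h.norm

theorem taylorCoeff_congr {F G : ℂ → ℂ} (h : EqOn F G (Metric.ball 0 1)) :
    taylorCoeff F = taylorCoeff G := by
  funext n
  have : F =ᶠ[𝓝 0] G := h.eventuallyEq_of_mem (Metric.ball_mem_nhds 0 one_pos)
  rw [taylorCoeff, taylorCoeff, this.iteratedDeriv_eq]

/-- Convergence at a radius `c` with `1 < c < R` gives summability of `‖aₙ‖ cⁿ`, and `cⁿ` dominates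
every power of `n + 1` up to a constant. -/
theorem rapidDecay_taylorCoeff {F : ℂ → ℂ} {R : ℝ}
    (hF : DifferentiableOn ℂ F (Metric.ball 0 R)) (hR : 1 < R) : RapidDecay (taylorCoeff F) := by
  obtain ⟨c, h1, h2⟩ := exists_between hR
  have h0 : 0 < c := by linarith
  intro k
  have hb : Tendsto (fun n : ℕ => (n + 1 : ℝ) ^ k * c⁻¹ ^ n) atTop (𝓝 0) :=
    (summable_poly_mul_geometric k (by positivity) (inv_lt_one_of_one_lt₀ h1)).tendsto_atTop_zero
  obtain ⟨C, hC⟩ := hb.bddAbove_range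
  refine Summable.of_nonneg_of_le (fun n => by positivity) (fun n => ?_)
    ((summable_norm_taylorCoeff hF h0.le h2).mul_left C)
  have := hC ⟨n, rfl⟩
  dsimp only at this
  rw [inv_pow, ← div_eq_mul_inv, div_le_iff₀ (by positivity)] at this
  calc ‖taylorCoeff F n‖ * (n + 1 : ℝ) ^ k ≤ ‖taylorCoeff F n‖ * (C * c ^ n) := by gcongr
    _ = _ := by ring

theorem isDiskSeries_of_mem_analyticModule (hf : f ∈ analyticModule r) :
    IsDiskSeries r f (taylorCoeff (diskMinus r f)) := by
  obtain ⟨R, hR, F, hF, hFf⟩ := hf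
  rw [← taylorCoeff_congr hFf]
  refine ⟨rapidDecay_taylorCoeff hF hR, fun x hx => ?_⟩
  rw [← hFf hx]
  exact (hasSum_taylorCoeff hF ((by simpa using hx : ‖x‖ < 1).trans hR)).tsum_eq

/-- Functionals given by polynomially bounded sequences are continuous. -/
theorem IsDiskSeries.tendsto_functional (h : IsDiskSeries r f a)
    {d : ℕ → ℂ} {C : ℝ} {N : ℕ} (hd : ∀ n, ‖d n‖ ≤ C * (n + 1 : ℝ) ^ N)
    {Φ : (LowerHalfPlane → ℂ) → ℂ}
    (hΦ : ∀ g ∈ analyticModule r, Φ g = ∑' n, d n * taylorCoeff (diskMinus r g) n) :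
    Tendsto Φ (analyticNhds r f) (𝓝 (∑' n, d n * a n)) := by
  have hC : 0 ≤ C := by
    have := (norm_nonneg _).trans (hd 0)
    simpa using this
  have hsum : ∀ b : ℕ → ℂ, RapidDecay b → Summable fun n => d n * b n := by
    intro b hb
    refine Summable.of_norm_bounded ((hb N).mul_left C) fun n => ?_
    rw [norm_mul]
    calc ‖d n‖ * ‖b n‖ ≤ (C * (n + 1 : ℝ) ^ N) * ‖b n‖ := by gcongr; exact hd n
      _ = _ := by ring
  have hs2 : Summable fun n : ℕ => ((n + 1 : ℝ) ^ 2)⁻¹ := by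
    have := (summable_nat_add_iff 1).2 (Real.summable_nat_pow_inv.2 (by norm_num : 1 < 2))
    simpa using this
  set S := ∑' n : ℕ, ((n + 1 : ℝ) ^ 2)⁻¹
  have hS : 0 ≤ S := tsum_nonneg fun n => by positivity
  rw [Metric.tendsto_nhds]
  intro ε hε
  -- Chosen so that `C δ S < ε`; the `1` keeps the denominator positive and the inequality strict.
  set δ := ε / (C * S + 1)
  have hδ : 0 < δ := by positivity
  have hmem : ∀ᶠ g in analyticNhds r f, g ∈ analyticModule r :=
    @eventually_mem_nhdsWithin _ (smoothTopology r) _ _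
  -- Closeness of the derivative of order `N + 2` controls `(2n)^(N+2) ‖bₙ - aₙ‖`. This beats the
  -- growth of `dₙ` and leaves a summable `1/(n + 1)²`. It says nothing for `n = 0`, which is why
  -- order `0` is needed too.
  filter_upwards [hmem, eventually_iteratedDeriv_sub_lt r f 0 hδ,
    eventually_iteratedDeriv_sub_lt r f (N + 2) hδ] with g hg h0 hN
  set b := taylorCoeff (diskMinus r g)
  have hb : IsDiskSeries r g b := isDiskSeries_of_mem_analyticModule hg
  have hcoeff : ∀ k n : ℕ, (∀ θ : ℝ, ‖iteratedDeriv k (boundaryValue r g) θ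
      - iteratedDeriv k (boundaryValue r f) θ‖ < δ) → (2 * n : ℝ) ^ k * ‖b n - a n‖ ≤ δ := by
    intro k n hk
    rw [hb.iteratedDeriv_boundaryValue, h.iteratedDeriv_boundaryValue] at hk
    have hA := (h.rapidDecay.fourier k).summable_norm
    have hB := (hb.rapidDecay.fourier k).summable_norm
    have hAB : Summable fun n : ℕ => ‖(-2 * I * n) ^ k * b n - (-2 * I * n) ^ k * a n‖ :=
      Summable.of_nonneg_of_le (fun n => norm_nonneg _) (fun n => norm_sub_le _ _) (hB.add hA)
    have := norm_coeff_le_of_circleSum_le hAB (ε := δ) (fun θ => by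
      have h1 := (hasSum_circleSum hB θ).sub (hasSum_circleSum hA θ)
      have h2 := hasSum_circleSum hAB θ
      simp only [sub_mul] at h2
      rw [show circleSum (fun n : ℕ => (-2 * I * n) ^ k * b n - (-2 * I * n) ^ k * a n) θ = _ from
        h2.unique h1]
      exact (hk θ).le) n
    rw [← mul_sub, norm_mul, norm_pow, norm_mul, norm_mul, norm_neg, norm_I, Complex.norm_natCast] at this
    simpa using this
  have hbound : ∀ n, ‖d n * b n - d n * a n‖ ≤ (C * δ) * ((n + 1 : ℝ) ^ 2)⁻¹ := by
    intro n
    have h3 : (n + 1 : ℝ) ^ (N + 2) * ‖b n - a n‖ ≤ δ := by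
      rcases n with _ | n
      · simpa using hcoeff 0 0 h0
      · refine le_trans ?_ (hcoeff (N + 2) (n + 1) hN)
        gcongr
        push_cast
        linarith [(by positivity : (0 : ℝ) ≤ n)]
    rw [← mul_sub, norm_mul]
    have h4 : (0 : ℝ) < (n + 1 : ℝ) ^ 2 := by positivity
    rw [← div_eq_mul_inv, le_div_iff₀ h4]
    calc ‖d n‖ * ‖b n - a n‖ * (n + 1 : ℝ) ^ 2
        ≤ (C * (n + 1 : ℝ) ^ N) * ‖b n - a n‖ * (n + 1 : ℝ) ^ 2 := by gcongr; exact hd n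
      _ = C * ((n + 1 : ℝ) ^ (N + 2) * ‖b n - a n‖) := by ring
      _ ≤ C * δ := by gcongr
  rw [hΦ g hg, dist_eq_norm, ← ((hsum b hb.rapidDecay).tsum_sub (hsum a h.rapidDecay))]
  refine (tsum_of_norm_bounded (hs2.hasSum.mul_left (C * δ)) hbound).trans_lt ?_
  calc C * δ * S = (C * S) / (C * S + 1) * ε := by simp only [δ]; ring
    _ < 1 * ε := by
      gcongr
      rw [div_lt_one (by positivity)]
      linarith
    _ = ε := one_mul ε

/-! ## Contour integrals over hyperbolic circles -/

/-- The disk coordinate `(z - i) / (z + i)`. -/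
def toDisk (z : ℂ) : ℂ := (z - I) / (z + I)

theorem add_I_ne_zero {z : ℂ} (hz : 0 < z.im) : z + I ≠ 0 := by
  intro h
  have := congrArg Complex.im h
  simp at this
  linarith

theorem sq_add_one (z : ℂ) : z ^ 2 + 1 = (z - I) * (z + I) := by linear_combination I_sq

/-- This turns the distance to the boundary of the disk into height and `|z + i|`. It underlies both
the growth of `h⁺` and the moment estimates. -/
theorem one_sub_normSq_toDisk {z : ℂ} (hz : 0 < z.im) :
    1 - ‖toDisk z‖ ^ 2 = 4 * z.im / ‖z + I‖ ^ 2 := by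
  have h : ‖z + I‖ ^ 2 ≠ 0 := by simpa using add_I_ne_zero hz
  rw [toDisk, norm_div, div_pow, eq_div_iff h, sub_mul, div_mul_cancel₀ _ h,
    ← normSq_eq_norm_sq, ← normSq_eq_norm_sq, normSq_apply, normSq_apply]
  simp
  ring

theorem norm_toDisk_lt_one {z : ℂ} (hz : 0 < z.im) : ‖toDisk z‖ < 1 := by
  have h := one_sub_normSq_toDisk hz
  have h1 : 0 < 4 * z.im / ‖z + I‖ ^ 2 := by
    have := norm_pos_iff.2 (add_I_ne_zero hz)
    positivity
  nlinarith [norm_nonneg (toDisk z)]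

/-- The center of the circle `‖toDisk z‖ = c`. -/
def circleCenter (c : ℝ) : ℂ := I * ((1 + c ^ 2) / (1 - c ^ 2) : ℝ)

/-- The radius of the circle `‖toDisk z‖ = c`. -/
def circleRadius (c : ℝ) : ℝ := 2 * c / (1 - c ^ 2)

theorem diskCircleIntegral_eq (c : ℝ) (F : ℂ → ℂ) :
    diskCircleIntegral c F = ∮ z in C(circleCenter c, circleRadius c), F z := rfl

section Circle

variable {c : ℝ} (h0 : 0 < c) (h1 : c < 1)
include h0 h1

theorem circleRadius_pos : 0 < circleRadius c :=
  div_pos (by positivity) (by nlinarith)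

/-- The points with `|z - i| = c |z + i|` form an Apollonius circle, with the centre and radius used
here. -/
theorem norm_sub_I_eq {z : ℂ} (hz : z ∈ Metric.sphere (circleCenter c) (circleRadius c)) :
    ‖z - I‖ = c * ‖z + I‖ := by
  have hc : (1 - c ^ 2) ≠ 0 := by nlinarith
  have hR := circleRadius_pos h0 h1
  rw [mem_sphere_iff_norm] at hz
  have h2 : ‖z - circleCenter c‖ ^ 2 = circleRadius c ^ 2 := by rw [hz]
  rw [← normSq_eq_norm_sq, normSq_apply] at h2
  simp [circleCenter, circleRadius] at h2
  have h3 : ‖z - I‖ ^ 2 = (c * ‖z + I‖) ^ 2 := by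
    rw [mul_pow, ← normSq_eq_norm_sq, ← normSq_eq_norm_sq, normSq_apply, normSq_apply]
    simp
    norm_cast at h2
    field_simp at h2
    have h4 : (1 - c ^ 2) * ((z.re * z.re + (z.im - 1) * (z.im - 1)) -
        c ^ 2 * (z.re * z.re + (z.im + 1) * (z.im + 1))) = 0 := by
      simp at h2
      linear_combination h2
    have := (mul_eq_zero.1 h4).resolve_left hc
    linarith
  exact (sq_eq_sq₀ (norm_nonneg _) (by positivity)).1 h3

theorem im_pos_of_mem_sphere {z : ℂ}
    (hz : z ∈ Metric.sphere (circleCenter c) (circleRadius c)) : 0 < z.im := by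
  have hc : 0 < (1 - c ^ 2) := by nlinarith
  rw [mem_sphere_iff_norm] at hz
  have h2 := (abs_im_le_norm (z - circleCenter c)).trans hz.le
  have h3 : (circleCenter c).im = (1 + c ^ 2) / (1 - c ^ 2) := by
    simp [circleCenter, -ofReal_div]
  rw [sub_im, h3, circleRadius, abs_le] at h2
  have h4 : 0 < (1 + c ^ 2) / (1 - c ^ 2) - 2 * c / (1 - c ^ 2) := by
    rw [← sub_div]
    exact div_pos (by nlinarith) hc
  linarith

theorem norm_toDisk_of_mem_sphere {z : ℂ}
    (hz : z ∈ Metric.sphere (circleCenter c) (circleRadius c)) : ‖toDisk z‖ = c := by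
  have := add_I_ne_zero (im_pos_of_mem_sphere h0 h1 hz)
  rw [toDisk, norm_div, norm_sub_I_eq h0 h1 hz, mul_div_cancel_right₀ _ (by simpa using this)]

theorem toDisk_ne_zero_of_mem_sphere {z : ℂ}
    (hz : z ∈ Metric.sphere (circleCenter c) (circleRadius c)) : toDisk z ≠ 0 := by
  rw [← norm_pos_iff, norm_toDisk_of_mem_sphere h0 h1 hz]
  exact h0

theorem sub_I_ne_zero_of_mem_sphere {z : ℂ}
    (hz : z ∈ Metric.sphere (circleCenter c) (circleRadius c)) : z - I ≠ 0 := by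
  have := toDisk_ne_zero_of_mem_sphere h0 h1 hz
  rw [toDisk] at this
  exact fun h => this (by rw [h, zero_div])

theorem circleMap_mem (θ : ℝ) : circleMap (circleCenter c) (circleRadius c) θ ∈
    Metric.sphere (circleCenter c) (circleRadius c) :=
  circleMap_mem_sphere _ (circleRadius_pos h0 h1).le θ

/-- With `w = toDisk z` one has `dz/(z² + 1) = dw/(2iw)`. For `n ≠ 0` the integrand has the
primitive `wⁿ/(2in)`; for `n = 0` Cauchy's formula at `i` gives `2πi/(2i) = π`. -/
theorem diskCircleIntegral_zpow (n : ℤ) :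
    diskCircleIntegral c (fun z => toDisk z ^ n * (1 / (z ^ 2 + 1)))
      = if n = 0 then (Real.pi : ℂ) else 0 := by
  have hR := circleRadius_pos h0 h1
  rw [diskCircleIntegral_eq]
  split_ifs with hn
  · subst hn
    have hc : 0 < (1 - c ^ 2) := by nlinarith
    have hin : I ∈ Metric.ball (circleCenter c) (circleRadius c) := by
      rw [mem_ball_iff_norm, circleCenter,
        show I - I * ((1 + c ^ 2) / (1 - c ^ 2) : ℝ) = I * ((1 - (1 + c ^ 2) / (1 - c ^ 2) : ℝ)) by
          push_cast; ring, norm_mul, norm_I, one_mul, norm_real, Real.norm_eq_abs, abs_lt,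
        circleRadius]
      have e : 1 - (1 + c ^ 2) / (1 - c ^ 2) = -(2 * c ^ 2) / (1 - c ^ 2) := by field_simp; ring
      rw [e, ← neg_div]
      constructor
      · gcongr; nlinarith
      · gcongr; nlinarith
    have hout : ∀ z ∈ Metric.closedBall (circleCenter c) (circleRadius c), z + I ≠ 0 := by
      intro z hz
      rw [mem_closedBall_iff_norm] at hz
      have h2 := (abs_im_le_norm (z - circleCenter c)).trans hz
      have h3 : (circleCenter c).im = (1 + c ^ 2) / (1 - c ^ 2) := by
        simp [circleCenter, -ofReal_div]
      rw [sub_im, h3, circleRadius, abs_le] at h2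
      have h4 : 0 < (1 + c ^ 2) / (1 - c ^ 2) - 2 * c / (1 - c ^ 2) := by
        rw [← sub_div]
        exact div_pos (by nlinarith) hc
      exact add_I_ne_zero (by linarith)
    have hd : DiffContOnCl ℂ (fun z : ℂ => (z + I)⁻¹)
        (Metric.ball (circleCenter c) (circleRadius c)) := by
      refine DifferentiableOn.diffContOnCl ?_
      rw [closure_ball _ hR.ne']
      intro z hz
      exact ((differentiableAt_id.add_const I).inv (hout z hz)).differentiableWithinAt
    have := hd.circleIntegral_sub_inv_smul hin
    simp only [smul_eq_mul] at this
    have e : ∀ z : ℂ, toDisk z ^ (0 : ℤ) * (1 / (z ^ 2 + 1)) = (z - I)⁻¹ * (z + I)⁻¹ := fun z => by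
      rw [sq_add_one, zpow_zero, one_mul, one_div, mul_inv]
    simp_rw [e]
    rw [this]
    have : I + I = 2 * I := by ring
    rw [this]
    field_simp
  · refine circleIntegral.integral_eq_zero_of_hasDerivWithinAt
      (f := fun z => (2 * I * n)⁻¹ * toDisk z ^ n) hR.le fun z hz => ?_
    have hz1 := add_I_ne_zero (im_pos_of_mem_sphere h0 h1 hz)
    have hz2 := sub_I_ne_zero_of_mem_sphere h0 h1 hz
    have hz3 := toDisk_ne_zero_of_mem_sphere h0 h1 hz
    have hd : HasDerivAt toDisk (2 * I / (z + I) ^ 2) z := by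
      refine (((hasDerivAt_id z).sub_const I).div ((hasDerivAt_id z).add_const I) hz1).congr_deriv ?_
      simp only [id]
      congr 1
      ring
    have hd2 := (((hasDerivAt_zpow n (toDisk z) (Or.inl hz3)).comp z hd).const_mul
      (2 * I * n)⁻¹).hasDerivWithinAt (s := Metric.sphere (circleCenter c) (circleRadius c))
    refine hd2.congr_deriv ?_
    have hn' : (n : ℂ) ≠ 0 := by exact_mod_cast hn
    rw [sq_add_one, zpow_sub_one₀ hz3]
    have : (toDisk z)⁻¹ = (z + I) / (z - I) := by rw [toDisk, inv_div]
    rw [this]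
    field_simp

/-- Cauchy's product formula: the integral picks out the diagonal of the product of a power series
in `toDisk z` and a power series in its inverse. -/
theorem diskCircleIntegral_mul_series {p q : ℕ → ℂ} (hp : Summable fun n => ‖p n‖ * c ^ n)
    (hq : Summable fun n => ‖q n‖ * c⁻¹ ^ n) {P Q : ℂ → ℂ}
    (hP : ∀ z ∈ Metric.sphere (circleCenter c) (circleRadius c),
      HasSum (fun n => p n * toDisk z ^ n) (P z))
    (hQ : ∀ z ∈ Metric.sphere (circleCenter c) (circleRadius c),
      HasSum (fun n => q n * (toDisk z)⁻¹ ^ n) (Q z)) :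
    diskCircleIntegral c (fun z => P z * Q z * (1 / (z ^ 2 + 1))) =
      Real.pi * ∑' n, p n * q n := by
  have hR := circleRadius_pos h0 h1
  obtain ⟨γ, hγd⟩ : ∃ γ, γ = circleMap (circleCenter c) (circleRadius c) := ⟨_, rfl⟩
  have hγ : ∀ θ, γ θ ∈ Metric.sphere (circleCenter c) (circleRadius c) :=
    hγd ▸ circleMap_mem h0 h1
  have hγw : ∀ θ, ‖toDisk (γ θ)‖ = c := fun θ => norm_toDisk_of_mem_sphere h0 h1 (hγ θ)
  have hγ1 : ∀ θ, γ θ + I ≠ 0 := fun θ => add_I_ne_zero (im_pos_of_mem_sphere h0 h1 (hγ θ))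
  have hγ2 : ∀ θ, γ θ - I ≠ 0 := fun θ => sub_I_ne_zero_of_mem_sphere h0 h1 (hγ θ)
  have hγ3 : ∀ θ, toDisk (γ θ) ≠ 0 := fun θ => toDisk_ne_zero_of_mem_sphere h0 h1 (hγ θ)
  have hcγ : Continuous γ := hγd ▸ continuous_circleMap _ _
  have hcw : Continuous fun θ => toDisk (γ θ) := (hcγ.sub continuous_const).div (hcγ.add continuous_const) hγ1
  have hck : Continuous fun θ => 1 / (γ θ ^ 2 + 1) := by
    refine continuous_const.div ((hcγ.pow 2).add continuous_const) fun θ => ?_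
    rw [sq_add_one]
    exact mul_ne_zero (hγ2 θ) (hγ1 θ)
  have hcd : Continuous fun θ => deriv γ θ := by
    have : (fun θ => deriv γ θ) = fun θ => circleMap 0 (circleRadius c) θ * I := by
      funext θ
      rw [hγd, deriv_circleMap]
    rw [this]
    exact (continuous_circleMap _ _).mul continuous_const
  have hPQ : ∀ θ, HasSum (fun mn : ℕ × ℕ =>
      p mn.1 * toDisk (γ θ) ^ mn.1 * (q mn.2 * (toDisk (γ θ))⁻¹ ^ mn.2)) (P (γ θ) * Q (γ θ)) := by
    intro θ
    have hs : Summable fun mn : ℕ × ℕ =>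
        p mn.1 * toDisk (γ θ) ^ mn.1 * (q mn.2 * (toDisk (γ θ))⁻¹ ^ mn.2) := by
      refine Summable.of_norm ?_
      have := hp.mul_of_nonneg hq (fun n => by positivity) (fun n => by positivity)
      simpa only [norm_mul, norm_pow, norm_inv, hγw] using this
    exact HasSum.mul (f := fun n => p n * toDisk (γ θ) ^ n)
      (g := fun n => q n * (toDisk (γ θ))⁻¹ ^ n) (hP _ (hγ θ)) (hQ _ (hγ θ)) hs
  have hint : HasSum (fun mn : ℕ × ℕ => ∫ θ in (0 : ℝ)..2 * Real.pi, deriv γ θ *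
        (p mn.1 * toDisk (γ θ) ^ mn.1 * (q mn.2 * (toDisk (γ θ))⁻¹ ^ mn.2) * (1 / (γ θ ^ 2 + 1))))
      (∫ θ in (0 : ℝ)..2 * Real.pi,
        deriv γ θ * (P (γ θ) * Q (γ θ) * (1 / (γ θ ^ 2 + 1)))) := by
    refine intervalIntegral.hasSum_integral_of_dominated_convergence
      (fun mn θ => ‖deriv γ θ‖ * ((‖p mn.1‖ * c ^ mn.1 * (‖q mn.2‖ * c⁻¹ ^ mn.2)) *
        ‖1 / (γ θ ^ 2 + 1)‖)) ?_ ?_ ?_ ?_ ?_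
    · intro mn
      have := hcw.inv₀ hγ3
      exact (hcd.mul (((continuous_const.mul (hcw.pow _)).mul
        (continuous_const.mul (this.pow _))).mul hck)).aestronglyMeasurable
    · intro mn
      refine Eventually.of_forall fun θ _ => le_of_eq ?_
      simp only [norm_mul, norm_pow, norm_inv, hγw]
    · refine Eventually.of_forall fun θ _ => ?_
      exact ((hp.mul_of_nonneg hq (fun n => by positivity) (fun n => by positivity)).mul_right
        _).mul_left _
    · simp_rw [tsum_mul_left, tsum_mul_right]
      exact (hcd.norm.mul (continuous_const.mul hck.norm)).intervalIntegrable _ _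
    · refine Eventually.of_forall fun θ _ => ?_
      refine HasSum.mul_left _ (HasSum.mul_right _ ?_)
      exact hPQ θ
  have hterm : ∀ m n : ℕ, ∫ θ in (0 : ℝ)..2 * Real.pi, deriv γ θ *
        (p m * toDisk (γ θ) ^ m * (q n * (toDisk (γ θ))⁻¹ ^ n) * (1 / (γ θ ^ 2 + 1)))
      = if m = n then Real.pi * (p m * q n) else 0 := by
    intro m n
    have h3 := diskCircleIntegral_zpow h0 h1 (m - n : ℤ)
    rw [diskCircleIntegral_eq, circleIntegral, ← hγd] at h3
    have h4 : ∀ θ, deriv γ θ *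
        (p m * toDisk (γ θ) ^ m * (q n * (toDisk (γ θ))⁻¹ ^ n) * (1 / (γ θ ^ 2 + 1)))
        = (p m * q n) * (deriv γ θ • (toDisk (γ θ) ^ (m - n : ℤ) * (1 / (γ θ ^ 2 + 1)))) := by
      intro θ
      rw [zpow_sub₀ (hγ3 θ), zpow_natCast, zpow_natCast, smul_eq_mul, inv_pow]
      ring
    simp_rw [h4]
    rw [intervalIntegral.integral_const_mul, h3]
    simp only [sub_eq_zero, Nat.cast_inj]
    split_ifs <;> ring
  simp_rw [hterm] at hint
  have hinj : Function.Injective fun n : ℕ => (n, n) := fun a b h => (Prod.mk.inj h).1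
  -- The off-diagonal integrals vanish, so the double sum reduces to the diagonal.
  have hdiag := (hinj.hasSum_iff (f := fun mn : ℕ × ℕ =>
    if mn.1 = mn.2 then (Real.pi * (p mn.1 * q mn.2) : ℂ) else 0) (fun mn hmn => by
      refine if_neg fun h => hmn ⟨mn.1, ?_⟩
      exact Prod.ext rfl h)).2 hint
  simp only [Function.comp_def, if_true] at hdiag
  rw [diskCircleIntegral_eq, circleIntegral, ← hγd]
  simp only [smul_eq_mul]
  rw [← hdiag.tsum_eq, tsum_mul_left]

end Circle

/-! ## The duality in terms of power series -/

/-- A function on `ℍ` in the disk coordinate. -/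
def inDisk (h : ℂ → ℂ) (w : ℂ) : ℂ := h (I * (1 + w) / (1 - w))

theorem inDisk_toDisk (h : ℂ → ℂ) {z : ℂ} (hz : 0 < z.im) : inDisk h (toDisk z) = h z := by
  have h1 := add_I_ne_zero hz
  rw [inDisk]
  congr 1
  have h2 : 1 - toDisk z = 2 * I / (z + I) := by rw [toDisk]; field_simp; ring
  rw [h2, toDisk]
  field_simp
  ring

/-- The product formula is used twice. On the inner circle it pairs the hypergeometric series with
`f⁻` and gives `σ_r f⁻` as a series in `1/w`; on the outer circle it pairs that series with `h⁺`.
The result involves neither the extension `F` nor the radii. -/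
theorem isDualityValue_eq {r : ℝ} (hr : 0 < r) {h : ℍ → ℂ} {f : LowerHalfPlane → ℂ} {B : ℂ}
    (hh : DifferentiableOn ℂ (inDisk (plusPart r h)) (Metric.ball 0 1))
    (hB : IsDualityValue r h f B) :
    B = ∑' n, taylorCoeff (inDisk (plusPart r h)) n * (binomCoeff r n : ℂ)⁻¹ *
      taylorCoeff (diskMinus r f) n := by
  obtain ⟨R, F, c₁, c₂, hR, hF, hFf, hc₁, hc₁₂, hc₂, rfl⟩ := hB
  have h0 : 0 < c₁ := lt_trans (by positivity) hc₁
  have h1 : c₁ < 1 := hc₁₂.trans hc₂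
  have h0' : 0 < c₂ := h0.trans hc₁₂
  have hcR : c₁⁻¹ < R := by
    rw [inv_lt_comm₀ h0 (by linarith), ← one_div]
    exact hc₁
  rw [← taylorCoeff_congr hFf]
  set a := taylorCoeff F
  set b := taylorCoeff (inDisk (plusPart r h))
  set l : ℕ → ℂ := fun n => (binomCoeff r n : ℂ)⁻¹
  have hl : ∀ n, ‖l n‖ ≤ (1 + r⁻¹) * (n + 1 : ℝ) := fun n => by
    simp only [l, norm_inv, norm_real, Real.norm_of_nonneg (binomCoeff_pos hr n).le]
    exact binomCoeff_inv_le hr n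
  have ha1 : Summable fun n => ‖a n‖ * c₁⁻¹ ^ n :=
    summable_norm_taylorCoeff hF (by positivity) hcR
  have hpoly : ∀ x : ℝ, 0 ≤ x → x < 1 → Summable fun n => ‖l n‖ * x ^ n := fun x hx hx1 =>
    Summable.of_nonneg_of_le (fun n => by positivity) (fun n => by
      rw [pow_one, ← mul_assoc]
      gcongr
      exact hl n) ((summable_poly_mul_geometric 1 hx hx1).mul_left (1 + r⁻¹))
  -- The factor `toDisk z` cancels the prefactor `(z + i)/(z - i)` of `sigma`.
  have hsigma : ∀ z ∈ Metric.sphere (circleCenter c₂) (circleRadius c₂),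
      HasSum (fun n => l n * a n * (toDisk z)⁻¹ ^ n)
        (toDisk z * sigma r (fun τ => F ((τ + I) / (τ - I))) c₁ z) := by
    intro z hz
    have hzw := norm_toDisk_of_mem_sphere h0' hc₂ hz
    have hz0 := toDisk_ne_zero_of_mem_sphere h0' hc₂ hz
    have hsum1 : Summable fun n => ‖l n * (toDisk z)⁻¹ ^ n‖ * c₁ ^ n := by
      refine (hpoly (c₁ / c₂) (by positivity) ((div_lt_one h0').2 hc₁₂)).congr fun n => ?_
      rw [norm_mul, norm_pow, norm_inv (toDisk z), hzw, div_pow, inv_pow]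
      ring
    have hval := diskCircleIntegral_mul_series h0 h1
      (p := fun n => l n * (toDisk z)⁻¹ ^ n) (q := a)
      (P := fun τ => ₂F₁ (1 : ℂ) 1 (r : ℂ) ((τ - I) * (z + I) / ((τ + I) * (z - I))))
      (Q := fun τ => F ((τ + I) / (τ - I))) hsum1 ha1 (fun τ hτ => by
        have e : (τ - I) * (z + I) / ((τ + I) * (z - I)) = toDisk τ * (toDisk z)⁻¹ := by
          rw [toDisk, toDisk, inv_div, div_mul_div_comm]
        have hlt : ‖toDisk τ * (toDisk z)⁻¹‖ < 1 := by
          rw [norm_mul, norm_inv, hzw, norm_toDisk_of_mem_sphere h0 h1 hτ, ← div_eq_mul_inv,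
            div_lt_one h0']
          exact hc₁₂
        rw [e]
        convert hasSum_hypergeometric hr hlt using 2 with n
        rw [mul_pow]
        ring) (fun τ hτ => by
        have e : (τ + I) / (τ - I) = (toDisk τ)⁻¹ := by rw [toDisk, inv_div]
        rw [e]
        refine hasSum_taylorCoeff hF ?_
        rw [norm_inv, norm_toDisk_of_mem_sphere h0 h1 hτ]
        exact hcR)
    have hs : Summable fun n => l n * a n * (toDisk z)⁻¹ ^ n := by
      refine Summable.of_norm_bounded (hsum1.mul_of_nonneg ha1 (fun n => by positivity)
        (fun n => by positivity) |>.comp_injective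
          (i := fun n : ℕ => (n, n)) fun x y h => (Prod.mk.inj h).1) fun n => le_of_eq ?_
      have : c₁ ^ n * c₁⁻¹ ^ n = 1 := by rw [← mul_pow, mul_inv_cancel₀ h0.ne', one_pow]
      simp only [Function.comp_def, norm_mul]
      linear_combination (-(‖l n‖ * ‖a n‖ * ‖(toDisk z)⁻¹ ^ n‖)) * this
    convert hs.hasSum using 1
    rw [sigma]
    have e2 : (z + I) / (z - I) = (toDisk z)⁻¹ := by rw [toDisk, inv_div]
    have e3 : (fun τ => F ((τ + I) / (τ - I)) *
        ₂F₁ (1 : ℂ) 1 (r : ℂ) ((τ - I) * (z + I) / ((τ + I) * (z - I))) * (1 / (τ ^ 2 + 1)))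
        = fun τ => ₂F₁ (1 : ℂ) 1 (r : ℂ) ((τ - I) * (z + I) / ((τ + I) * (z - I))) *
          F ((τ + I) / (τ - I)) * (1 / (τ ^ 2 + 1)) := by
      funext τ
      ring
    rw [e2, e3, hval]
    have hpi : (Real.pi : ℂ) ≠ 0 := by exact_mod_cast Real.pi_ne_zero
    have e4 : ∑' n, l n * (toDisk z)⁻¹ ^ n * a n = ∑' n, l n * a n * (toDisk z)⁻¹ ^ n :=
      tsum_congr fun n => by ring
    rw [e4]
    field_simp
  have hq : Summable fun n => ‖l n * a n‖ * c₂⁻¹ ^ n := by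
    refine Summable.of_nonneg_of_le (fun n => by positivity) (fun n => ?_)
      ((hpoly (c₁ / c₂) (by positivity) ((div_lt_one h0').2 hc₁₂)).mul_of_nonneg ha1
        (fun n => by positivity) (fun n => by positivity) |>.comp_injective
          (i := fun n : ℕ => (n, n)) fun x y h => (Prod.mk.inj h).1)
    have : c₁ ^ n * c₁⁻¹ ^ n = 1 := by rw [← mul_pow, mul_inv_cancel₀ h0.ne', one_pow]
    simp only [Function.comp_def, norm_mul, div_pow, inv_pow] at this ⊢
    refine le_of_eq ?_
    linear_combination (-(‖l n‖ * ‖a n‖ * (c₂ ^ n)⁻¹)) * this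
  have hfin := diskCircleIntegral_mul_series h0' hc₂ (p := b) (q := fun n => l n * a n)
    (P := plusPart r h)
    (summable_norm_taylorCoeff hh h0'.le hc₂) hq (fun z hz => by
      have him := im_pos_of_mem_sphere h0' hc₂ hz
      rw [← inDisk_toDisk (plusPart r h) him]
      exact hasSum_taylorCoeff hh (norm_toDisk_lt_one him)) hsigma
  -- Here `dz/(z + i)² = w dz/(z² + 1)`, which supplies the factor `w` required by `hsigma`.
  have hcongr : diskCircleIntegral c₂ (fun z =>
        plusPart r h z * sigma r (fun τ => F ((τ + I) / (τ - I))) c₁ z / (z + I) ^ 2)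
      = diskCircleIntegral c₂ fun z => plusPart r h z *
        (toDisk z * sigma r (fun τ => F ((τ + I) / (τ - I))) c₁ z) * (1 / (z ^ 2 + 1)) := by
    refine circleIntegral.integral_congr (circleRadius_pos h0' hc₂).le fun z hz => ?_
    have hz1 := add_I_ne_zero (im_pos_of_mem_sphere h0' hc₂ hz)
    have hz2 := sub_I_ne_zero_of_mem_sphere h0' hc₂ hz
    simp only [toDisk, sq_add_one]
    field_simp
  rw [hcongr, hfin]
  have hpi : (Real.pi : ℂ) ≠ 0 := by exact_mod_cast Real.pi_ne_zero
  rw [← mul_assoc, one_div, inv_mul_cancel₀ hpi, one_mul]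
  exact tsum_congr fun n => by ring

theorem exists_isDualityValue (r : ℝ) (h : ℍ → ℂ) {f : LowerHalfPlane → ℂ}
    (hf : f ∈ analyticModule r) : ∃ B, IsDualityValue r h f B := by
  obtain ⟨R, hR, F, hF, hFf⟩ := hf
  have h1 : 1 / R < 1 := by rw [div_lt_one (by linarith)]; exact hR
  obtain ⟨c₁, h2, h3⟩ := exists_between h1
  obtain ⟨c₂, h4, h5⟩ := exists_between h3
  exact ⟨_, R, F, c₁, c₂, hR, hF, hFf, h2, h4, h5, rfl⟩

/-- The choice operator is harmless: a duality value exists, and all duality values equal the same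
series. -/
theorem analyticPairing_eq {r : ℝ} (hr : 0 < r) {h : ℍ → ℂ} {f : LowerHalfPlane → ℂ}
    (hh : DifferentiableOn ℂ (inDisk (plusPart r h)) (Metric.ball 0 1))
    (hf : f ∈ analyticModule r) :
    analyticPairing r h f = ∑' n, taylorCoeff (inDisk (plusPart r h)) n * (binomCoeff r n : ℂ)⁻¹ *
      taylorCoeff (diskMinus r f) n :=
  isDualityValue_eq hr hh (Classical.epsilon_spec (exists_isDualityValue r h hf))

/-- The duality on a smooth element exists as a limit and is given by power series. -/
theorem IsDiskSeries.tendsto_analyticPairing {r : ℝ} (hr : 0 < r) {h : ℍ → ℂ}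
    {f : LowerHalfPlane → ℂ} {a : ℕ → ℂ} (hf : IsDiskSeries r f a)
    (hh : DifferentiableOn ℂ (inDisk (plusPart r h)) (Metric.ball 0 1)) {C : ℝ} {N : ℕ}
    (hb : ∀ n, ‖taylorCoeff (inDisk (plusPart r h)) n‖ ≤ C * (n + 1 : ℝ) ^ N) :
    Tendsto (analyticPairing r h) (analyticNhds r f)
      (𝓝 (∑' n, taylorCoeff (inDisk (plusPart r h)) n * (binomCoeff r n : ℂ)⁻¹ * a n)) := by
  refine hf.tendsto_functional (C := C * (1 + r⁻¹)) (N := N + 1) (fun n => ?_)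
    fun g hg => analyticPairing_eq hr hh hg
  rw [norm_mul, norm_inv, norm_real, Real.norm_of_nonneg (binomCoeff_pos hr n).le]
  calc _ ≤ (C * (n + 1 : ℝ) ^ N) * ((1 + r⁻¹) * (n + 1 : ℝ)) :=
        mul_le_mul (hb n) (binomCoeff_inv_le hr n) (inv_nonneg.2 (binomCoeff_pos hr n).le)
          ((norm_nonneg _).trans (hb n))
    _ = _ := by ring

/-! ## Growth of entire modular forms -/

theorem norm_mul_im_rpow_smul {r : ℝ} {v : SL(2, ℤ) → ℂˣ} {f : ℍ → ℂ} (hf : f ∈ modularForms r v)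
    (γ : SL(2, ℤ)) (z : ℍ) :
    ‖f (γ • z)‖ * (γ • z).im ^ (r / 2) = ‖(v γ : ℂ)‖ * (‖f z‖ * z.im ^ (r / 2)) := by
  have hd : ((γ 1 0 : ℤ) : ℂ) * z + ((γ 1 1 : ℤ) : ℂ) = denom γ z := (ModularGroup.denom_apply γ z).symm
  have hd0 : 0 < ‖denom γ z‖ := norm_pos_iff.2 (denom_ne_zero γ z)
  rw [hf.2 γ z, hd, norm_mul, norm_mul, norm_cpow_real, ModularGroup.im_smul_eq_div_normSq,
    normSq_eq_norm_sq, Real.div_rpow z.im_pos.le (by positivity), ← Real.rpow_natCast,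
    ← Real.rpow_mul hd0.le]
  have : ((2 : ℕ) : ℝ) * (r / 2) = r := by push_cast; ring
  rw [this]
  have : ‖denom γ z‖ ^ r ≠ 0 := (Real.rpow_pos_of_pos hd0 r).ne'
  field_simp

/-- Evaluating `|f| y^(r/2)` at a point where `f ≠ 0` shows that `|v|` is multiplicative, the
automorphy factor having been absorbed by the height. The elements `S` and `ST` generate the group
and have finite order, and a nonnegative real with a power equal to `1` is `1`. -/
theorem norm_multiplier {r : ℝ} {v : SL(2, ℤ) → ℂˣ} (hv : IsMultiplierSystem r v) (γ : SL(2, ℤ)) :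
    ‖(v γ : ℂ)‖ = 1 := by
  obtain ⟨f, hf, hf0⟩ := hv
  obtain ⟨z, hz⟩ := Function.ne_iff.1 hf0
  have hp : ‖f z‖ * z.im ^ (r / 2) ≠ 0 :=
    mul_ne_zero (norm_ne_zero_iff.2 hz) (Real.rpow_pos_of_pos z.im_pos _).ne'
  let N : SL(2, ℤ) →* ℝ :=
    { toFun := fun γ => ‖(v γ : ℂ)‖
      map_one' := by
        have := norm_mul_im_rpow_smul hf 1 z
        rw [one_smul] at this
        exact (mul_right_cancel₀ hp ((one_mul _).trans this)).symm
      map_mul' := fun γ δ => by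
        have h1 := norm_mul_im_rpow_smul hf (γ * δ) z
        rw [mul_smul, norm_mul_im_rpow_smul hf γ, norm_mul_im_rpow_smul hf δ, ← mul_assoc] at h1
        exact (mul_right_cancel₀ hp h1).symm }
  have hN : ∀ γ, 0 ≤ N γ := fun γ => norm_nonneg (v γ : ℂ)
  have hS : N ModularGroup.S = 1 := by
    have h : ModularGroup.S ^ 4 = 1 := by decide
    have h2 : N ModularGroup.S ^ 4 = 1 := by rw [← map_pow, h, map_one]
    exact (pow_eq_one_iff_of_nonneg (hN _) (by norm_num)).1 h2
  have hT : N ModularGroup.T = 1 := by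
    have h : (ModularGroup.S * ModularGroup.T) ^ 6 = 1 := by decide
    have h2 : N (ModularGroup.S * ModularGroup.T) ^ 6 = 1 := by rw [← map_pow, h, map_one]
    have h3 := (pow_eq_one_iff_of_nonneg (hN _) (by norm_num)).1 h2
    rwa [map_mul, hS, one_mul] at h3
  have hγ : γ ∈ Subgroup.closure {ModularGroup.S, ModularGroup.T} := by
    simp [SpecialLinearGroup.SL2Z_generators]
  change N γ = 1
  induction hγ using Subgroup.closure_induction with
  | mem x hx =>
    rcases hx with rfl | rfl
    · exact hS
    · exact hT
  | one => exact map_one N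
  | mul x y _ _ hx hy => rw [map_mul, hx, hy, one_mul]
  | inv x _ hx =>
    have : N x⁻¹ * N x = 1 := by rw [← map_mul, inv_mul_cancel, map_one]
    rwa [hx, mul_one] at this

/-- The function `|f| y^(r/2)` is invariant because `|v| = 1`, and it is `O(y^(r/2))` at the cusp,
so it is bounded by a multiple of `max(y, 1/y)^(r/2)` everywhere. Division by `y^(r/2)` gives
`max(1, y⁻²)^(r/2) = max(1, y⁻¹)^r`. -/
theorem exists_norm_le_of_entireForms {r : ℝ} (hr : 0 < r) {v : SL(2, ℤ) → ℂˣ}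
    (hv : IsMultiplierSystem r v) {f : ℍ → ℂ} (hf : f ∈ entireForms r v) :
    ∃ C : ℝ, 0 ≤ C ∧ ∀ z : ℍ, ‖f z‖ ≤ C * max 1 z.im⁻¹ ^ r := by
  have hcont : Continuous fun z : ℍ => ‖f z‖ * z.im ^ (r / 2) :=
    hf.1.1.continuous.norm.mul (UpperHalfPlane.continuous_im.rpow_const fun z => Or.inl z.im_ne_zero)
  have hO : (fun z : ℍ => ‖f z‖ * z.im ^ (r / 2)) =O[atImInfty] fun z => z.im ^ (r / 2) := by
    have h1 : (fun z : ℍ => ‖f z‖) =O[atImInfty] fun _ => (1 : ℝ) := hf.2.norm_left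
    simpa using h1.mul (Asymptotics.isBigO_refl (fun z : ℍ => z.im ^ (r / 2)) atImInfty)
  obtain ⟨C, hC⟩ := ModularGroup.exists_bound_of_invariant_of_isBigO hcont
    (by positivity : 0 ≤ r / 2) hO fun γ z => by
      rw [norm_mul_im_rpow_smul hf.1, norm_multiplier hv, one_mul]
  have key : ∀ z : ℍ, ‖f z‖ ≤ C * max 1 z.im⁻¹ ^ r := by
    intro z
    have hy := z.im_pos
    have hy2 := Real.rpow_pos_of_pos hy (r / 2)
    have h := hC z
    rw [Real.norm_of_nonneg (by positivity), ← le_div_iff₀ hy2] at h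
    refine h.trans_eq ?_
    rw [mul_div_assoc, ← Real.div_rpow (by positivity) hy.le, ← max_div_div_right hy.le,
      div_self hy.ne', div_div, one_div, mul_inv]
    have h2 : max 1 (z.im⁻¹ * z.im⁻¹) = max 1 z.im⁻¹ ^ (2 : ℕ) := by
      have hi : 0 < z.im⁻¹ := by positivity
      rcases le_total z.im⁻¹ 1 with h | h
      · rw [max_eq_left h, max_eq_left (by nlinarith), one_pow]
      · rw [max_eq_right h, max_eq_right (by nlinarith), sq]
    rw [h2, ← Real.rpow_natCast, ← Real.rpow_mul (by positivity)]
    congr 2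
    push_cast
    ring
  refine ⟨C, ?_, key⟩
  have h0 := (norm_nonneg _).trans (key UpperHalfPlane.I)
  by_contra hneg
  have : 0 < max 1 (UpperHalfPlane.I).im⁻¹ ^ r := by positivity
  nlinarith

theorem exists_norm_le_of_le_im {r : ℝ} (hr : 0 < r) {v : SL(2, ℤ) → ℂˣ}
    (hv : IsMultiplierSystem r v) {f : ℍ → ℂ} (hf : f ∈ entireForms r v) {δ : ℝ} (hδ : 0 < δ) :
    ∃ C : ℝ, ∀ z : ℍ, δ ≤ z.im → ‖f z‖ ≤ C := by
  obtain ⟨C, hC0, hC⟩ := exists_norm_le_of_entireForms hr hv hf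
  refine ⟨C * max 1 δ⁻¹ ^ r, fun z hz => (hC z).trans ?_⟩
  have := z.im_pos
  gcongr

/-! ### Holomorphy and boundary growth of entire forms in the disk coordinate. -/

theorem differentiableOn_of_mem_modularForms {r : ℝ} {v : SL(2, ℤ) → ℂˣ} {f : ℍ → ℂ}
    (hf : f ∈ modularForms r v) : DifferentiableOn ℂ (fun z => f (ofComplex z)) {z | 0 < z.im} :=
  mdifferentiable_iff.1 hf.1

theorem inDisk_im_pos {w : ℂ} (hw : ‖w‖ < 1) : 0 < (I * (1 + w) / (1 - w)).im := by
  have := cayley_im_neg hw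
  rw [neg_mul, neg_div, neg_im] at this
  linarith

theorem toDisk_inDisk {w : ℂ} (hw : ‖w‖ < 1) : toDisk (I * (1 + w) / (1 - w)) = w := by
  have h1 : 1 - w ≠ 0 := sub_ne_zero.2 (ne_one_of_norm_lt hw).symm
  have h2 := add_I_ne_zero (inDisk_im_pos hw)
  rw [toDisk, div_eq_iff h2]
  field_simp
  ring

theorem differentiableOn_inDisk {F : ℂ → ℂ} (hF : DifferentiableOn ℂ F {z | 0 < z.im}) :
    DifferentiableOn ℂ (inDisk F) (Metric.ball 0 1) := by
  refine hF.comp (f := fun w => I * (1 + w) / (1 - w)) ?_ fun w hw => inDisk_im_pos (by simpa using hw)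
  intro w hw
  have hw : ‖w‖ < 1 := by simpa using hw
  have h1 : 1 - w ≠ 0 := sub_ne_zero.2 (ne_one_of_norm_lt hw).symm
  fun_prop (disch := exact h1)

theorem differentiableOn_plusPart {r : ℝ} {h : ℍ → ℂ}
    (hh : DifferentiableOn ℂ (fun z => h (ofComplex z)) {z | 0 < z.im}) :
    DifferentiableOn ℂ (plusPart r h) {z | 0 < z.im} := by
  refine DifferentiableOn.mul ?_ hh
  intro z hz
  refine DifferentiableAt.differentiableWithinAt ?_
  refine DifferentiableAt.cpow (by fun_prop) (by fun_prop) ?_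
  refine Or.inr ?_
  simp
  have : 0 < z.im := hz
  linarith

/-- The weight factor contributes `|z + i|^r` and the form `max(1, 1/y)^r`. Both `|z + i| = 2/|1 -
w|` and `|z + i|/y` are at most `4/(1 - |w|)`. -/
theorem exists_norm_inDisk_plusPart_le {r : ℝ} (hr : 0 < r) {v : SL(2, ℤ) → ℂˣ}
    (hv : IsMultiplierSystem r v) {f : ℍ → ℂ} (hf : f ∈ entireForms r v) :
    ∃ C : ℝ, 0 ≤ C ∧ ∀ w : ℂ, ‖w‖ < 1 →
      ‖inDisk (plusPart r f) w‖ ≤ C * (4 / (1 - ‖w‖)) ^ r := by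
  obtain ⟨C, hC0, hC⟩ := exists_norm_le_of_entireForms hr hv hf
  refine ⟨C, hC0, fun w hw => ?_⟩
  have him := inDisk_im_pos hw
  have htw := toDisk_inDisk hw
  have h1w : 1 - w ≠ 0 := sub_ne_zero.2 (ne_one_of_norm_lt hw).symm
  have hzI : I * (1 + w) / (1 - w) + I = 2 * I / (1 - w) := by field_simp; ring
  rw [inDisk, plusPart]
  set z := I * (1 + w) / (1 - w)
  have h1 : 0 < 1 - ‖w‖ := by linarith
  have hn1 : ‖z + I‖ ≤ 4 / (1 - ‖w‖) := by
    rw [hzI, norm_div, norm_mul, norm_I, Complex.norm_ofNat, mul_one]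
    have : 1 - ‖w‖ ≤ ‖1 - w‖ := by simpa using norm_sub_norm_le (1 : ℂ) w
    gcongr
    norm_num
  -- This permits replacing `|z + i|` by its square, the quantity in `|z + i|² (1 - |w|²) = 4y`.
  have hge : 1 ≤ ‖z + I‖ := by
    have := (le_abs_self _).trans (abs_im_le_norm (z + I))
    simp at this
    linarith
  have hn2 : ‖z + I‖ * z.im⁻¹ ≤ 4 / (1 - ‖w‖) := by
    have h2 := one_sub_normSq_toDisk him
    rw [htw, eq_div_iff (by positivity)] at h2
    rw [le_div_iff₀ h1, ← div_eq_mul_inv, div_mul_eq_mul_div, div_le_iff₀ him, ← h2]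
    have h3 : 1 - ‖w‖ ≤ 1 - ‖w‖ ^ 2 := by nlinarith [norm_nonneg w]
    calc ‖z + I‖ * (1 - ‖w‖) ≤ ‖z + I‖ ^ 2 * (1 - ‖w‖ ^ 2) := by
          gcongr
          nlinarith
      _ = _ := by ring
  rw [norm_mul, norm_cpow_real, show -I - z = -(z + I) by ring, norm_neg, ofComplex_apply_of_im_pos him]
  calc ‖z + I‖ ^ r * ‖f ⟨z, him⟩‖ ≤ ‖z + I‖ ^ r * (C * max 1 z.im⁻¹ ^ r) := by
        gcongr
        exact hC ⟨z, him⟩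
    _ = C * (‖z + I‖ * max 1 z.im⁻¹) ^ r := by
        rw [Real.mul_rpow (by positivity) (by positivity)]
        ring
    _ ≤ _ := by
        gcongr
        rw [mul_max_of_nonneg _ _ (norm_nonneg _), mul_one]
        exact max_le hn1 hn2

/-- Cauchy's estimate on the circle of radius `c = (n + 1)/(n + 2)`: there `1/(1 - c) = n + 2`,
while `c^(-n)` stays below `e`. -/
theorem exists_norm_taylorCoeff_le {r : ℝ} {F : ℂ → ℂ}
    (hF : DifferentiableOn ℂ F (Metric.ball 0 1)) {C : ℝ} (hC : 0 ≤ C)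
    (hb : ∀ w : ℂ, ‖w‖ < 1 → ‖F w‖ ≤ C * (4 / (1 - ‖w‖)) ^ r) :
    ∃ (C' : ℝ) (N : ℕ), ∀ n, ‖taylorCoeff F n‖ ≤ C' * (n + 1 : ℝ) ^ N := by
  obtain ⟨N, hN⟩ := exists_nat_ge r
  refine ⟨C * 8 ^ N * Real.exp 1, N, fun n => ?_⟩
  set c : ℝ := (n + 1) / (n + 2)
  have hc0 : 0 < c := by positivity
  have hc1 : c < 1 := by rw [div_lt_one (by positivity)]; linarith
  have hc2 : 4 / (1 - c) = 4 * (n + 2) := by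
    have : 1 - c = 1 / (n + 2) := by simp only [c]; field_simp; ring
    rw [this]
    field_simp
  have hd : DiffContOnCl ℂ F (Metric.ball 0 c) := by
    refine DifferentiableOn.diffContOnCl ?_
    rw [closure_ball _ hc0.ne']
    exact hF.mono (Metric.closedBall_subset_ball hc1)
  have h := norm_iteratedDeriv_le_of_forall_mem_sphere_norm_le n hc0 hd (fun z hz => by
    have hz : ‖z‖ = c := by simpa using hz
    have := hb z (by rwa [hz])
    rwa [hz, hc2] at this)
  have hM : (4 * (n + 2) : ℝ) ^ r ≤ 8 ^ N * (n + 1 : ℝ) ^ N := by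
    calc (4 * (n + 2) : ℝ) ^ r ≤ (4 * (n + 2) : ℝ) ^ (N : ℝ) := by
          apply Real.rpow_le_rpow_of_exponent_le _ hN
          linarith [(by positivity : (0 : ℝ) ≤ n)]
      _ = (4 * (n + 2) : ℝ) ^ N := Real.rpow_natCast _ _
      _ ≤ (8 * (n + 1) : ℝ) ^ N := by
          gcongr ?_ ^ N
          linarith [(by positivity : (0 : ℝ) ≤ n)]
      _ = _ := mul_pow _ _ _
  have hcn : (c ^ n)⁻¹ ≤ Real.exp 1 := by
    have h1 : c⁻¹ ≤ Real.exp (1 / (n + 1)) := by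
      have := Real.add_one_le_exp (1 / (n + 1 : ℝ))
      refine le_trans (le_of_eq ?_) this
      simp only [c]
      field_simp
      ring
    calc (c ^ n)⁻¹ = c⁻¹ ^ n := (inv_pow _ _).symm
      _ ≤ Real.exp (1 / (n + 1)) ^ n := by gcongr
      _ = Real.exp (n * (1 / (n + 1))) := (Real.exp_nat_mul _ _).symm
      _ ≤ Real.exp 1 := by
        gcongr
        rw [mul_one_div, div_le_one (by positivity)]
        linarith
  rw [taylorCoeff, norm_mul, norm_inv, Complex.norm_natCast, inv_mul_le_iff₀ (by positivity)]
  refine h.trans ?_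
  rw [div_eq_mul_inv, mul_assoc]
  refine mul_le_mul_of_nonneg_left ?_ (by positivity)
  calc C * (4 * (n + 2) : ℝ) ^ r * (c ^ n)⁻¹
      ≤ C * (8 ^ N * (n + 1 : ℝ) ^ N) * Real.exp 1 := by gcongr
    _ = _ := by ring

/-! ## Products of principal powers -/

/-- The arguments lie in `[-π/2, π/2]` and `(-π/2, π/2)`, so their sum stays in the principal range.
All manipulations of powers in the disk coordinate are reduced to this case. -/
theorem mul_cpow_of_re {x y : ℂ} (hx : 0 ≤ x.re) (hx0 : x ≠ 0) (hy : 0 < y.re) (s : ℂ) :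
    (x * y) ^ s = x ^ s * y ^ s := by
  have hy0 : y ≠ 0 := by rintro rfl; simp at hy
  have h1 := abs_le.1 (abs_arg_le_pi_div_two_iff.2 hx)
  have h2 := abs_lt.1 (abs_arg_lt_pi_div_two_iff.2 (Or.inl hy))
  have h := log_mul hx0 hy0 ⟨by linarith [h1.1, h2.1], by linarith [h1.2, h2.2]⟩
  rw [cpow_def_of_ne_zero (mul_ne_zero hx0 hy0), cpow_def_of_ne_zero hx0,
    cpow_def_of_ne_zero hy0, h, ← exp_add]
  ring_nf

theorem inv_re_pos {x : ℂ} (hx : 0 < x.re) : 0 < x⁻¹.re := by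
  rw [inv_re]
  have : x ≠ 0 := by rintro rfl; simp at hx
  exact div_pos hx (Complex.normSq_pos.2 this)

/-- Multiplication by `-i` turns the upper half-plane into the right half-plane, where
`mul_cpow_of_re` applies; the powers of `i` cancel. -/
theorem div_cpow_of_im_pos {p q : ℂ} (hp : 0 < p.im) (hq : 0 < q.im) (s : ℂ) :
    (q / p) ^ s = q ^ s * p ^ (-s) := by
  have hp' : 0 < (-I * p).re := by simpa using hp
  have hq' : 0 < (-I * q).re := by simpa using hq
  have hp0 : -I * p ≠ 0 := by intro h; rw [h] at hp'; simp at hp'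
  have hq0 : -I * q ≠ 0 := by intro h; rw [h] at hq'; simp at hq'
  have e1 : p ^ (-s) = I ^ (-s) * (-I * p) ^ (-s) := by
    rw [← mul_cpow_of_re (by simp) I_ne_zero hp']
    congr 1
    linear_combination p * I_sq
  have e2 : q ^ s = I ^ s * (-I * q) ^ s := by
    rw [← mul_cpow_of_re (by simp) I_ne_zero hq']
    congr 1
    linear_combination q * I_sq
  have e3 : q / p = (-I * q) * (-I * p)⁻¹ := by
    rw [← div_eq_mul_inv, mul_div_mul_left _ _ (by simp)]
  have harg : (-I * p).arg ≠ Real.pi := (arg_lt_pi_iff.2 (Or.inl hp'.le)).ne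
  have hI : I ^ s * I ^ (-s) = 1 := by rw [← cpow_add _ _ I_ne_zero, add_neg_cancel, cpow_zero]
  rw [e1, e2, e3, mul_cpow_of_re hq'.le hq0 (inv_re_pos hp'), inv_cpow _ _ harg, cpow_neg (-I * p)]
  linear_combination (-((-I * q) ^ s * ((-I * p) ^ s)⁻¹)) * hI

/-! ## The beta kernel and Feynman's formula -/

/-- The integrand `u ^ (β - 1) (1 - u) ^ (α - 1)` of the beta integral. -/
def betaKernel (α β u : ℝ) : ℝ := u ^ (β - 1) * (1 - u) ^ (α - 1)

theorem betaKernel_nonneg {α β u : ℝ} (hu : u ∈ Icc (0 : ℝ) 1) : 0 ≤ betaKernel α β u :=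
  mul_nonneg (Real.rpow_nonneg hu.1 _) (Real.rpow_nonneg (by linarith [hu.2]) _)

theorem ofReal_betaKernel {α β u : ℝ} (hu : u ∈ Icc (0 : ℝ) 1) :
    (betaKernel α β u : ℂ) = (u : ℂ) ^ ((β : ℂ) - 1) * (1 - (u : ℂ)) ^ ((α : ℂ) - 1) := by
  have h1 : 0 ≤ 1 - u := by linarith [hu.2]
  rw [betaKernel, ofReal_mul, ofReal_cpow hu.1, ofReal_cpow h1]
  push_cast
  rfl

theorem intervalIntegrable_ofReal_betaKernel {α β : ℝ} (hα : 0 < α) (hβ : 0 < β) :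
    IntervalIntegrable (fun u => ((betaKernel α β u : ℝ) : ℂ)) volume 0 1 := by
  refine (betaIntegral_convergent (u := β) (v := α) (by simpa) (by simpa)).congr fun u hu => ?_
  rw [uIoc_of_le zero_le_one] at hu
  exact (ofReal_betaKernel ⟨hu.1.le, hu.2⟩).symm

theorem intervalIntegrable_betaKernel {α β : ℝ} (hα : 0 < α) (hβ : 0 < β) :
    IntervalIntegrable (betaKernel α β) volume 0 1 := by
  refine (intervalIntegrable_ofReal_betaKernel hα hβ).norm.congr fun u hu => ?_
  rw [uIoc_of_le zero_le_one] at hu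
  simp only [norm_real]
  exact Real.norm_of_nonneg (betaKernel_nonneg ⟨hu.1.le, hu.2⟩)

theorem integral_betaKernel {α β : ℝ} (hα : 0 < α) (hβ : 0 < β) :
    ∫ u in (0 : ℝ)..1, (betaKernel α β u : ℂ) =
      ((Real.Gamma α * Real.Gamma β / Real.Gamma (α + β) : ℝ) : ℂ) := by
  have h := betaIntegral_eq_Gamma_mul_div β α (by simpa) (by simpa)
  rw [betaIntegral] at h
  rw [show ∫ u in (0 : ℝ)..1, (betaKernel α β u : ℂ) = _ from
    intervalIntegral.integral_congr fun u hu => ofReal_betaKernel (by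
      rwa [uIcc_of_le zero_le_one] at hu), h]
  push_cast
  rw [← Gamma_ofReal, ← Gamma_ofReal, ← Gamma_ofReal]
  push_cast
  rw [mul_comm, add_comm]

theorem Gamma_add_nat_eq {a : ℝ} (ha : 0 < a) (n : ℕ) :
    Real.Gamma (a + n) = Real.Gamma a * (n.factorial * binomCoeff a n) := by
  induction n with
  | zero => simp [binomCoeff_zero]
  | succ n ih =>
    rw [Nat.cast_succ, ← add_assoc, Real.Gamma_add_one (by positivity), ih, binomCoeff_succ,
      Nat.factorial_succ]
    push_cast
    field_simp

theorem summable_binomCoeff_mul {r : ℝ} (hr : 0 < r) {ρ : ℝ} (h0 : 0 ≤ ρ) (h1 : ρ < 1) :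
    Summable fun n => binomCoeff r n * ρ ^ n := by
  obtain ⟨k, hk⟩ := exists_binomCoeff_le hr
  refine Summable.of_nonneg_of_le
    (fun n => mul_nonneg (binomCoeff_pos hr n).le (by positivity)) (fun n => ?_)
    (summable_poly_mul_geometric k h0 h1)
  gcongr
  exact hk n

/-- Feynman's formula near `1`. -/
theorem integral_betaKernel_mul_one_sub {α β : ℝ} (hα : 0 < α) (hβ : 0 < β) {a b : ℂ}
    (ha : ‖a‖ < 1) (hb : ‖b‖ < 1) :
    ∫ u in (0 : ℝ)..1, (betaKernel α β u : ℂ) * (1 - ((1 - u) * a + u * b)) ^ (-(α + β : ℝ) : ℂ) =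
      ((Real.Gamma α * Real.Gamma β / Real.Gamma (α + β) : ℝ) : ℂ) *
        ((1 - a) ^ (-α : ℂ) * (1 - b) ^ (-β : ℂ)) := by
  have hr : 0 < α + β := by positivity
  set ρ := max ‖a‖ ‖b‖
  have hρ0 : 0 ≤ ρ := (norm_nonneg a).trans (le_max_left _ _)
  have hρ1 : ρ < 1 := max_lt ha hb
  have hu_norm : ∀ u ∈ Icc (0 : ℝ) 1, ‖(1 - u) * a + u * b‖ ≤ ρ := by
    intro u hu
    have h1 : 0 ≤ 1 - u := by linarith [hu.2]
    calc ‖(1 - u) * a + u * b‖ ≤ ‖((1 - u : ℝ) : ℂ) * a‖ + ‖(u : ℂ) * b‖ := by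
          push_cast
          exact norm_add_le _ _
      _ = (1 - u) * ‖a‖ + u * ‖b‖ := by
          rw [norm_mul, norm_mul, norm_real, norm_real, Real.norm_of_nonneg h1,
            Real.norm_of_nonneg hu.1]
      _ ≤ (1 - u) * ρ + u * ρ := by
          gcongr
          · exact le_max_left _ _
          · exact hu.1
          · exact le_max_right _ _
      _ = ρ := by ring
  have hK := intervalIntegrable_betaKernel hα hβ
  -- The power is expanded in a binomial series. Expanding the `n`-th power of the convex
  -- combination in turn gives beta integrals with parameters `α + k`, `β + l`, `k + l = n`. Their
  -- Gamma factors convert the sum into the Cauchy product of the series of `(1 - a)^(-α)` and `(1 -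
  -- b)^(-β)`.
  have hsum : HasSum (fun n => ∫ u in (0 : ℝ)..1, (betaKernel α β u : ℂ) *
        ((binomCoeff (α + β) n : ℂ) * ((1 - u) * a + u * b) ^ n))
      (∫ u in (0 : ℝ)..1,
        (betaKernel α β u : ℂ) * (1 - ((1 - u) * a + u * b)) ^ (-(α + β : ℝ) : ℂ)) := by
    refine intervalIntegral.hasSum_integral_of_dominated_convergence
      (fun n u => betaKernel α β u * (binomCoeff (α + β) n * ρ ^ n)) ?_ ?_ ?_ ?_ ?_
    · intro n
      rw [uIoc_of_le zero_le_one]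
      refine AEStronglyMeasurable.mul ?_ (by fun_prop)
      exact continuous_ofReal.comp_aestronglyMeasurable
        ((intervalIntegrable_iff_integrableOn_Ioc_of_le zero_le_one).1 hK).aestronglyMeasurable
    · refine fun n => Eventually.of_forall fun u hu => ?_
      rw [uIoc_of_le zero_le_one] at hu
      have hu : u ∈ Icc (0 : ℝ) 1 := ⟨hu.1.le, hu.2⟩
      have h1 := betaKernel_nonneg (α := α) (β := β) hu
      have h2 := (binomCoeff_pos hr n).le
      rw [norm_mul, norm_mul, norm_pow, norm_real, norm_real, Real.norm_of_nonneg h1,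
        Real.norm_of_nonneg h2]
      gcongr
      exact hu_norm u hu
    · exact Eventually.of_forall fun u _ => (summable_binomCoeff_mul hr hρ0 hρ1).mul_left _
    · simp_rw [tsum_mul_left]
      exact hK.mul_const _
    · refine Eventually.of_forall fun u hu => ?_
      rw [uIoc_of_le zero_le_one] at hu
      have hu : u ∈ Icc (0 : ℝ) 1 := ⟨hu.1.le, hu.2⟩
      exact (hasSum_binomCoeff (α + β) ((hu_norm u hu).trans_lt hρ1)).mul_left _
  have hterm : ∀ n, ∫ u in (0 : ℝ)..1, (betaKernel α β u : ℂ) *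
        ((binomCoeff (α + β) n : ℂ) * ((1 - u) * a + u * b) ^ n) =
      ((Real.Gamma α * Real.Gamma β / Real.Gamma (α + β) : ℝ) : ℂ) *
        ∑ kl ∈ Finset.HasAntidiagonal.antidiagonal n, (binomCoeff α kl.1 : ℂ) * a ^ kl.1 *
          ((binomCoeff β kl.2 : ℂ) * b ^ kl.2) := by
    intro n
    have hexp : ∀ u ∈ Ioo (0 : ℝ) 1, (betaKernel α β u : ℂ) *
        ((binomCoeff (α + β) n : ℂ) * ((1 - u) * a + u * b) ^ n) =
        ∑ kl ∈ Finset.HasAntidiagonal.antidiagonal n, (betaKernel (α + kl.1) (β + kl.2) u : ℂ) *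
          ((binomCoeff (α + β) n : ℂ) * n.choose kl.1 * a ^ kl.1 * b ^ kl.2) := by
      intro u hu
      rw [(Commute.all _ _).add_pow', Finset.mul_sum, Finset.mul_sum]
      refine Finset.sum_congr rfl fun kl _ => ?_
      have h1 : 0 < 1 - u := by linarith [hu.2]
      have e : betaKernel (α + kl.1) (β + kl.2) u
          = betaKernel α β u * ((1 - u) ^ kl.1 * u ^ kl.2) := by
        rw [betaKernel, betaKernel, add_sub_right_comm, add_sub_right_comm, Real.rpow_add hu.1,
          Real.rpow_add h1, Real.rpow_natCast, Real.rpow_natCast]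
        ring
      rw [e]
      push_cast
      rw [nsmul_eq_mul, mul_pow, mul_pow]
      ring
    rw [intervalIntegral.integral_of_le zero_le_one, integral_Ioc_eq_integral_Ioo,
      setIntegral_congr_fun measurableSet_Ioo hexp, ← integral_Ioc_eq_integral_Ioo,
      ← intervalIntegral.integral_of_le zero_le_one, intervalIntegral.integral_finsetSum]
    · rw [Finset.mul_sum]
      refine Finset.sum_congr rfl fun kl hkl => ?_
      rw [Finset.HasAntidiagonal.mem_antidiagonal] at hkl
      rw [intervalIntegral.integral_mul_const,
        integral_betaKernel (add_pos_of_pos_of_nonneg hα (by positivity))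
          (add_pos_of_pos_of_nonneg hβ (by positivity))]
      have e1 : α + kl.1 + (β + kl.2) = α + β + n := by rw [← hkl]; push_cast; ring
      rw [e1, Gamma_add_nat_eq hα, Gamma_add_nat_eq hβ, Gamma_add_nat_eq hr]
      have e2 : (n.factorial : ℝ) = n.choose kl.1 * (kl.1.factorial * kl.2.factorial) := by
        have := Nat.add_choose_mul_factorial_mul_factorial kl.1 kl.2
        rw [hkl] at this
        rw [← this, Nat.choose_symm_of_eq_add hkl.symm]
        push_cast
        ring
      have e3 : (Real.Gamma α * (kl.1.factorial * binomCoeff α kl.1) *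
          (Real.Gamma β * (kl.2.factorial * binomCoeff β kl.2)) /
          (Real.Gamma (α + β) * (n.factorial * binomCoeff (α + β) n))) *
          (binomCoeff (α + β) n * n.choose kl.1) =
          (Real.Gamma α * Real.Gamma β / Real.Gamma (α + β)) *
            (binomCoeff α kl.1 * binomCoeff β kl.2) := by
        have := (Real.Gamma_pos_of_pos hr).ne'
        have := (binomCoeff_pos hr n).ne'
        have := (n.factorial_pos).ne'
        field_simp
        rw [e2]
        ring
      have e4 := congrArg (fun x : ℝ => (x : ℂ)) e3
      simp only [ofReal_mul, ofReal_natCast] at e4 ⊢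
      linear_combination (a ^ kl.1 * b ^ kl.2) * e4
    · intro kl _
      exact (intervalIntegrable_ofReal_betaKernel (add_pos_of_pos_of_nonneg hα (by positivity))
        (add_pos_of_pos_of_nonneg hβ (by positivity))).mul_const _
  simp_rw [hterm] at hsum
  have hn : ∀ {s : ℝ} {x : ℂ}, 0 < s → ‖x‖ < 1 → Summable fun n => ‖(binomCoeff s n : ℂ) * x ^ n‖ := by
    intro s x hs hx
    refine (summable_binomCoeff_mul hs (norm_nonneg x) hx).congr fun n => ?_
    rw [norm_mul, norm_pow, norm_real, Real.norm_of_nonneg (binomCoeff_pos hs n).le]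
  rw [← hsum.tsum_eq, tsum_mul_left,
    ← tsum_mul_tsum_eq_tsum_sum_antidiagonal_of_summable_norm (hn hα ha) (hn hβ hb),
    (hasSum_binomCoeff α ha).tsum_eq, (hasSum_binomCoeff β hb).tsum_eq]

/-- Since `|1 - A/(iM)|² = 1 - (2 Im A - |A|²/M)/M`, a large `M` moves `A/(iM)` into the unit disk
around `1`, where the binomial series converges. -/
theorem exists_scale {A : ℂ} (hA : 0 < A.im) :
    ∃ M₀ : ℝ, ∀ M > M₀, 0 < M → ‖1 - A / (I * M)‖ < 1 := by
  refine ⟨‖A‖ ^ 2 / A.im, fun M hM hM0 => ?_⟩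
  have h1 : ‖1 - A / (I * M)‖ ^ 2 < 1 := by
    have e : 1 - A / (I * M) = 1 + I * A * ((M⁻¹ : ℝ) : ℂ) := by
      have : (M : ℂ) ≠ 0 := by exact_mod_cast hM0.ne'
      push_cast
      field_simp
      linear_combination (-A) * I_sq
    rw [gt_iff_lt, div_lt_iff₀ hA, ← normSq_eq_norm_sq, normSq_apply] at hM
    rw [e, ← normSq_eq_norm_sq, normSq_apply]
    simp only [add_re, one_re, mul_re, Complex.I_re, Complex.I_im, mul_im, ofReal_re, ofReal_im, add_im, one_im,
      zero_mul, one_mul, mul_zero, zero_sub, sub_zero, zero_add]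
    have e2 : (1 + -A.im * M⁻¹) * (1 + -A.im * M⁻¹) + A.re * M⁻¹ * (A.re * M⁻¹) =
        1 - M⁻¹ * (2 * A.im - (A.re * A.re + A.im * A.im) * M⁻¹) := by ring
    rw [e2]
    have h3 : (A.re * A.re + A.im * A.im) * M⁻¹ < A.im := by
      rw [← div_eq_mul_inv, div_lt_iff₀ hM0]
      linarith
    have : 0 < M⁻¹ := by positivity
    nlinarith
  nlinarith [norm_nonneg (1 - A / (I * M))]

/-- Feynman's formula for `A`, `B` in the upper half-plane. -/
theorem integral_betaKernel_mul_cpow {α β : ℝ} (hα : 0 < α) (hβ : 0 < β) {A B : ℂ}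
    (hA : 0 < A.im) (hB : 0 < B.im) :
    ∫ u in (0 : ℝ)..1, (betaKernel α β u : ℂ) * ((1 - u) * A + u * B) ^ (-(α + β : ℝ) : ℂ) =
      ((Real.Gamma α * Real.Gamma β / Real.Gamma (α + β) : ℝ) : ℂ) *
        (A ^ (-α : ℂ) * B ^ (-β : ℂ)) := by
  obtain ⟨M₁, h1⟩ := exists_scale hA
  obtain ⟨M₂, h2⟩ := exists_scale hB
  -- One scale for both points. Both sides of the formula are homogeneous of degree `-(α + β)` under
  -- division by `iM`, so the case near `1` suffices.
  set M : ℝ := max (max M₁ M₂) 0 + 1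
  have hM0 : 0 < M := by positivity
  have hM1 : M₁ < M := by
    have := (le_max_left M₁ M₂).trans (le_max_left _ (0 : ℝ))
    simp only [M]; linarith
  have hM2 : M₂ < M := by
    have := (le_max_right M₁ M₂).trans (le_max_left _ (0 : ℝ))
    simp only [M]; linarith
  have hMI : (I * M : ℂ) ≠ 0 := mul_ne_zero I_ne_zero (by exact_mod_cast hM0.ne')
  set a := 1 - A / (I * M)
  set b := 1 - B / (I * M)
  have ha : ‖a‖ < 1 := h1 M hM1 hM0
  have hb : ‖b‖ < 1 := h2 M hM2 hM0
  have hre : ∀ x : ℂ, ‖x‖ < 1 → 0 < (1 - x).re := by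
    intro x hx
    have := (le_abs_self _).trans (abs_re_le_norm x)
    simp
    linarith
  have hsplit : ∀ x : ℂ, ‖x‖ < 1 → ∀ s : ℂ,
      ((I * M) * (1 - x)) ^ s = (I * M : ℂ) ^ s * (1 - x) ^ s := fun x hx s =>
    mul_cpow_of_re (by simp) hMI (hre x hx) s
  have eA : A = (I * M) * (1 - a) := by simp only [a]; rw [sub_sub_cancel, mul_div_cancel₀ _ hMI]
  have eB : B = (I * M) * (1 - b) := by simp only [b]; rw [sub_sub_cancel, mul_div_cancel₀ _ hMI]
  have hint : ∫ u in (0 : ℝ)..1,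
      (betaKernel α β u : ℂ) * ((1 - u) * A + u * B) ^ (-(α + β : ℝ) : ℂ) =
      ∫ u in (0 : ℝ)..1, (I * M : ℂ) ^ (-(α + β : ℝ) : ℂ) *
        ((betaKernel α β u : ℂ) * (1 - ((1 - u) * a + u * b)) ^ (-(α + β : ℝ) : ℂ)) := by
    refine intervalIntegral.integral_congr fun u hu => ?_
    rw [uIcc_of_le zero_le_one] at hu
    have h1 : 0 ≤ 1 - u := by linarith [hu.2]
    have hlt : ‖(1 - u) * a + u * b‖ < 1 := by
      have := (convex_ball (0 : ℂ) 1) (by simpa using ha : a ∈ Metric.ball (0 : ℂ) 1)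
        (by simpa using hb : b ∈ Metric.ball (0 : ℂ) 1) h1 hu.1 (by ring)
      simpa [real_smul] using this
    have e : (1 - u) * A + u * B = (I * M) * (1 - ((1 - u) * a + u * b)) := by
      rw [eA, eB]
      ring
    rw [e, hsplit _ hlt]
    ring
  rw [hint, intervalIntegral.integral_const_mul, integral_betaKernel_mul_one_sub hα hβ ha hb]
  rw [eA, eB, hsplit a ha, hsplit b hb]
  have : (I * M : ℂ) ^ (-(α + β : ℝ) : ℂ) = (I * M : ℂ) ^ (-α : ℂ) * (I * M : ℂ) ^ (-β : ℂ) := by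
    rw [← cpow_add _ _ hMI]
    congr 1
    push_cast
    ring
  rw [this]
  ring

/-! ## Superpositions of the functions `(z - t) ^ (-r)` -/

/-- The left side is at most `k!` times a single term of `∑ (n + k choose k) ρⁿ = (1 - ρ)^(-(k+1))`.
-/
theorem succ_pow_mul_pow_le (k n : ℕ) {ρ : ℝ} (h0 : 0 ≤ ρ) (h1 : ρ < 1) :
    (n + 1 : ℝ) ^ k * ρ ^ n ≤ k.factorial * (1 - ρ)⁻¹ ^ (k + 1) := by
  have h := hasSum_choose_mul_geometric_of_norm_lt_one k (r := ρ) (by rwa [Real.norm_of_nonneg h0])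
  have h2 := le_hasSum h n fun m _ => by positivity
  have h3 : (n + 1 : ℝ) ^ k ≤ k.factorial * (n + k).choose k := by
    have := Nat.pow_succ_le_ascFactorial (n + 1) k
    rw [Nat.ascFactorial_eq_factorial_mul_choose] at this
    exact_mod_cast this
  rw [one_div, ← inv_pow] at h2
  calc (n + 1 : ℝ) ^ k * ρ ^ n ≤ k.factorial * (n + k).choose k * ρ ^ n := by gcongr
    _ = k.factorial * ((n + k).choose k * ρ ^ n) := by ring
    _ ≤ _ := by gcongr

section Superposition

variable {Ω : Type*} [MeasurableSpace Ω] {μ : Measure Ω} {w g : Ω → ℂ}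

/-- All moments of the density `g` against inverse powers of the distance of `w` to the boundary
of the unit disk are finite. -/
structure HasMoments (μ : Measure Ω) (w g : Ω → ℂ) : Prop where
  measurable : AEStronglyMeasurable w μ
  lt_one : ∀ᵐ p ∂μ, ‖w p‖ < 1
  integrable : ∀ k : ℕ, Integrable (fun p => ‖g p‖ * (1 - ‖w p‖)⁻¹ ^ k) μ
  measurable' : AEStronglyMeasurable g μ

theorem HasMoments.integrable_mul_pow (h : HasMoments μ w g) (n : ℕ) :
    Integrable (fun p => ‖g p‖ * ‖w p‖ ^ n) μ := by
  refine Integrable.mono' (h.integrable 0) (h.measurable'.norm.mul (h.measurable.norm.pow n)) ?_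
  filter_upwards [h.lt_one] with p hp
  rw [Real.norm_of_nonneg (by positivity), pow_zero, mul_one]
  exact mul_le_of_le_one_right (norm_nonneg _) (pow_le_one₀ (norm_nonneg _) hp.le)

theorem HasMoments.summable (h : HasMoments μ w g) (k : ℕ) :
    Summable fun n : ℕ => (n + 1 : ℝ) ^ k * ∫ p, ‖g p‖ * ‖w p‖ ^ n ∂μ := by
  have hs2 : Summable fun n : ℕ => ((n + 1 : ℝ) ^ 2)⁻¹ := by
    have := (summable_nat_add_iff 1).2 (Real.summable_nat_pow_inv.2 (by norm_num : 1 < 2))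
    simpa using this
  -- Bounding `(n + 1)^(k+2) ‖w‖ⁿ` costs a moment of order `k + 3`; the two spare powers of `n + 1`
  -- provide summability.
  set K := ∫ p, ‖g p‖ * (1 - ‖w p‖)⁻¹ ^ (k + 2 + 1) ∂μ
  refine Summable.of_nonneg_of_le
    (fun n => mul_nonneg (by positivity) (integral_nonneg fun p => by positivity)) (fun n => ?_)
    (hs2.mul_left ((k + 2).factorial * K))
  have hn : (0 : ℝ) < (n + 1 : ℝ) ^ 2 := by positivity
  rw [← div_eq_mul_inv, le_div_iff₀ hn]
  have e : (n + 1 : ℝ) ^ k * (∫ p, ‖g p‖ * ‖w p‖ ^ n ∂μ) * (n + 1 : ℝ) ^ 2 =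
      ∫ p, (n + 1 : ℝ) ^ (k + 2) * (‖g p‖ * ‖w p‖ ^ n) ∂μ := by
    rw [integral_const_mul]
    ring
  rw [e, ← integral_const_mul]
  refine integral_mono_ae ((h.integrable_mul_pow n).const_mul _)
    ((h.integrable (k + 2 + 1)).const_mul _) ?_
  filter_upwards [h.lt_one] with p hp
  have := succ_pow_mul_pow_le (k + 2) n (norm_nonneg (w p)) hp
  calc (n + 1 : ℝ) ^ (k + 2) * (‖g p‖ * ‖w p‖ ^ n)
      = ‖g p‖ * ((n + 1 : ℝ) ^ (k + 2) * ‖w p‖ ^ n) := by ring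
    _ ≤ ‖g p‖ * ((k + 2).factorial * (1 - ‖w p‖)⁻¹ ^ (k + 2 + 1)) := by gcongr
    _ = _ := by ring

/-- Termwise integration of a power series with polynomially bounded coefficients. -/
theorem HasMoments.hasSum_integral (h : HasMoments μ w g) {d : ℕ → ℂ} {C : ℝ} {N : ℕ}
    (hd : ∀ n, ‖d n‖ ≤ C * (n + 1 : ℝ) ^ N) {F : ℂ → ℂ}
    (hF : ∀ x : ℂ, ‖x‖ < 1 → HasSum (fun n => d n * x ^ n) (F x)) :
    HasSum (fun n => d n * ∫ p, g p * w p ^ n ∂μ) (∫ p, g p * F (w p) ∂μ) := by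
  have hn : ∀ n p, ‖d n * (g p * w p ^ n)‖ = ‖d n‖ * (‖g p‖ * ‖w p‖ ^ n) := fun n p => by
    rw [norm_mul, norm_mul, norm_pow]
  have hm : ∀ n, AEStronglyMeasurable (fun p => d n * (g p * w p ^ n)) μ := fun n =>
    (h.measurable'.mul (h.measurable.pow n)).const_mul _
  have hint : ∀ n, Integrable (fun p => d n * (g p * w p ^ n)) μ := fun n =>
    ((h.integrable_mul_pow n).const_mul ‖d n‖).mono' (hm n)
      (Eventually.of_forall fun p => (hn n p).le)
  have hsum : Summable fun n => ∫ p, ‖d n * (g p * w p ^ n)‖ ∂μ := by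
    simp_rw [hn, integral_const_mul]
    refine Summable.of_nonneg_of_le
      (fun n => mul_nonneg (norm_nonneg _) (integral_nonneg fun p => by positivity)) (fun n => ?_)
      ((h.summable N).mul_left C)
    rw [← mul_assoc]
    exact mul_le_mul_of_nonneg_right (hd n) (integral_nonneg fun p => by positivity)
  have := hasSum_integral_of_summable_integral_norm hint hsum
  simp_rw [integral_const_mul] at this
  have e : ∫ p, g p * F (w p) ∂μ = ∫ p, ∑' n, d n * (g p * w p ^ n) ∂μ := by
    refine integral_congr_ae ?_
    filter_upwards [h.lt_one] with p hp
    rw [← (hF _ hp).tsum_eq, ← tsum_mul_left]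
    exact tsum_congr fun n => by ring
  rwa [e]

variable {r : ℝ} {f : LowerHalfPlane → ℂ}

/-- The binomial series of `(1 - x w)^(-r)` is integrated termwise. The moments of `g` give decay of
`∫ g wⁿ` faster than any power, which the polynomially bounded binomial coefficients do not spoil.
-/
theorem HasMoments.isDiskSeries (h : HasMoments μ w g) (hr : 0 < r)
    (hf : ∀ x : ℂ, ‖x‖ < 1 → diskMinus r f x = ∫ p, g p * (1 - x * w p) ^ (-r : ℂ) ∂μ) :
    IsDiskSeries r f fun n => binomCoeff r n * ∫ p, g p * w p ^ n ∂μ := by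
  obtain ⟨N, hN⟩ := exists_binomCoeff_le hr
  have hnorm : ∀ n, ‖(binomCoeff r n : ℂ)‖ ≤ (n + 1 : ℝ) ^ N := fun n => by
    rw [norm_real, Real.norm_of_nonneg (binomCoeff_pos hr n).le]
    exact hN n
  refine ⟨fun k => ?_, fun x hx => ?_⟩
  · refine Summable.of_nonneg_of_le (fun n => by positivity) (fun n => ?_) (h.summable (N + k))
    have h1 : ‖∫ p, g p * w p ^ n ∂μ‖ ≤ ∫ p, ‖g p‖ * ‖w p‖ ^ n ∂μ := by
      refine (norm_integral_le_integral_norm _).trans_eq ?_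
      simp_rw [norm_mul, norm_pow]
    rw [norm_mul, pow_add]
    calc ‖(binomCoeff r n : ℂ)‖ * ‖∫ p, g p * w p ^ n ∂μ‖ * (n + 1 : ℝ) ^ k
        ≤ (n + 1 : ℝ) ^ N * (∫ p, ‖g p‖ * ‖w p‖ ^ n ∂μ) * (n + 1 : ℝ) ^ k := by
          gcongr
          exact hnorm n
      _ = _ := by ring
  · have hx : ‖x‖ < 1 := by simpa using hx
    rw [hf x hx]
    refine (h.hasSum_integral (d := fun n => binomCoeff r n * x ^ n) (C := 1) (N := N)
      (F := fun y => (1 - x * y) ^ (-r : ℂ)) (fun n => ?_) (fun y hy => ?_)).tsum_eq ▸ ?_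
    · rw [norm_mul, norm_pow, one_mul]
      exact (mul_le_of_le_one_right (norm_nonneg _)
        (pow_le_one₀ (norm_nonneg _) hx.le)).trans (hnorm n)
    · have hxy : ‖x * y‖ < 1 := by
        rw [norm_mul]
        nlinarith [norm_nonneg x, norm_nonneg y]
      simpa only [mul_pow, mul_assoc] using hasSum_binomCoeff r hxy
    · exact tsum_congr fun n => by ring

/-- The reproducing property: the duality divides by exactly the coefficients that the kernel `(1 -
x w)^(-r)` brings in, and what remains is the Taylor series of `F` at `w`. -/
theorem HasMoments.tsum_eq (h : HasMoments μ w g) (hr : 0 < r) {F : ℂ → ℂ}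
    (hF : DifferentiableOn ℂ F (Metric.ball 0 1)) {C : ℝ} {N : ℕ}
    (hb : ∀ n, ‖taylorCoeff F n‖ ≤ C * (n + 1 : ℝ) ^ N) :
    ∑' n, taylorCoeff F n * (binomCoeff r n : ℂ)⁻¹ *
      (binomCoeff r n * ∫ p, g p * w p ^ n ∂μ) = ∫ p, g p * F (w p) ∂μ := by
  rw [← (h.hasSum_integral hb fun x hx => hasSum_taylorCoeff hF hx).tsum_eq]
  refine tsum_congr fun n => ?_
  have : (binomCoeff r n : ℂ) ≠ 0 := by exact_mod_cast (binomCoeff_pos hr n).ne'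
  field_simp

end Superposition

theorem half_re_pos {z : ℂ} (hz : 0 < z.im) : 0 < ((z + I) / (2 * I)).re := by
  have : (z + I) / (2 * I) = ((2⁻¹ : ℝ) : ℂ) * (-I * (z + I)) := by
    rw [div_eq_mul_inv, mul_inv, inv_I]
    push_cast
    ring
  rw [this, re_ofReal_mul]
  simp
  linarith

/-- The factorization of `z - t` in the disk coordinates `x` of `t` and `toDisk z` of `z`. -/
theorem cpow_mul_cpow_eq (r : ℝ) {z x : ℂ} (hz : 0 < z.im) (hx : ‖x‖ < 1) :
    (2 * I / (1 - x)) ^ (r : ℂ) * (z - (lowerPoint x hx).1) ^ (-r : ℂ) =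
      ((z + I) / (2 * I)) ^ (-r : ℂ) * (1 - x * toDisk z) ^ (-r : ℂ) := by
  have hx1 := ne_one_of_norm_lt hx
  have h1x : 1 - x ≠ 0 := sub_ne_zero.2 hx1.symm
  have hzI := add_I_ne_zero hz
  have hlow := (lowerPoint x hx).2
  have e : 2 * I / (1 - x) = I - (lowerPoint x hx).1 := (I_sub_cayley hx1).symm
  have hp : 0 < (2 * I / (1 - x)).im := by
    rw [e, sub_im, Complex.I_im]
    linarith
  have hq : 0 < (z - (lowerPoint x hx).1).im := by
    rw [sub_im]
    linarith
  have hre := half_re_pos hz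
  have hre2 : 0 < (1 - x * toDisk z).re := by
    have hlt : ‖x * toDisk z‖ < 1 := by
      rw [norm_mul]
      nlinarith [norm_nonneg x, norm_nonneg (toDisk z), norm_toDisk_lt_one hz]
    have := (le_abs_self _).trans (abs_re_le_norm (x * toDisk z))
    rw [sub_re, one_re]
    linarith
  have hd := div_cpow_of_im_pos hp hq (-r : ℂ)
  rw [neg_neg] at hd
  rw [mul_comm, ← hd, ← mul_cpow_of_re hre.le (div_ne_zero hzI (by simp)) hre2]
  congr 1
  simp only [lowerPoint, toDisk]
  field_simp
  ring

/-- The origin of the constant `(-2i)^r`: the weight factor of `h⁺` and the normalization of the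
kernel differ by it, since `-i - z = -2i · (z + i)/(2i)`. -/
theorem cpow_mul_inDisk_plusPart (r : ℝ) (h : ℍ → ℂ) {z : ℂ} (hz : 0 < z.im) :
    ((z + I) / (2 * I)) ^ (-r : ℂ) * inDisk (plusPart r h) (toDisk z) =
      (-2 * I) ^ (r : ℂ) * h (ofComplex z) := by
  have hre := half_re_pos hz
  have hne : (z + I) / (2 * I) ≠ 0 := div_ne_zero (add_I_ne_zero hz) (by simp)
  have e : -I - z = (-2 * I) * ((z + I) / (2 * I)) := by
    field_simp
    ring
  rw [inDisk_toDisk _ hz, plusPart, e, mul_cpow_of_re (by simp) (by simp) hre, cpow_neg]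
  have : ((z + I) / (2 * I)) ^ (r : ℂ) ≠ 0 := by simp [cpow_eq_zero_iff, hne]
  generalize ((z + I) / (2 * I)) ^ (r : ℂ) = c at *
  field_simp

/-! ## The triple integral -/

/-- The domain of the parameters `(s, y, u)` of the triple integral. -/
def tripleDomain : Set (ℝ × ℝ × ℝ) := Ioo 0 1 ×ˢ Ioi 1 ×ˢ Ioo 0 1

theorem measurableSet_tripleDomain : MeasurableSet tripleDomain :=
  measurableSet_Ioo.prod (measurableSet_Ioi.prod measurableSet_Ioo)

theorem volume_restrict_tripleDomain :
    (volume : Measure (ℝ × ℝ × ℝ)).restrict tripleDomain =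
      (volume.restrict (Ioo 0 1)).prod
        ((volume.restrict (Ioi 1)).prod (volume.restrict (Ioo 0 1))) := by
  rw [Measure.prod_restrict, Measure.prod_restrict]
  rfl

theorem integral_tripleDomain {H : ℝ × ℝ × ℝ → ℂ} (hH : IntegrableOn H tripleDomain) :
    ∫ p in tripleDomain, H p =
      ∫ s in Ioo (0 : ℝ) 1, ∫ y in Ioi (1 : ℝ), ∫ u in Ioo (0 : ℝ) 1, H (s, y, u) := by
  rw [IntegrableOn, volume_restrict_tripleDomain] at hH
  rw [volume_restrict_tripleDomain, integral_prod _ hH]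
  refine integral_congr_ae ?_
  filter_upwards [hH.prod_right_ae] with s hs
  exact integral_prod _ hs

/-- The point `τ₁ + u (τ₂ - τ₁)` with `τ₁ = γ s` and `τ₂ = i y`. -/
def triplePoint (γ : ℝ → ℂ) (p : ℝ × ℝ × ℝ) : ℂ := γ p.1 + p.2.2 * (I * p.2.1 - γ p.1)

/-- The density of the triple integral. -/
def tripleDensity (α β : ℝ) (A B : ℝ → ℂ) (p : ℝ × ℝ × ℝ) : ℂ :=
  A p.1 * B p.2.1 * (betaKernel α β p.2.2 : ℂ)

/-- Hypotheses on the path `γ` of `τ₁` and the densities `A` of `τ₁` and `B` of `τ₂`. -/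
structure TripleData (δ : ℝ) (γ A B : ℝ → ℂ) : Prop where
  pos : 0 < δ
  le_one : δ ≤ 1
  continuousOn_path : ContinuousOn γ (Ioo 0 1)
  le_im : ∀ s ∈ Ioo (0 : ℝ) 1, δ ≤ (γ s).im
  norm_le : ∀ s ∈ Ioo (0 : ℝ) 1, ‖γ s‖ ≤ 1
  continuousOn_left : ContinuousOn A (Ioo 0 1)
  integrableOn_left : IntegrableOn A (Ioo 0 1)
  continuousOn_right : ContinuousOn B (Ioi 1)
  integrableOn_right : ∀ k : ℕ, IntegrableOn (fun y => ‖B y‖ * y ^ k) (Ioi 1)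

namespace TripleData

variable {δ : ℝ} {γ A B : ℝ → ℂ} (h : TripleData δ γ A B)
include h

theorem le_im_triplePoint {p : ℝ × ℝ × ℝ} (hp : p ∈ tripleDomain) :
    δ ≤ (triplePoint γ p).im := by
  obtain ⟨hs, hy, hu⟩ := hp
  have h1 := h.le_im _ hs
  have h2 := h.le_one
  have hy : 1 < p.2.1 := hy
  have e : (triplePoint γ p).im = (1 - p.2.2) * (γ p.1).im + p.2.2 * p.2.1 := by
    simp [triplePoint]
    ring
  rw [e]
  nlinarith [hu.1, hu.2]

theorem im_triplePoint_pos {p : ℝ × ℝ × ℝ} (hp : p ∈ tripleDomain) :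
    0 < (triplePoint γ p).im := h.pos.trans_le (h.le_im_triplePoint hp)

theorem norm_triplePoint_add_I_le {p : ℝ × ℝ × ℝ} (hp : p ∈ tripleDomain) :
    ‖triplePoint γ p + I‖ ≤ 3 * p.2.1 := by
  obtain ⟨hs, hy, hu⟩ := hp
  have hy : 1 < p.2.1 := hy
  have e : triplePoint γ p + I =
      ((1 - p.2.2 : ℝ) : ℂ) * γ p.1 + (p.2.2 : ℂ) * (I * p.2.1) + I := by
    simp only [triplePoint]
    push_cast
    ring
  have h1 : 0 ≤ 1 - p.2.2 := by linarith [hu.2]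
  rw [e]
  refine (norm_add₃_le).trans ?_
  rw [norm_mul, norm_mul, norm_mul, norm_I, norm_real, norm_real, norm_real,
    Real.norm_of_nonneg h1, Real.norm_of_nonneg hu.1.le, Real.norm_of_nonneg (by linarith)]
  have h2 := h.norm_le _ hs
  nlinarith [hu.1, hu.2, norm_nonneg (γ p.1)]

theorem continuousOn_triplePoint : ContinuousOn (triplePoint γ) tripleDomain := by
  have h1 : ContinuousOn (fun p : ℝ × ℝ × ℝ => γ p.1) tripleDomain :=
    h.continuousOn_path.comp continuousOn_fst fun p hp => hp.1
  have h2 : ContinuousOn (fun p : ℝ × ℝ × ℝ => (p.2.2 : ℂ)) tripleDomain := by fun_prop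
  have h3 : ContinuousOn (fun p : ℝ × ℝ × ℝ => I * (p.2.1 : ℂ)) tripleDomain := by fun_prop
  exact h1.add (h2.mul (h3.sub h1))

theorem continuousOn_tripleDensity (α β : ℝ) :
    ContinuousOn (tripleDensity α β A B) tripleDomain := by
  have h1 : ContinuousOn (fun p : ℝ × ℝ × ℝ => A p.1) tripleDomain :=
    h.continuousOn_left.comp continuousOn_fst fun p hp => hp.1
  have h2 : ContinuousOn (fun p : ℝ × ℝ × ℝ => B p.2.1) tripleDomain :=
    h.continuousOn_right.comp (by fun_prop) fun p hp => hp.2.1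
  have h3 : ContinuousOn (fun p : ℝ × ℝ × ℝ => (betaKernel α β p.2.2 : ℂ)) tripleDomain := by
    refine continuous_ofReal.comp_continuousOn ?_
    unfold betaKernel
    refine ContinuousOn.mul ?_ ?_
    · exact ContinuousOn.rpow_const (by fun_prop) fun p hp => Or.inl hp.2.2.1.ne'
    · exact ContinuousOn.rpow_const (by fun_prop) fun p hp => Or.inl (sub_pos.2 hp.2.2.2).ne'
  exact (h1.mul h2).mul h3

theorem integrableOn_tripleDensity {α β : ℝ} (hα : 0 < α) (hβ : 0 < β) (k : ℕ) :
    IntegrableOn (fun p => ‖tripleDensity α β A B p‖ * p.2.1 ^ k) tripleDomain := by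
  have hK : Integrable (fun u => ‖(betaKernel α β u : ℂ)‖) (volume.restrict (Ioo 0 1)) := by
    have := (intervalIntegrable_ofReal_betaKernel hα hβ).norm
    rwa [intervalIntegrable_iff_integrableOn_Ioo_of_le zero_le_one] at this
  have := h.integrableOn_left.norm.mul_prod ((h.integrableOn_right k).mul_prod hK)
  rw [IntegrableOn, volume_restrict_tripleDomain]
  refine this.congr (Eventually.of_forall fun p => ?_)
  simp only [tripleDensity, norm_mul]
  ring

theorem integrableOn_mul_of_bounded {α β : ℝ} (hα : 0 < α) (hβ : 0 < β) {F : ℝ × ℝ × ℝ → ℂ}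
    (hF : ContinuousOn F tripleDomain) {C : ℝ} (hC : ∀ p ∈ tripleDomain, ‖F p‖ ≤ C) :
    IntegrableOn (fun p => tripleDensity α β A B p * F p) tripleDomain := by
  refine Integrable.mono' ((h.integrableOn_tripleDensity hα hβ 0).mul_const C)
    (((h.continuousOn_tripleDensity α β).mul hF).aestronglyMeasurable
      measurableSet_tripleDomain) ?_
  filter_upwards [ae_restrict_mem measurableSet_tripleDomain] with p hp
  rw [norm_mul, pow_zero, mul_one]
  exact mul_le_mul_of_nonneg_left (hC p hp) (norm_nonneg _)

/-- From `1 - |w|² = 4 Im z/|z + i|²` with `Im z ≥ δ` and `|z + i| ≤ 3y`: the chords approach the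
boundary of the disk only polynomially in `y`. -/
theorem inv_one_sub_norm_le {p : ℝ × ℝ × ℝ} (hp : p ∈ tripleDomain) :
    (1 - ‖toDisk (triplePoint γ p)‖)⁻¹ ≤ 9 / (2 * δ) * p.2.1 ^ 2 := by
  have him := h.im_triplePoint_pos hp
  have h1 := norm_toDisk_lt_one him
  have h2 := one_sub_normSq_toDisk him
  have h3 := h.le_im_triplePoint hp
  have h4 := h.norm_triplePoint_add_I_le hp
  have hδ := h.pos
  have hy : 1 < p.2.1 := hp.2.1
  set z := triplePoint γ p
  have hz0 : 0 < ‖z + I‖ := norm_pos_iff.2 (add_I_ne_zero him)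
  rw [eq_div_iff (by positivity)] at h2
  rw [inv_le_iff_one_le_mul₀ (by linarith)]
  have h5 : 4 * δ ≤ (2 * (1 - ‖toDisk z‖)) * (3 * p.2.1) ^ 2 := by
    calc 4 * δ ≤ 4 * z.im := by linarith
      _ = (1 - ‖toDisk z‖ ^ 2) * ‖z + I‖ ^ 2 := h2.symm
      _ ≤ (2 * (1 - ‖toDisk z‖)) * (3 * p.2.1) ^ 2 := by
        have : 1 - ‖toDisk z‖ ^ 2 ≤ 2 * (1 - ‖toDisk z‖) := by nlinarith [norm_nonneg (toDisk z)]
        have : 0 ≤ 1 - ‖toDisk z‖ := by linarith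
        gcongr
  rw [div_mul_eq_mul_div, div_mul_eq_mul_div, le_div_iff₀ (by positivity)]
  nlinarith

omit h in
theorem continuousOn_toDisk : ContinuousOn toDisk {z | 0 < z.im} := by
  refine ContinuousOn.div (by fun_prop) (by fun_prop) fun z hz => add_I_ne_zero hz

omit h in
theorem continuousOn_half_cpow (r : ℝ) :
    ContinuousOn (fun z : ℂ => ((z + I) / (2 * I)) ^ (-r : ℂ)) {z | 0 < z.im} := by
  refine ContinuousOn.cpow_const (by fun_prop) fun z hz => Or.inl (half_re_pos hz)

omit h in
theorem norm_half_cpow_le {r : ℝ} (hr : 0 < r) {z : ℂ} (hz : 0 < z.im) :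
    ‖((z + I) / (2 * I)) ^ (-r : ℂ)‖ ≤ 2 ^ r := by
  have h1 : 1 ≤ ‖z + I‖ := by
    have := (le_abs_self _).trans (abs_im_le_norm (z + I))
    simp at this
    linarith
  have h2 : 1 / 2 ≤ ‖(z + I) / (2 * I)‖ := by
    rw [norm_div, norm_mul, norm_I, Complex.norm_ofNat, mul_one]
    gcongr
  have := norm_cpow_real ((z + I) / (2 * I)) (-r)
  push_cast at this
  rw [this, Real.rpow_neg (norm_nonneg _), ← Real.inv_rpow (norm_nonneg _)]
  refine Real.rpow_le_rpow (by positivity) ?_ hr.le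
  rw [inv_le_comm₀ (by linarith) (by norm_num)]
  linarith

/-- A moment of order `k` costs a factor `y^(2k)`, which the decay of `B` can afford. -/
theorem hasMoments {α β : ℝ} (hα : 0 < α) (hβ : 0 < β) {r : ℝ} (hr : 0 < r) (K : ℂ) :
    HasMoments (volume.restrict tripleDomain) (fun p => toDisk (triplePoint γ p))
      (fun p => K * (tripleDensity α β A B p *
        ((triplePoint γ p + I) / (2 * I)) ^ (-r : ℂ))) := by
  have hw : ContinuousOn (fun p => toDisk (triplePoint γ p)) tripleDomain :=
    continuousOn_toDisk.comp h.continuousOn_triplePoint fun p hp => h.im_triplePoint_pos hp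
  have hg : ContinuousOn (fun p => K * (tripleDensity α β A B p *
      ((triplePoint γ p + I) / (2 * I)) ^ (-r : ℂ))) tripleDomain :=
    continuousOn_const.mul ((h.continuousOn_tripleDensity α β).mul
      ((continuousOn_half_cpow r).comp h.continuousOn_triplePoint fun p hp =>
        h.im_triplePoint_pos hp))
  have hmw := hw.aestronglyMeasurable measurableSet_tripleDomain (μ := volume)
  have hmg := hg.aestronglyMeasurable measurableSet_tripleDomain (μ := volume)
  refine ⟨hmw, ?_, fun k => ?_, hmg⟩
  · filter_upwards [ae_restrict_mem measurableSet_tripleDomain] with p hp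
    exact norm_toDisk_lt_one (h.im_triplePoint_pos hp)
  · refine Integrable.mono' ((h.integrableOn_tripleDensity hα hβ (2 * k)).const_mul
      (‖K‖ * 2 ^ r * (9 / (2 * δ)) ^ k)) ?_ ?_
    · exact hmg.norm.mul (((aestronglyMeasurable_const.sub hmw.norm).aemeasurable.inv.pow_const
        k).aestronglyMeasurable)
    · filter_upwards [ae_restrict_mem measurableSet_tripleDomain] with p hp
      have h1 := norm_half_cpow_le hr (h.im_triplePoint_pos hp)
      have h2 := h.inv_one_sub_norm_le hp
      have h3 : 0 < 1 - ‖toDisk (triplePoint γ p)‖ := by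
        linarith [norm_toDisk_lt_one (h.im_triplePoint_pos hp)]
      rw [Real.norm_of_nonneg (by positivity), norm_mul, norm_mul]
      calc ‖K‖ * (‖tripleDensity α β A B p‖ *
              ‖((triplePoint γ p + I) / (2 * I)) ^ (-r : ℂ)‖) *
              (1 - ‖toDisk (triplePoint γ p)‖)⁻¹ ^ k
          ≤ ‖K‖ * (‖tripleDensity α β A B p‖ * 2 ^ r) * (9 / (2 * δ) * p.2.1 ^ 2) ^ k := by gcongr
        _ = _ := by rw [mul_pow, ← pow_mul]; ring

/-- The product of the two transforms of `A` and `B` is a superposition. -/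
theorem diskMinus_eq_integral {α β : ℝ} (hα : 0 < α) (hβ : 0 < β) {f : LowerHalfPlane → ℂ}
    (hf : ∀ t, f t = (∫ s in Ioo (0 : ℝ) 1, A s * (γ s - t.1) ^ (-α : ℂ)) *
      ∫ y in Ioi (1 : ℝ), B y * (I * y - t.1) ^ (-β : ℂ)) {x : ℂ} (hx : ‖x‖ < 1) :
    diskMinus (α + β) f x = ∫ p in tripleDomain,
      ((Real.Gamma (α + β) / (Real.Gamma α * Real.Gamma β) : ℝ) : ℂ) *
        (tripleDensity α β A B p *
          ((triplePoint γ p + I) / (2 * I)) ^ (-(α + β : ℝ) : ℂ)) *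
        (1 - x * toDisk (triplePoint γ p)) ^ (-(α + β : ℝ) : ℂ) := by
  have hr : 0 < α + β := by positivity
  set K : ℂ := ((Real.Gamma (α + β) / (Real.Gamma α * Real.Gamma β) : ℝ) : ℂ)
  set t := lowerPoint x hx
  set P : ℂ := (2 * I / (1 - x)) ^ ((α + β : ℝ) : ℂ)
  have hP : P ≠ 0 := by
    have : 2 * I / (1 - x) ≠ 0 :=
      div_ne_zero (by simp) (sub_ne_zero.2 (ne_one_of_norm_lt hx).symm)
    simp [P, cpow_eq_zero_iff, this]
  -- The disk factorization is undone to recover `(z - t)^(-(α+β))`. The prefactor depends on `t`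
  -- alone, and Fubini then leaves Feynman's formula as the innermost integral.
  have hcongr : ∀ p ∈ tripleDomain, K * (tripleDensity α β A B p *
          ((triplePoint γ p + I) / (2 * I)) ^ (-(α + β : ℝ) : ℂ)) *
        (1 - x * toDisk (triplePoint γ p)) ^ (-(α + β : ℝ) : ℂ) =
      (P * K) * (tripleDensity α β A B p * (triplePoint γ p - t.1) ^ (-(α + β : ℝ) : ℂ)) := by
    intro p hp
    have := cpow_mul_cpow_eq (α + β) (h.im_triplePoint_pos hp) hx
    linear_combination (-(K * tripleDensity α β A B p)) * this
  rw [setIntegral_congr_fun measurableSet_tripleDomain hcongr, integral_const_mul]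
  have hint : IntegrableOn (fun p => tripleDensity α β A B p *
      (triplePoint γ p - t.1) ^ (-(α + β : ℝ) : ℂ)) tripleDomain := by
    have ht := t.2
    have him : ∀ p ∈ tripleDomain, -t.1.im ≤ (triplePoint γ p - t.1).im := fun p hp => by
      have := h.im_triplePoint_pos hp
      rw [sub_im]
      linarith
    refine h.integrableOn_mul_of_bounded hα hβ (C := (-t.1.im) ^ (-(α + β))) ?_ fun p hp => ?_
    · refine ContinuousOn.cpow_const (h.continuousOn_triplePoint.sub continuousOn_const)
        fun p hp => Or.inr ?_
      have := him p hp
      have h0 : 0 < (triplePoint γ p - t.1).im := by linarith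
      exact h0.ne'
    · have e := norm_cpow_real (triplePoint γ p - t.1) (-(α + β))
      rw [ofReal_neg] at e
      rw [e]
      exact Real.rpow_le_rpow_of_nonpos (by linarith)
        ((him p hp).trans ((le_abs_self _).trans (abs_im_le_norm _))) (by linarith)
  rw [integral_tripleDomain hint, diskMinus_eq _ _ hx, hf, mul_assoc P K]
  refine congrArg (P * ·) ?_
  rw [← integral_mul_const, ← integral_const_mul]
  refine setIntegral_congr_fun measurableSet_Ioo fun s hs => ?_
  change A s * _ * _ = K * _
  rw [mul_comm (A s * _), ← integral_mul_const, ← integral_const_mul]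
  refine setIntegral_congr_fun measurableSet_Ioi fun y hy => ?_
  have hy : 1 < y := hy
  have ht := t.2
  have hAim : 0 < (γ s - t.1).im := by
    have := h.le_im s hs
    have := h.pos
    rw [sub_im]
    linarith
  have hBim : 0 < (I * y - t.1).im := by
    simp
    linarith
  have hF := integral_betaKernel_mul_cpow hα hβ hAim hBim
  have e : ∀ u : ℝ, tripleDensity α β A B (s, y, u) *
      (triplePoint γ (s, y, u) - t.1) ^ (-(α + β : ℝ) : ℂ) = (A s * B y) *
        ((betaKernel α β u : ℂ) *
          ((1 - u) * (γ s - t.1) + u * (I * y - t.1)) ^ (-(α + β : ℝ) : ℂ)) := by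
    intro u
    have : triplePoint γ (s, y, u) - t.1 = (1 - u) * (γ s - t.1) + u * (I * y - t.1) := by
      simp only [triplePoint]
      ring
    rw [this, tripleDensity]
    ring
  simp_rw [e]
  rw [integral_const_mul, ← integral_Ioc_eq_integral_Ioo,
    ← intervalIntegral.integral_of_le zero_le_one, hF]
  have hK : K * ((Real.Gamma α * Real.Gamma β / Real.Gamma (α + β) : ℝ) : ℂ) = 1 := by
    have h1 := (Real.Gamma_pos_of_pos hα).ne'
    have h2 := (Real.Gamma_pos_of_pos hβ).ne'
    have h3 := (Real.Gamma_pos_of_pos hr).ne'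
    simp only [K]
    rw [← ofReal_mul, ← ofReal_one]
    congr 1
    field_simp
  linear_combination (-(A s * B y * (γ s - t.1) ^ (-α : ℂ) * (I * y - t.1) ^ (-β : ℂ))) * hK

end TripleData

/-! ### Primitives of functions with power singularities at `0` and `1`. -/

/-- The average `∫₀¹ s^(β-1) g (s U) ds`. -/
def radialAverage (β : ℝ) (g : ℂ → ℂ) (U : ℂ) : ℂ :=
  ∫ s in (0 : ℝ)..1, ((s ^ (β - 1) : ℝ) : ℂ) * g (s * U)

theorem smul_mem_of_starConvex {D : Set ℂ} (hD : StarConvex ℝ 0 D) {U : ℂ} (hU : U ∈ D) {s : ℝ}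
    (h0 : 0 ≤ s) (h1 : s ≤ 1) : (s : ℂ) * U ∈ D := by
  have := hD.smul_mem hU h0 h1
  rwa [Complex.real_smul] at this

theorem intervalIntegrable_rpow_mul {β : ℝ} (hβ : 0 < β) {g : ℝ → ℂ}
    (hg : ContinuousOn g (Icc 0 1)) :
    IntervalIntegrable (fun s : ℝ => ((s ^ (β - 1) : ℝ) : ℂ) * g s) volume 0 1 := by
  refine IntervalIntegrable.mul_continuousOn ?_ (by rwa [uIcc_of_le zero_le_one])
  have h : IntervalIntegrable (fun s : ℝ => s ^ (β - 1)) volume 0 1 :=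
    intervalIntegral.intervalIntegrable_rpow' (by linarith)
  exact ⟨h.1.ofReal, h.2.ofReal⟩

/-- Differentiation under the integral, with `g'` bounded on the compact set of all `sV` for `V`
near `U`. The point `U = 0` is included when it lies in `D`, which later gives continuity of the
primitive at the singular endpoint. -/
theorem hasDerivAt_radialAverage {D : Set ℂ} (hDo : IsOpen D) (hD : StarConvex ℝ 0 D)
    {g : ℂ → ℂ} (hg : DifferentiableOn ℂ g D) {β : ℝ} (hβ : 0 < β) {U : ℂ} (hU : U ∈ D) :
    HasDerivAt (radialAverage β g)
      (∫ s in (0 : ℝ)..1, ((s ^ (β - 1) : ℝ) : ℂ) * (s * deriv g (s * U))) U := by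
  obtain ⟨ε, hε, hball⟩ := Metric.isOpen_iff.1 hDo U hU
  have hcb : Metric.closedBall U (ε / 2) ⊆ D :=
    (Metric.closedBall_subset_ball (by linarith)).trans hball
  have hdg : ContinuousOn (deriv g) D := (hg.deriv hDo).continuousOn
  set K : Set ℂ := (fun p : ℝ × ℂ => (p.1 : ℂ) * p.2) '' (Icc 0 1 ×ˢ Metric.closedBall U (ε / 2))
  have hK : IsCompact K :=
    (isCompact_Icc.prod (isCompact_closedBall U (ε / 2))).image (by fun_prop)
  have hKD : K ⊆ D := by
    rintro _ ⟨p, ⟨h1, h2⟩, rfl⟩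
    exact smul_mem_of_starConvex hD (hcb h2) h1.1 h1.2
  obtain ⟨C, hC⟩ := hK.exists_bound_of_continuousOn (hdg.mono hKD)
  have hcont : ∀ V ∈ D, ContinuousOn (fun s : ℝ => g (s * V)) (Icc 0 1) := fun V hV =>
    hg.continuousOn.comp (by fun_prop) fun s hs => smul_mem_of_starConvex hD hV hs.1 hs.2
  have hcont' : ContinuousOn (fun s : ℝ => (s : ℂ) * deriv g (s * U)) (Icc 0 1) :=
    (by fun_prop : ContinuousOn (fun s : ℝ => (s : ℂ)) (Icc 0 1)).mul
      (hdg.comp (by fun_prop) fun s hs => smul_mem_of_starConvex hD hU hs.1 hs.2)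
  refine (intervalIntegral.hasDerivAt_integral_of_dominated_loc_of_deriv_le
    (s := Metric.ball U (ε / 2)) (bound := fun s => s ^ (β - 1) * C)
    (F := fun V s => ((s ^ (β - 1) : ℝ) : ℂ) * g (s * V))
    (F' := fun V s => ((s ^ (β - 1) : ℝ) : ℂ) * (s * deriv g (s * V)))
    (Metric.ball_mem_nhds U (by positivity)) ?_ ?_ ?_ ?_ ?_ ?_).2
  · filter_upwards [hDo.mem_nhds hU] with V hV
    exact (intervalIntegrable_iff.1 (intervalIntegrable_rpow_mul hβ (hcont V hV))).aestronglyMeasurable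
  · exact intervalIntegrable_rpow_mul hβ (hcont U hU)
  · exact (intervalIntegrable_iff.1 (intervalIntegrable_rpow_mul hβ hcont')).aestronglyMeasurable
  · refine Eventually.of_forall fun s hs V hV => ?_
    rw [uIoc_of_le zero_le_one] at hs
    have h1 : ‖deriv g (s * V)‖ ≤ C :=
      hC _ ⟨(s, V), ⟨⟨hs.1.le, hs.2⟩, Metric.ball_subset_closedBall hV⟩, rfl⟩
    have h2 : 0 ≤ s ^ (β - 1) := Real.rpow_nonneg hs.1.le _
    rw [norm_mul, norm_mul, Complex.norm_real, Complex.norm_real, Real.norm_of_nonneg h2,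
      Real.norm_of_nonneg hs.1.le]
    refine mul_le_mul_of_nonneg_left ?_ h2
    nlinarith [norm_nonneg (deriv g (s * V)), hs.1, hs.2]
  · exact (intervalIntegral.intervalIntegrable_rpow' (by linarith)).mul_const C
  · refine Eventually.of_forall fun s hs V hV => ?_
    rw [uIoc_of_le zero_le_one] at hs
    have hm : (s : ℂ) * V ∈ D :=
      smul_mem_of_starConvex hD (hcb (Metric.ball_subset_closedBall hV)) hs.1.le hs.2
    have h1 := (hg.differentiableAt (hDo.mem_nhds hm)).hasDerivAt
    have h2 : HasDerivAt (fun V : ℂ => (s : ℂ) * V) (s : ℂ) V := by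
      simpa using (hasDerivAt_id V).const_mul (s : ℂ)
    exact ((h1.comp V h2).const_mul _).congr_deriv (by ring)

/-- The fundamental theorem of calculus for `s^β g(sU)` on `[0, 1]`. This Euler equation is what
makes `U^β` times the average a primitive of `U^(β-1) g`. -/
theorem radialAverage_euler {D : Set ℂ} (hDo : IsOpen D) (hD : StarConvex ℝ 0 D)
    {g : ℂ → ℂ} (hg : DifferentiableOn ℂ g D) {β : ℝ} (hβ : 0 < β) {U : ℂ} (hU : U ∈ D) :
    β * radialAverage β g U +
      U * (∫ s in (0 : ℝ)..1, ((s ^ (β - 1) : ℝ) : ℂ) * (s * deriv g (s * U))) = g U := by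
  have hmem : ∀ s ∈ Icc (0 : ℝ) 1, (s : ℂ) * U ∈ D := fun s hs =>
    smul_mem_of_starConvex hD hU hs.1 hs.2
  have hc : ContinuousOn (fun s : ℝ => g (s * U)) (Icc 0 1) :=
    hg.continuousOn.comp (by fun_prop) hmem
  have hc' : ContinuousOn (fun s : ℝ => (s : ℂ) * deriv g (s * U)) (Icc 0 1) :=
    (by fun_prop : ContinuousOn (fun s : ℝ => (s : ℂ)) (Icc 0 1)).mul
      ((hg.deriv hDo).continuousOn.comp (by fun_prop) hmem)
  have i1 := (intervalIntegrable_rpow_mul hβ hc).const_mul (β : ℂ)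
  have i2 := (intervalIntegrable_rpow_mul hβ hc').const_mul U
  rw [radialAverage, ← intervalIntegral.integral_const_mul, ← intervalIntegral.integral_const_mul,
    ← intervalIntegral.integral_add i1 i2,
    intervalIntegral.integral_eq_sub_of_hasDerivAt_of_le zero_le_one
      (f := fun s : ℝ => ((s ^ β : ℝ) : ℂ) * g (s * U)) ?_ ?_ (i1.add i2)]
  · simp [Real.zero_rpow hβ.ne']
  · refine ContinuousOn.mul ?_ hc
    exact (continuous_ofReal.comp (Real.continuous_rpow_const hβ.le)).continuousOn
  · intro s hs
    have h1 : HasDerivAt (fun s : ℝ => ((s ^ β : ℝ) : ℂ)) ((β * s ^ (β - 1) : ℝ) : ℂ) s :=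
      (Real.hasDerivAt_rpow_const (Or.inl hs.1.ne')).ofReal_comp
    have h2 := (hg.differentiableAt (hDo.mem_nhds (hmem s ⟨hs.1.le, hs.2.le⟩))).hasDerivAt
    have h3 : HasDerivAt (fun s : ℝ => (s : ℂ) * U) U s := by
      simpa using (hasDerivAt_id s).ofReal_comp.mul_const U
    have h4 : HasDerivAt (fun s : ℝ => g (s * U)) (deriv g (s * U) * U) s :=
      HasDerivAt.comp (h := fun s : ℝ => (s : ℂ) * U) s h2 h3
    refine (h1.mul h4).congr_deriv ?_
    have h5 : s ^ β = s ^ (β - 1) * s := by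
      rw [← Real.rpow_add_one hs.1.ne', sub_add_cancel]
    rw [h5]
    push_cast
    ring

/-- A primitive of `U^(β-1) g U`. -/
def powPrimitive (β : ℝ) (g : ℂ → ℂ) (U : ℂ) : ℂ := U ^ (β : ℂ) * radialAverage β g U

theorem hasDerivAt_powPrimitive {D : Set ℂ} (hDo : IsOpen D) (hD : StarConvex ℝ 0 D)
    {g : ℂ → ℂ} (hg : DifferentiableOn ℂ g D) {β : ℝ} (hβ : 0 < β) {U : ℂ} (hU : U ∈ D)
    (hs : U ∈ slitPlane) :
    HasDerivAt (powPrimitive β g) (U ^ (((β - 1 : ℝ) : ℂ)) * g U) U := by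
  have h1 : HasDerivAt (fun U : ℂ => U ^ (β : ℂ)) ((β : ℂ) * U ^ ((β : ℂ) - 1)) U := by
    simpa using (hasDerivAt_id U).cpow_const (c := (β : ℂ)) hs
  refine (h1.mul (hasDerivAt_radialAverage hDo hD hg hβ hU)).congr_deriv ?_
  have h0 : U ≠ 0 := slitPlane_ne_zero hs
  have h2 : U ^ (β : ℂ) = U ^ ((β : ℂ) - 1) * U := by
    conv_rhs => rw [← cpow_one U, cpow_one U, cpow_sub _ _ h0, cpow_one]
    field_simp
  rw [h2, ← radialAverage_euler hDo hD hg hβ hU]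
  push_cast
  ring

theorem powPrimitive_zero {β : ℝ} (hβ : 0 < β) (g : ℂ → ℂ) : powPrimitive β g 0 = 0 := by
  rw [powPrimitive, zero_cpow (by exact_mod_cast hβ.ne'), zero_mul]

theorem continuousAt_powPrimitive_zero {D : Set ℂ} (hDo : IsOpen D) (hD : StarConvex ℝ 0 D)
    (h0 : (0 : ℂ) ∈ D) {g : ℂ → ℂ} (hg : DifferentiableOn ℂ g D) {β : ℝ} (hβ : 0 < β) :
    ContinuousAt (powPrimitive β g) 0 := by
  refine ContinuousAt.mul ?_ (hasDerivAt_radialAverage hDo hD hg hβ h0).continuousAt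
  exact continuousAt_cpow_const_of_re_pos (Or.inl le_rfl) (by simpa using hβ)

/-- The disk of radius `R` without the two cuts `(-R, 0]` and `[1, R)`. -/
def cutDisk (R : ℝ) : Set ℂ := {U | ‖U‖ < R ∧ U ∈ slitPlane ∧ 1 - U ∈ slitPlane}

/-- The function `H U U^(β-1) (1 - U)^(α-1)`. -/
def betaIntegrand (α β : ℝ) (H : ℂ → ℂ) (U : ℂ) : ℂ :=
  H U * U ^ ((β - 1 : ℝ) : ℂ) * (1 - U) ^ ((α - 1 : ℝ) : ℂ)

theorem isOpen_cutDisk (R : ℝ) : IsOpen (cutDisk R) := by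
  refine (isOpen_lt continuous_norm continuous_const).inter
    (isOpen_slitPlane.inter (isOpen_slitPlane.preimage ?_))
  fun_prop

theorem half_add_mem_slitPlane {U : ℂ} (hU : U ∈ slitPlane) {a b : ℝ} (ha : 0 ≤ a) (hb : 0 ≤ b)
    (hab : a + b = 1) : a / 2 + b * U ∈ slitPlane := by
  rw [mem_slitPlane_iff] at hU ⊢
  have e : (a / 2 + b * U : ℂ).re = a / 2 + b * U.re := by
    simp [show (a / 2 : ℂ) = ((a / 2 : ℝ) : ℂ) by push_cast; rfl, -ofReal_div]
  have e' : (a / 2 + b * U : ℂ).im = b * U.im := by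
    simp [show (a / 2 : ℂ) = ((a / 2 : ℝ) : ℂ) by push_cast; rfl, -ofReal_div]
  rw [e, e']
  rcases hb.eq_or_lt with rfl | hb
  · left; linarith
  · rcases hU with h | h
    · left; positivity
    · right; exact mul_ne_zero hb.ne' h

/-- The set is star-shaped about `1/2`. Connectedness lets the primitives at the two endpoints be
compared by one constant. -/
theorem isPreconnected_cutDisk {R : ℝ} (hR : 1 < R) : IsPreconnected (cutDisk R) := by
  refine (StarConvex.isPathConnected (a := (1 / 2 : ℂ)) ?_ ?_).isConnected.isPreconnected
  · intro U hU a b ha hb hab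
    have e : a • (1 / 2 : ℂ) + b • U = a / 2 + b * U := by
      simp only [Complex.real_smul]; ring
    rw [e]
    refine ⟨?_, half_add_mem_slitPlane hU.2.1 ha hb hab, ?_⟩
    · have h1 : ‖(a / 2 : ℂ)‖ = a / 2 := by simp [abs_of_nonneg ha]
      have h2 : ‖(b * U : ℂ)‖ = b * ‖U‖ := by simp [abs_of_nonneg hb]
      have h3 := norm_add_le (a / 2 : ℂ) (b * U)
      rw [h1, h2] at h3
      rcases hb.eq_or_lt with rfl | hb
      · linarith
      · nlinarith [hU.1]
    · have e2 : 1 - (a / 2 + b * U : ℂ) = a / 2 + b * (1 - U) := by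
        have : (a : ℂ) + b = 1 := by exact_mod_cast hab
        linear_combination -this
      rw [e2]
      exact half_add_mem_slitPlane hU.2.2 ha hb hab
  · have h : (1 / 2 : ℂ) ∈ slitPlane := by rw [mem_slitPlane_iff]; norm_num
    refine ⟨?_, h, ?_⟩
    · norm_num; linarith
    · rwa [show (1 : ℂ) - 1 / 2 = 1 / 2 by norm_num]

theorem starConvex_one_sub_slitPlane : StarConvex ℝ (0 : ℂ) {U | 1 - U ∈ slitPlane} := by
  intro U hU a b ha hb hab
  have h := starConvex_one_slitPlane hU ha hb hab
  have e : 1 - (a • (0 : ℂ) + b • U) = a • (1 : ℂ) + b • (1 - U) := by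
    have : (a : ℂ) + b = 1 := by exact_mod_cast hab
    simp only [Complex.real_smul]
    linear_combination -this
  change 1 - (a • (0 : ℂ) + b • U) ∈ slitPlane
  rwa [e]

/-- There is a primitive continuous at `0`, with `(1-U)^(α-1)` put into the regular factor, and one
continuous at `1`, obtained by `U ↦ 1 - U`. On the connected cut disk they differ by a constant, so
the first one extends continuously to `1` as well. -/
theorem exists_primitive_betaIntegrand {α β R : ℝ} (hα : 0 < α) (hβ : 0 < β) (hR : 1 < R)
    {H : ℂ → ℂ} (hH : DifferentiableOn ℂ H (Metric.ball 0 R)) :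
    ∃ Φ : ℂ → ℂ, ContinuousOn Φ (insert 0 (insert 1 (cutDisk R))) ∧
      ∀ U ∈ cutDisk R, HasDerivAt Φ (betaIntegrand α β H U) U := by
  have hc : Continuous fun U : ℂ => 1 - U := by fun_prop
  set D₁ : Set ℂ := Metric.ball 0 R ∩ {U | 1 - U ∈ slitPlane}
  set D₂ : Set ℂ := (fun U => 1 - U) ⁻¹' Metric.ball 0 R ∩ {U | 1 - U ∈ slitPlane}
  have ho₁ : IsOpen D₁ := Metric.isOpen_ball.inter (isOpen_slitPlane.preimage hc)
  have ho₂ : IsOpen D₂ := (Metric.isOpen_ball.preimage hc).inter (isOpen_slitPlane.preimage hc)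
  have hs₁ : StarConvex ℝ 0 D₁ :=
    ((convex_ball _ _).starConvex (by simp; linarith)).inter starConvex_one_sub_slitPlane
  have hs₂ : StarConvex ℝ 0 D₂ := by
    refine StarConvex.inter ?_ starConvex_one_sub_slitPlane
    intro U hU a b ha hb hab
    have h1 : (1 : ℂ) ∈ Metric.ball 0 R := by simpa using hR
    have h := (convex_ball (0 : ℂ) R) h1 hU ha hb hab
    have e : 1 - (a • (0 : ℂ) + b • U) = a • (1 : ℂ) + b • (1 - U) := by
      have : (a : ℂ) + b = 1 := by exact_mod_cast hab
      simp only [Complex.real_smul]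
      linear_combination -this
    change 1 - (a • (0 : ℂ) + b • U) ∈ Metric.ball 0 R
    rwa [e]
  have h01 : (0 : ℂ) ∈ D₁ := by
    refine ⟨by simp; linarith, ?_⟩
    simp
  have h02 : (0 : ℂ) ∈ D₂ := by
    refine ⟨by simpa using hR, ?_⟩
    simp
  set g₁ : ℂ → ℂ := fun U => H U * (1 - U) ^ ((α - 1 : ℝ) : ℂ)
  set g₂ : ℂ → ℂ := fun V => H (1 - V) * (1 - V) ^ ((β - 1 : ℝ) : ℂ)
  have hd : Differentiable ℂ fun U : ℂ => 1 - U := by fun_prop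
  have hg₁ : DifferentiableOn ℂ g₁ D₁ :=
    (hH.mono inter_subset_left).mul
      (hd.differentiableOn.cpow_const fun U hU => hU.2)
  have hg₂ : DifferentiableOn ℂ g₂ D₂ :=
    (hH.comp hd.differentiableOn fun U hU => hU.1).mul
      (hd.differentiableOn.cpow_const fun U hU => hU.2)
  set Φ₁ : ℂ → ℂ := powPrimitive β g₁
  set Φ₂ : ℂ → ℂ := fun U => -powPrimitive α g₂ (1 - U)
  have hΦ₁ : ∀ U ∈ cutDisk R, HasDerivAt Φ₁ (betaIntegrand α β H U) U := fun U hU =>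
    (hasDerivAt_powPrimitive ho₁ hs₁ hg₁ hβ ⟨by simpa using hU.1, hU.2.2⟩ hU.2.1).congr_deriv
      (by simp only [g₁, betaIntegrand]; ring)
  have hΦ₂ : ∀ U ∈ cutDisk R, HasDerivAt Φ₂ (betaIntegrand α β H U) U := by
    intro U hU
    have hm : 1 - U ∈ D₂ := by
      refine ⟨?_, ?_⟩
      · simpa using hU.1
      · simpa using hU.2.1
    have h1 := hasDerivAt_powPrimitive ho₂ hs₂ hg₂ hα hm hU.2.2
    have h2 : HasDerivAt (fun U : ℂ => 1 - U) (-1) U := by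
      simpa using (hasDerivAt_id U).const_sub 1
    refine (h1.comp U h2).neg.congr_deriv ?_
    simp only [g₂, betaIntegrand, sub_sub_cancel]
    ring
  obtain ⟨c, hcst⟩ : ∃ c, ∀ U ∈ cutDisk R, Φ₁ U - Φ₂ U = c := by
    refine (isOpen_cutDisk R).exists_is_const_of_deriv_eq_zero (isPreconnected_cutDisk hR)
      (f := fun U => Φ₁ U - Φ₂ U) ?_ ?_
    · exact fun U hU =>
        ((hΦ₁ U hU).sub (hΦ₂ U hU)).differentiableAt.differentiableWithinAt
    · intro U hU
      change deriv (Φ₁ - Φ₂) U = 0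
      rw [((hΦ₁ U hU).sub (hΦ₂ U hU)).deriv, sub_self]
  have hne1 : ∀ U ∈ cutDisk R, U ≠ 1 := by
    rintro U hU rfl
    exact slitPlane_ne_zero hU.2.2 (sub_self _)
  -- The value `c` at `1` is forced: it equals `Φ₂ 1 + c`, because `Φ₂ 1 = 0`.
  set Φ : ℂ → ℂ := fun U => if U = 1 then c else Φ₁ U
  have hnear : ∀ U : ℂ, U ≠ 1 → Φ =ᶠ[𝓝 U] Φ₁ := by
    intro U hU
    filter_upwards [isOpen_ne.mem_nhds hU] with V hV
    exact if_neg hV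
  have hder : ∀ U ∈ cutDisk R, HasDerivAt Φ (betaIntegrand α β H U) U := fun U hU =>
    (hΦ₁ U hU).congr_of_eventuallyEq (hnear U (hne1 U hU))
  refine ⟨Φ, ?_, hder⟩
  intro U hU
  rcases hU with rfl | rfl | hU
  · refine ContinuousAt.continuousWithinAt ?_
    exact (continuousAt_powPrimitive_zero ho₁ hs₁ h01 hg₁ hβ).congr
      (hnear 0 zero_ne_one).symm
  · have hcont : ContinuousAt (fun U => Φ₂ U + c) 1 := by
      refine ContinuousAt.add (ContinuousAt.neg ?_) continuousAt_const
      refine ContinuousAt.comp (g := powPrimitive α g₂) (f := fun U : ℂ => 1 - U) ?_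
        hc.continuousAt
      simpa using continuousAt_powPrimitive_zero ho₂ hs₂ h02 hg₂ hα
    have hval : ∀ V ∈ insert 0 (insert 1 (cutDisk R)), V ≠ 0 → Φ V = Φ₂ V + c := by
      intro V hV hV0
      rcases hV with rfl | rfl | hV
      · exact absurd rfl hV0
      · simp [Φ, Φ₂, powPrimitive_zero hα]
      · rw [← hcst V hV]
        simp only [Φ, if_neg (hne1 V hV)]
        ring
    refine hcont.continuousWithinAt.congr_of_eventuallyEq ?_
      (hval 1 (by simp) one_ne_zero)
    filter_upwards [self_mem_nhdsWithin,
      mem_nhdsWithin_of_mem_nhds (isOpen_ne.mem_nhds (one_ne_zero (α := ℂ)))] with V hV hV0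
    exact hval V hV hV0
  · exact (hder U hU).continuousAt.continuousWithinAt

/-! ### Integrability along regular curves -/

/-- An infinite level set would accumulate at a point of the compact interval, and a nonzero
derivative there excludes this. -/
theorem finite_preimage_of_regular {V : ℝ → ℂ} {a b : ℝ} (hV : ContDiffOn ℝ 1 V (Icc a b))
    (hV' : ∀ s ∈ Icc a b, derivWithin V (Icc a b) s ≠ 0) (c : ℂ) :
    {s ∈ Icc a b | V s = c}.Finite := by
  by_contra hinf
  obtain ⟨x, hx, hacc⟩ := Set.Infinite.exists_accPt_of_subset_isCompact hinf isCompact_Icc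
    (fun s hs => hs.1)
  have hd := (hV.differentiableOn one_ne_zero x hx).hasDerivWithinAt
  have hne := hd.eventually_ne (c := c) (hV' x hx)
  rw [accPt_iff_frequently] at hacc
  rw [eventually_nhdsWithin_iff] at hne
  obtain ⟨y, ⟨hyx, hy⟩, hyc⟩ := (hacc.and_eventually hne).exists
  exact hyc ⟨hy.1, hyx⟩ hy.2

theorem integrableOn_abs_rpow {e : ℝ} (he : -1 < e) (c : ℝ) :
    IntegrableOn (fun x : ℝ => |x| ^ e) (Icc (-c) c) := by
  rcases lt_or_ge c 0 with hc | hc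
  · rw [Icc_eq_empty (by linarith)]
    exact integrableOn_empty
  have h1 : IntervalIntegrable (fun x : ℝ => |x| ^ e) volume 0 c := by
    refine (intervalIntegral.intervalIntegrable_rpow' he).congr fun x hx => ?_
    rw [uIoc_of_le hc] at hx
    simp only [abs_of_pos hx.1]
  have h2 : IntervalIntegrable (fun x : ℝ => |x| ^ e) volume (-c) 0 := by
    have := ((IntervalIntegrable.iff_comp_neg (f := fun x : ℝ => |x| ^ e) (by simp)).1 h1).symm
    simpa using this
  exact (intervalIntegrable_iff_integrableOn_Icc_of_le (by linarith)).1 (h2.trans h1)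

/-- Near a zero `x` regularity gives `‖V s‖ ≥ C |s - x|`, so for negative `e` the integrand is
locally dominated by a multiple of `|s - x|^e`, integrable because `e > -1`. -/
theorem integrableOn_norm_rpow_of_regular {V : ℝ → ℂ} {a b e : ℝ} (he : -1 < e)
    (hV : ContDiffOn ℝ 1 V (Icc a b))
    (hV' : ∀ s ∈ Icc a b, derivWithin V (Icc a b) s ≠ 0) :
    IntegrableOn (fun s => ‖V s‖ ^ e) (Icc a b) := by
  rcases le_or_gt 0 e with he0 | he0
  · exact (ContinuousOn.rpow_const hV.continuousOn.norm
      fun _ _ => Or.inr he0).integrableOn_compact isCompact_Icc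
  have hmeas : AEStronglyMeasurable (fun s => ‖V s‖ ^ e) (volume.restrict (Icc a b)) :=
    ((hV.continuousOn.aestronglyMeasurable measurableSet_Icc).norm.aemeasurable.pow_const
      e).aestronglyMeasurable
  refine LocallyIntegrableOn.integrableOn_isCompact ?_ isCompact_Icc
  intro x hx
  have hd := (hV.differentiableOn one_ne_zero x hx).hasDerivWithinAt
  -- a lower bound for `‖V s‖` near `x`
  obtain ⟨C, hC, hbound⟩ : ∃ C : ℝ, 0 < C ∧
      ∀ᶠ s in 𝓝[Icc a b] x, C * |s - x| ≤ ‖V s‖ := by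
    by_cases h0 : V x = 0
    · obtain ⟨K, hK, hKb⟩ := (HasDerivAtFilter.isTheta_sub hd (hV' x hx)).isBigO_symm.exists_pos
      refine ⟨K⁻¹, inv_pos.2 hK, ?_⟩
      have h1 := hKb.bound
      rw [prod_pure, eventually_map] at h1
      filter_upwards [h1] with s hs
      rw [h0, sub_zero, Real.norm_eq_abs] at hs
      rwa [inv_mul_le_iff₀ hK]
    · have hpos : 0 < ‖V x‖ := norm_pos_iff.2 h0
      refine ⟨‖V x‖ / 2, by positivity, ?_⟩
      have h1 : ∀ᶠ s in 𝓝[Icc a b] x, ‖V x‖ / 2 < ‖V s‖ :=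
        (hV.continuousOn x hx).norm.eventually (lt_mem_nhds (by linarith))
      have h2 : ∀ᶠ s in 𝓝[Icc a b] x, s ∈ Metric.ball x 1 :=
        mem_nhdsWithin_of_mem_nhds (Metric.ball_mem_nhds x one_pos)
      filter_upwards [h1, h2] with s h1 h2
      rw [Metric.mem_ball, Real.dist_eq] at h2
      nlinarith
  rw [eventually_nhdsWithin_iff, Metric.eventually_nhds_iff] at hbound
  obtain ⟨ε, hε, hb⟩ := hbound
  refine ⟨Icc a b ∩ Metric.ball x ε, inter_mem_nhdsWithin _ (Metric.ball_mem_nhds x hε), ?_⟩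
  have hint : IntegrableOn (fun s => C ^ e * |s - x| ^ e) (Icc a b ∩ Metric.ball x ε) := by
    have h1 := (integrableOn_abs_rpow he ε).integrable_indicator measurableSet_Icc
    have h2 := (h1.comp_sub_right x).const_mul (C ^ e)
    refine h2.integrableOn.congr_fun (s := Icc a b ∩ Metric.ball x ε) ?_
      (measurableSet_Icc.inter measurableSet_ball)
    intro s hs
    have : s - x ∈ Icc (-ε) ε := abs_le.1 (by simpa [Real.dist_eq] using hs.2.le)
    simp only [indicator_of_mem this]
  refine Integrable.mono' hint (hmeas.mono_measure
    (Measure.restrict_mono inter_subset_left le_rfl)) ?_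
  refine (ae_restrict_iff' (measurableSet_Icc.inter measurableSet_ball)).2 ?_
  have hx0 : ∀ᵐ s : ℝ, s ≠ x := by simp [ae_iff]
  filter_upwards [hx0] with s hsx hs
  have hpos : 0 < |s - x| := abs_pos.2 (sub_ne_zero.2 hsx)
  rw [Real.norm_of_nonneg (Real.rpow_nonneg (norm_nonneg _) _), ← Real.mul_rpow hC.le hpos.le]
  exact Real.rpow_le_rpow_of_nonpos (by positivity) (hb (by simpa using hs.2) hs.1) he0.le

/-- Since `‖U‖ + ‖1 - U‖ ≥ 1`, one of the two is at least `1/2` and its power is bounded. This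
separates the singularities at `0` and `1`. -/
theorem norm_cpow_le_add {α β R : ℝ} {U : ℂ} (hU : U ∈ cutDisk R) :
    ‖U ^ ((β - 1 : ℝ) : ℂ) * (1 - U) ^ ((α - 1 : ℝ) : ℂ)‖ ≤
      max ((1 / 2) ^ (α - 1)) ((R + 1) ^ (α - 1)) * ‖U‖ ^ (β - 1) +
        max ((1 / 2) ^ (β - 1)) ((R + 1) ^ (β - 1)) * ‖1 - U‖ ^ (α - 1) := by
  have key : ∀ (e x : ℝ), 1 / 2 ≤ x → x ≤ R + 1 →
      x ^ e ≤ max ((1 / 2 : ℝ) ^ e) ((R + 1) ^ e) := by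
    intro e x h1 h2
    rcases le_or_gt 0 e with he | he
    · exact (Real.rpow_le_rpow (by linarith) h2 he).trans (le_max_right _ _)
    · exact (Real.rpow_le_rpow_of_nonpos (by norm_num) h1 he.le).trans (le_max_left _ _)
  have hn : ∀ (e x : ℝ), 0 ≤ x → 0 ≤ x ^ e := fun e x hx => Real.rpow_nonneg hx e
  have h1 : ‖1 - U‖ ≤ R + 1 := by
    have := norm_sub_le (1 : ℂ) U
    rw [norm_one] at this
    linarith [hU.1]
  have h2 : 1 ≤ ‖U‖ + ‖1 - U‖ := by
    have := norm_add_le U (1 - U)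
    rwa [add_sub_cancel, norm_one] at this
  rw [norm_mul, norm_cpow_real, norm_cpow_real]
  have p1 := hn (β - 1) ‖U‖ (norm_nonneg _)
  have p2 := hn (α - 1) ‖1 - U‖ (norm_nonneg _)
  have m1 : 0 ≤ max ((1 / 2 : ℝ) ^ (α - 1)) ((R + 1) ^ (α - 1)) :=
    (hn _ _ (by norm_num)).trans (le_max_left _ _)
  have m2 : 0 ≤ max ((1 / 2 : ℝ) ^ (β - 1)) ((R + 1) ^ (β - 1)) :=
    (hn _ _ (by norm_num)).trans (le_max_left _ _)
  rcases le_total (1 / 2) ‖U‖ with h | h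
  · have := mul_le_mul_of_nonneg_right (key (β - 1) ‖U‖ h (by linarith [hU.1])) p2
    linarith [mul_nonneg m1 p1]
  · have := mul_le_mul_of_nonneg_right (key (α - 1) ‖1 - U‖ (by linarith) h1) p1
    linarith [mul_nonneg m2 p2]

theorem continuousOn_betaIntegrand {α β R : ℝ} {H : ℂ → ℂ}
    (hH : DifferentiableOn ℂ H (Metric.ball 0 R)) :
    ContinuousOn (betaIntegrand α β H) (cutDisk R) := by
  refine ((hH.continuousOn.mono fun U hU => by simpa using hU.1).mul ?_).mul ?_
  · exact continuousOn_id.cpow_const fun U hU => hU.2.1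
  · exact (by fun_prop : ContinuousOn (fun U : ℂ => 1 - U) _).cpow_const fun U hU => hU.2.2

/-- The path may touch `0` and `1`, also in its interior, but by regularity only finitely often.
Elsewhere `Φ ∘ V` has the integrand as derivative; continuity of `Φ` and integrability then suffice
for the fundamental theorem. -/
theorem integral_regular_piece {α β R : ℝ} (hα : 0 < α) (hβ : 0 < β) (hR : 1 < R)
    {H Φ : ℂ → ℂ} (hH : DifferentiableOn ℂ H (Metric.ball 0 R))
    (hΦ : ContinuousOn Φ (insert 0 (insert 1 (cutDisk R))))
    (hΦ' : ∀ U ∈ cutDisk R, HasDerivAt Φ (betaIntegrand α β H U) U)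
    {V : ℝ → ℂ} {a b : ℝ} (hab : a < b) (hV : ContDiffOn ℝ 1 V (Icc a b))
    (hV' : ∀ s ∈ Icc a b, derivWithin V (Icc a b) s ≠ 0)
    (hVm : ∀ s ∈ Icc a b, V s ∈ insert 0 (insert 1 (cutDisk R)))
    {F : ℝ → ℂ} (hF : ∀ s ∈ Ioo a b, V s ∈ cutDisk R →
      F s = betaIntegrand α β H (V s) * deriv V s) :
    IntervalIntegrable F volume a b ∧ ∫ s in a..b, F s = Φ (V b) - Φ (V a) := by
  set Z : Set ℝ := {s ∈ Icc a b | V s = 0} ∪ {s ∈ Icc a b | V s = 1}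
  have hZ : Z.Finite := (finite_preimage_of_regular hV hV' 0).union
    (finite_preimage_of_regular hV hV' 1)
  have hcut : ∀ s ∈ Icc a b, s ∉ Z → V s ∈ cutDisk R := by
    intro s hs hsZ
    rcases hVm s hs with h | h | h
    · exact absurd (Or.inl ⟨hs, h⟩) hsZ
    · exact absurd (Or.inr ⟨hs, h⟩) hsZ
    · exact h
  have hdV : ContinuousOn (derivWithin V (Icc a b)) (Icc a b) :=
    hV.continuousOn_derivWithin (uniqueDiffOn_Icc hab) le_rfl
  have hderiv : ∀ s ∈ Ioo a b, HasDerivAt V (derivWithin V (Icc a b) s) s := fun s hs =>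
    ((hV.differentiableOn one_ne_zero s (Ioo_subset_Icc_self hs)).hasDerivWithinAt).hasDerivAt
      (Icc_mem_nhds hs.1 hs.2)
  set G : ℝ → ℂ := fun s => betaIntegrand α β H (V s) * derivWithin V (Icc a b) s
  have hFG : ∀ s ∈ Ioo a b, s ∉ Z → F s = G s := fun s hs hsZ => by
    rw [hF s hs (hcut s (Ioo_subset_Icc_self hs) hsZ), (hderiv s hs).deriv]
  have hball : ∀ s ∈ Icc a b, V s ∈ Metric.ball 0 R := by
    intro s hs
    rcases hVm s hs with h | h | h
    · rw [h]; simp; linarith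
    · rw [h]; simpa using hR
    · simpa using h.1
  obtain ⟨C, hC⟩ := isCompact_Icc.exists_bound_of_continuousOn
    ((hH.continuousOn.comp hV.continuousOn hball).mul hdV)
  have hI : IntegrableOn (fun s => C *
      (max ((1 / 2) ^ (α - 1)) ((R + 1) ^ (α - 1)) * ‖V s‖ ^ (β - 1) +
        max ((1 / 2) ^ (β - 1)) ((R + 1) ^ (β - 1)) * ‖1 - V s‖ ^ (α - 1))) (Icc a b) := by
    have hW : ContDiffOn ℝ 1 (fun s => 1 - V s) (Icc a b) := contDiffOn_const.sub hV
    have hW' : ∀ s ∈ Icc a b, derivWithin (fun s => 1 - V s) (Icc a b) s ≠ 0 := by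
      intro s hs
      rw [derivWithin_const_sub]
      exact neg_ne_zero.2 (hV' s hs)
    exact (((integrableOn_norm_rpow_of_regular (by linarith) hV hV').const_mul _).add
      ((integrableOn_norm_rpow_of_regular (by linarith) hW hW').const_mul _)).const_mul C
  have hGint : IntegrableOn G (Icc a b \ Z) := by
    have hm : MeasurableSet (Icc a b \ Z) := measurableSet_Icc.diff hZ.measurableSet
    refine Integrable.mono' (hI.mono_set sdiff_subset) ?_ ?_
    · refine ContinuousOn.aestronglyMeasurable ?_ hm
      exact ((continuousOn_betaIntegrand hH).comp (hV.continuousOn.mono sdiff_subset)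
        fun s hs => hcut s hs.1 hs.2).mul (hdV.mono sdiff_subset)
    · refine (ae_restrict_iff' hm).2 (Eventually.of_forall fun s hs => ?_)
      have h1 := norm_cpow_le_add (α := α) (β := β) (hcut s hs.1 hs.2)
      have h2 := hC s hs.1
      have h3 : G s = (H (V s) * derivWithin V (Icc a b) s) *
          (V s ^ ((β - 1 : ℝ) : ℂ) * (1 - V s) ^ ((α - 1 : ℝ) : ℂ)) := by
        simp only [G, betaIntegrand]; ring
      rw [h3, norm_mul]
      exact mul_le_mul h2 h1 (norm_nonneg _) ((norm_nonneg _).trans h2)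
  have hFint : IntervalIntegrable F volume a b := by
    rw [intervalIntegrable_iff_integrableOn_Ioo_of_le hab.le]
    have hmz : ∀ᵐ s : ℝ, s ∉ Z := by
      rw [ae_iff]
      simpa using hZ.measure_zero volume
    have h1 : IntegrableOn G (Ioo a b) := by
      refine hGint.congr_set_ae ?_ |>.mono_set Ioo_subset_Icc_self
      filter_upwards [hmz] with s hs
      simp only [eq_iff_iff]
      exact ⟨fun h => ⟨h, hs⟩, fun h => h.1⟩
    refine h1.congr ?_
    refine (ae_restrict_iff' measurableSet_Ioo).2 ?_
    filter_upwards [hmz] with s hs hs'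
    exact (hFG s hs' hs).symm
  refine ⟨hFint, ?_⟩
  refine integral_eq_of_hasDerivAt_off_countable_of_le (fun s => Φ (V s)) F hab.le hZ.countable
    (hΦ.comp hV.continuousOn hVm) ?_ hFint
  intro s hs
  have hc := hcut s (Ioo_subset_Icc_self hs.1) hs.2
  rw [hFG s hs.1 hs.2]
  exact HasDerivAt.comp s (hΦ' _ hc) (hderiv s hs.1)

/-! ### The disk coordinate centred in a point of the upper half-plane -/

theorem sub_conj_im_pos {a z : ℂ} (ha : 0 < a.im) (hz : 0 < z.im) : 0 < (z - conj a).im := by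
  simp only [sub_im, conj_im]; linarith

theorem ne_zero_of_im_pos {w : ℂ} (h : 0 < w.im) : w ≠ 0 := by
  rintro rfl; simp at h

theorem normSq_sub_conj (a z : ℂ) :
    Complex.normSq (z - conj a) = Complex.normSq (z - a) + 4 * a.im * z.im := by
  simp only [Complex.normSq_apply, sub_re, sub_im, conj_re, conj_im]; ring

theorem norm_toDiskAt_lt_one {a z : ℂ} (ha : 0 < a.im) (hz : 0 < z.im) : ‖toDiskAt a z‖ < 1 := by
  have h0 : 0 < ‖z - conj a‖ := norm_pos_iff.2 (ne_zero_of_im_pos (sub_conj_im_pos ha hz))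
  rw [toDiskAt, norm_div, div_lt_one h0]
  refine lt_of_pow_lt_pow_left₀ 2 (norm_nonneg _) ?_
  rw [← Complex.normSq_eq_norm_sq, ← Complex.normSq_eq_norm_sq, normSq_sub_conj]
  nlinarith [mul_pos ha hz]

theorem im_pos_of_norm_toDiskAt_lt_one {a z : ℂ} (ha : 0 < a.im) (h0 : z - conj a ≠ 0)
    (h : ‖toDiskAt a z‖ < 1) : 0 < z.im := by
  rw [toDiskAt, norm_div, div_lt_one (norm_pos_iff.2 h0)] at h
  have h2 := pow_lt_pow_left₀ h (norm_nonneg _) two_ne_zero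
  rw [← Complex.normSq_eq_norm_sq, ← Complex.normSq_eq_norm_sq, normSq_sub_conj] at h2
  by_contra hc
  nlinarith

theorem toDiskAt_ne_zero {a b : ℂ} (ha : 0 < a.im) (hb : 0 < b.im) (hab : b ≠ a) :
    toDiskAt a b ≠ 0 :=
  div_ne_zero (sub_ne_zero.2 hab) (ne_zero_of_im_pos (sub_conj_im_pos ha hb))

/-- The quotient of two elements of the upper half-plane is not a negative real number. -/
theorem div_mem_slitPlane_of_im_pos {z w : ℂ} (hz : 0 < z.im) (hw : 0 < w.im) :
    z / w ∈ slitPlane := by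
  rw [mem_slitPlane_iff_not_le_zero]
  intro h
  rw [Complex.le_def] at h
  simp only [zero_re, zero_im] at h
  have e : z = ((z / w).re : ℂ) * w := by
    have h1 : z / w = ((z / w).re : ℂ) := by
      apply Complex.ext <;> simp [h.2]
    rw [← h1, div_mul_cancel₀ _ (ne_zero_of_im_pos hw)]
  have h2 := congrArg Complex.im e
  rw [im_ofReal_mul] at h2
  nlinarith [h.1]

/-- The point with disk coordinate `U * toDiskAt a b`, for complex `U`. -/
def geodesicExt (a b U : ℂ) : ℂ :=
  (a - conj a * (toDiskAt a b * U)) / (1 - toDiskAt a b * U)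

theorem geodesic_eq_geodesicExt (a b : ℂ) (u : ℝ) : geodesic a b u = geodesicExt a b u := rfl

theorem geodesicExt_sub_conj {a b U : ℂ} (hU : 1 - toDiskAt a b * U ≠ 0) :
    geodesicExt a b U - conj a = (a - conj a) / (1 - toDiskAt a b * U) := by
  rw [geodesicExt]; field_simp; ring

theorem geodesicExt_sub {a b U : ℂ} (hU : 1 - toDiskAt a b * U ≠ 0) :
    geodesicExt a b U - a = (a - conj a) * (toDiskAt a b * U) / (1 - toDiskAt a b * U) := by
  rw [geodesicExt]; field_simp; ring

theorem self_sub_conj_ne_zero {a : ℂ} (ha : 0 < a.im) : a - conj a ≠ 0 :=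
  ne_zero_of_im_pos (sub_conj_im_pos ha ha)

theorem toDiskAt_geodesicExt {a b U : ℂ} (ha : 0 < a.im) (hU : 1 - toDiskAt a b * U ≠ 0) :
    toDiskAt a (geodesicExt a b U) = toDiskAt a b * U := by
  have := self_sub_conj_ne_zero ha
  rw [toDiskAt, geodesicExt_sub hU, geodesicExt_sub_conj hU]
  field_simp

theorem one_sub_ne_zero_of_norm_lt {w : ℂ} (hw : ‖w‖ < 1) : 1 - w ≠ 0 := by
  intro h
  rw [← sub_eq_zero.1 h, norm_one] at hw
  exact lt_irrefl _ hw

theorem geodesicExt_im_pos {a b U : ℂ} (ha : 0 < a.im) (hU : ‖toDiskAt a b * U‖ < 1) :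
    0 < (geodesicExt a b U).im := by
  have h := one_sub_ne_zero_of_norm_lt hU
  refine im_pos_of_norm_toDiskAt_lt_one ha ?_ (by rwa [toDiskAt_geodesicExt ha h])
  rw [geodesicExt_sub_conj h]
  exact div_ne_zero (self_sub_conj_ne_zero ha) h

theorem geodesicExt_toDiskAt {a b z : ℂ} (ha : 0 < a.im) (hb : 0 < b.im) (hab : b ≠ a)
    (hz : 0 < z.im) : geodesicExt a b (toDiskAt a z / toDiskAt a b) = z := by
  have h1 := toDiskAt_ne_zero ha hb hab
  have h2 := ne_zero_of_im_pos (sub_conj_im_pos ha hz)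
  have h3 := self_sub_conj_ne_zero ha
  rw [geodesicExt, mul_div_cancel₀ _ h1, div_eq_iff (one_sub_ne_zero_of_norm_lt
    (norm_toDiskAt_lt_one ha hz)), toDiskAt]
  field_simp
  ring

theorem hasDerivAt_geodesicExt {a b U : ℂ} (hU : 1 - toDiskAt a b * U ≠ 0) :
    HasDerivAt (geodesicExt a b)
      (toDiskAt a b * (a - conj a) / (1 - toDiskAt a b * U) ^ 2) U := by
  have h1 : HasDerivAt (fun U : ℂ => toDiskAt a b * U) (toDiskAt a b) U := by
    simpa using (hasDerivAt_id U).const_mul (toDiskAt a b)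
  refine (((h1.const_mul (conj a)).const_sub a).div (h1.const_sub 1) hU).congr_deriv ?_
  congr 1
  ring

/-- Recentring the disk from `a` to `b` is a Möbius map in the normalized coordinate `U`. It is
real, exchanges `0` and `1`, and has its pole at `1/|toDiskAt a b|²`. -/
theorem toDiskAt_div_symm {a b z : ℂ} (ha : 0 < a.im) (hb : 0 < b.im) (hab : b ≠ a)
    (hz : 0 < z.im) :
    toDiskAt b z / toDiskAt b a = (1 - toDiskAt a z / toDiskAt a b) *
      (1 - (Complex.normSq (toDiskAt a b) : ℂ) * (toDiskAt a z / toDiskAt a b))⁻¹ := by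
  have h0 := self_sub_conj_ne_zero ha
  have h1 := ne_zero_of_im_pos (sub_conj_im_pos ha hz)
  have h2 := ne_zero_of_im_pos (sub_conj_im_pos ha hb)
  have h3 := ne_zero_of_im_pos (sub_conj_im_pos hb hz)
  have h4 := ne_zero_of_im_pos (sub_conj_im_pos hb ha)
  have h5 := sub_ne_zero.2 hab
  have h6 := sub_ne_zero.2 hab.symm
  have h7 : conj b - a ≠ 0 := fun h => h4 (by linear_combination -h)
  have h8 : conj a - a ≠ 0 := fun h => h0 (by linear_combination -h)
  have e1 : 1 - toDiskAt a z / toDiskAt a b =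
      (z - b) * (conj a - a) / ((z - conj a) * (b - a)) := by
    unfold toDiskAt; field_simp; ring
  have e2 : 1 - (Complex.normSq (toDiskAt a b) : ℂ) * (toDiskAt a z / toDiskAt a b) =
      (z - conj b) * (conj a - a) / ((z - conj a) * (conj b - a)) := by
    rw [← Complex.mul_conj]
    simp only [toDiskAt, map_div₀, map_sub, Complex.conj_conj]
    field_simp; ring
  rw [e1, e2]
  unfold toDiskAt
  field_simp
  ring

/-! ### The integrand in the disk coordinate -/

theorem log_mul_of_im_lt_or {x y : ℂ} (hx : x ∈ slitPlane) (hy : y ∈ slitPlane)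
    (h : (x.im < 0 ∧ 0 < y.im) ∨ (0 < x.im ∧ y.im < 0) ∨ (x.im = 0 ∧ y.im = 0)) :
    log (x * y) = log x + log y := by
  refine log_mul (slitPlane_ne_zero hx) (slitPlane_ne_zero hy) ?_
  have h1 := neg_pi_lt_arg x
  have h2 := neg_pi_lt_arg y
  have h3 := arg_le_pi x
  have h4 := arg_le_pi y
  rcases h with ⟨hx', hy'⟩ | ⟨hx', hy'⟩ | ⟨hx', hy'⟩
  · have h5 := arg_neg_iff.2 hx'
    have h6 := arg_nonneg_iff.2 hy'.le
    exact ⟨by linarith, by linarith⟩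
  · have h5 := arg_neg_iff.2 hy'
    have h6 := arg_nonneg_iff.2 hx'.le
    exact ⟨by linarith, by linarith⟩
  · rw [mem_slitPlane_iff] at hx hy
    have h5 : arg x = 0 := arg_eq_zero_iff.2 ⟨(hx.resolve_right (by simp [hx'])).le, hx'⟩
    have h6 : arg y = 0 := arg_eq_zero_iff.2 ⟨(hy.resolve_right (by simp [hy'])).le, hy'⟩
    rw [h5, h6]
    exact ⟨by linarith [Real.pi_pos], by linarith [Real.pi_pos]⟩

/-- The imaginary parts of `1 - U` and `(1 - cU)⁻¹` have opposite signs or both vanish, so the sum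
of the arguments does not leave the principal range. -/
theorem log_one_sub_mul_inv {U : ℂ} {c : ℝ} (hc : 0 < c) (hU : 1 - U ∈ slitPlane)
    (hcU : ‖(c : ℂ) * U‖ < 1) :
    log ((1 - U) * (1 - c * U)⁻¹) = log (1 - U) + log (1 - c * U)⁻¹ := by
  have h1 : 0 < (1 - c * U).re := by
    have := (abs_le.1 (abs_re_le_norm (c * U))).2
    simp only [sub_re, one_re]; linarith
  have h2 : 0 < (1 - c * U)⁻¹.re := inv_re_pos h1
  have h0 : 0 < Complex.normSq (1 - c * U) :=
    Complex.normSq_pos.2 (one_sub_ne_zero_of_norm_lt hcU)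
  have h3 : (1 - c * U)⁻¹.im = c * U.im / Complex.normSq (1 - c * U) := by
    rw [inv_im]; simp
  refine log_mul_of_im_lt_or hU (mem_slitPlane_iff.2 (Or.inl h2)) ?_
  rw [h3]
  simp only [sub_im, one_im, zero_sub]
  rcases lt_trichotomy U.im 0 with h | h | h
  · right; left
    exact ⟨by linarith, div_neg_of_neg_of_pos (mul_neg_of_pos_of_neg hc h) h0⟩
  · right; right
    simp [h]
  · left
    exact ⟨by linarith, by positivity⟩

/-- The holomorphic factor of the branched integrand in the disk coordinate. -/
def regularFactor (α β : ℝ) (f : ℍ → ℂ) (a b U : ℂ) : ℂ :=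
  f (ofComplex (geodesicExt a b U)) *
    exp ((β - 1 : ℝ) * log ((geodesicExt a b U - conj a) / (b - conj a))) *
    exp ((α - 1 : ℝ) * (log (1 - (Complex.normSq (toDiskAt a b) : ℂ) * U)⁻¹ +
      log ((geodesicExt a b U - conj b) / (a - conj b)))) / (b - a) *
    (toDiskAt a b * (a - conj a) / (1 - toDiskAt a b * U) ^ 2)

theorem norm_toDiskAt_mul_lt {a b U : ℂ} (ha : 0 < a.im) (hb : 0 < b.im) (hab : b ≠ a)
    (hU : ‖U‖ < ‖toDiskAt a b‖⁻¹) : ‖toDiskAt a b * U‖ < 1 := by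
  have h := norm_pos_iff.2 (toDiskAt_ne_zero ha hb hab)
  rw [norm_mul]
  calc ‖toDiskAt a b‖ * ‖U‖ < ‖toDiskAt a b‖ * ‖toDiskAt a b‖⁻¹ := mul_lt_mul_of_pos_left hU h
    _ = 1 := mul_inv_cancel₀ h.ne'

theorem norm_normSq_mul_lt {a b U : ℂ} (ha : 0 < a.im) (hb : 0 < b.im) (hab : b ≠ a)
    (hU : ‖U‖ < ‖toDiskAt a b‖⁻¹) : ‖(Complex.normSq (toDiskAt a b) : ℂ) * U‖ < 1 := by
  have h1 := norm_toDiskAt_mul_lt ha hb hab hU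
  have h2 := norm_toDiskAt_lt_one ha hb
  rw [norm_mul] at h1
  rw [norm_mul, Complex.norm_real, Real.norm_of_nonneg (Complex.normSq_nonneg _),
    Complex.normSq_eq_norm_sq, sq, mul_assoc]
  nlinarith [norm_nonneg (toDiskAt a b), norm_nonneg U]

theorem one_lt_inv_norm_toDiskAt {a b : ℂ} (ha : 0 < a.im) (hb : 0 < b.im) (hab : b ≠ a) :
    1 < ‖toDiskAt a b‖⁻¹ :=
  (one_lt_inv₀ (norm_pos_iff.2 (toDiskAt_ne_zero ha hb hab))).2 (norm_toDiskAt_lt_one ha hb)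

theorem norm_toDiskAt_div_lt {a b z : ℂ} (ha : 0 < a.im) (hb : 0 < b.im) (hab : b ≠ a)
    (hz : 0 < z.im) : ‖toDiskAt a z / toDiskAt a b‖ < ‖toDiskAt a b‖⁻¹ := by
  have h := norm_pos_iff.2 (toDiskAt_ne_zero ha hb hab)
  rw [norm_div, div_eq_mul_inv]
  exact mul_lt_of_lt_one_left (inv_pos.2 h) (norm_toDiskAt_lt_one ha hz)

theorem differentiableOn_regularFactor {a b : ℂ} (ha : 0 < a.im) (hb : 0 < b.im) (hab : b ≠ a)
    (α β : ℝ) {f : ℍ → ℂ} (hf : DifferentiableOn ℂ (fun z => f (ofComplex z)) {z | 0 < z.im}) :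
    DifferentiableOn ℂ (regularFactor α β f a b) (Metric.ball 0 ‖toDiskAt a b‖⁻¹) := by
  have hw : ∀ U ∈ Metric.ball (0 : ℂ) ‖toDiskAt a b‖⁻¹, ‖toDiskAt a b * U‖ < 1 := fun U hU =>
    norm_toDiskAt_mul_lt ha hb hab (by simpa using hU)
  have hne : ∀ U ∈ Metric.ball (0 : ℂ) ‖toDiskAt a b‖⁻¹, 1 - toDiskAt a b * U ≠ 0 := fun U hU =>
    one_sub_ne_zero_of_norm_lt (hw U hU)
  have him : ∀ U ∈ Metric.ball (0 : ℂ) ‖toDiskAt a b‖⁻¹, 0 < (geodesicExt a b U).im :=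
    fun U hU => geodesicExt_im_pos ha (hw U hU)
  have hZ : DifferentiableOn ℂ (geodesicExt a b) (Metric.ball 0 ‖toDiskAt a b‖⁻¹) := fun U hU =>
    (hasDerivAt_geodesicExt (hne U hU)).differentiableAt.differentiableWithinAt
  have hlog : ∀ {x y : ℂ}, 0 < x.im → 0 < y.im → DifferentiableOn ℂ
      (fun U => log ((geodesicExt a b U - conj x) / (y - conj x)))
      (Metric.ball 0 ‖toDiskAt a b‖⁻¹) := fun {x y} hx hy =>
    ((hZ.sub_const _).div_const _).clog fun U hU =>
      div_mem_slitPlane_of_im_pos (sub_conj_im_pos hx (him U hU)) (sub_conj_im_pos hx hy)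
  have hlin : ∀ c : ℂ, Differentiable ℂ fun U : ℂ => 1 - c * U := fun c => by fun_prop
  have hinv : DifferentiableOn ℂ
      (fun U => log (1 - (Complex.normSq (toDiskAt a b) : ℂ) * U)⁻¹)
      (Metric.ball 0 ‖toDiskAt a b‖⁻¹) := by
    have hlt : ∀ U ∈ Metric.ball (0 : ℂ) ‖toDiskAt a b‖⁻¹,
        ‖(Complex.normSq (toDiskAt a b) : ℂ) * U‖ < 1 := fun U hU =>
      norm_normSq_mul_lt ha hb hab (by simpa using hU)
    refine DifferentiableOn.clog ((hlin _).differentiableOn.fun_inv fun U hU =>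
      one_sub_ne_zero_of_norm_lt (hlt U hU)) fun U hU => ?_
    refine mem_slitPlane_iff.2 (Or.inl (inv_re_pos ?_))
    have := (abs_le.1 (abs_re_le_norm ((Complex.normSq (toDiskAt a b) : ℂ) * U))).2
    have := hlt U hU
    simp only [sub_re, one_re]; linarith
  refine ((((hf.comp hZ him).mul ((hlog ha hb).const_mul _).cexp).mul
    (((hinv.add (hlog hb ha)).const_mul _).cexp)).div_const _).mul ?_
  exact ((differentiableOn_const _).div ((hlin _).pow 2).differentiableOn
    fun U hU => pow_ne_zero 2 (hne U hU))

/-- The extra factor on the left is `dz/dU`. Of the four logarithms in the two branches, only those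
of `U` and `1 - U` are singular; the remaining parts are collected in `regularFactor`. -/
theorem branchKernel_eq {a b z : ℂ} (ha : 0 < a.im) (hb : 0 < b.im) (hab : b ≠ a)
    (hz : 0 < z.im) {r₁ r₂ : ℝ} (f : ℍ → ℂ)
    (hU : toDiskAt a z / toDiskAt a b ∈ cutDisk ‖toDiskAt a b‖⁻¹) :
    branchKernel r₁ r₂ f a b z *
        (toDiskAt a b * (a - conj a) / (1 - toDiskAt a b * (toDiskAt a z / toDiskAt a b)) ^ 2) =
      betaIntegrand (2 - r₁) (2 - r₂) (regularFactor (2 - r₁) (2 - r₂) f a b)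
        (toDiskAt a z / toDiskAt a b) := by
  set U := toDiskAt a z / toDiskAt a b with hUdef
  have hZ : geodesicExt a b U = z := geodesicExt_toDiskAt ha hb hab hz
  have hc : 0 < Complex.normSq (toDiskAt a b) :=
    Complex.normSq_pos.2 (toDiskAt_ne_zero ha hb hab)
  have hs : toDiskAt b z / toDiskAt b a =
      (1 - U) * (1 - (Complex.normSq (toDiskAt a b) : ℂ) * U)⁻¹ := toDiskAt_div_symm ha hb hab hz
  have hl := log_one_sub_mul_inv hc hU.2.2 (norm_normSq_mul_lt ha hb hab hU.1)
  have h1 : branchPow a b (1 - r₂) z = U ^ (((2 - r₂ - 1 : ℝ)) : ℂ) *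
      exp ((2 - r₂ - 1 : ℝ) * log ((z - conj a) / (b - conj a))) := by
    rw [branchPow, branchLog, ← hUdef, cpow_def_of_ne_zero (slitPlane_ne_zero hU.2.1), ← exp_add]
    congr 1
    push_cast
    ring
  have h2 : branchPow b a (1 - r₁) z = (1 - U) ^ (((2 - r₁ - 1 : ℝ)) : ℂ) *
      exp ((2 - r₁ - 1 : ℝ) * (log (1 - (Complex.normSq (toDiskAt a b) : ℂ) * U)⁻¹ +
      log ((z - conj b) / (a - conj b)))) := by
    rw [branchPow, branchLog, hs, hl, cpow_def_of_ne_zero (slitPlane_ne_zero hU.2.2), ← exp_add]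
    congr 1
    push_cast
    ring
  rw [betaIntegrand, regularFactor, hZ, branchKernel, h1, h2]
  ring

/-- Outside the slit conditions `U` is real with `U ≤ 0` or `U ≥ 1`, so `z` is on the geodesic line.
Avoidance then puts `U` in `[0, 1]`, which leaves only `0` and `1`. -/
theorem toDiskAt_div_mem {a b z : ℂ} (ha : 0 < a.im) (hb : 0 < b.im) (hab : b ≠ a)
    (hz : 0 < z.im) (h : z ∉ geodesicLine a b \ geodesicSegment a b) :
    toDiskAt a z / toDiskAt a b ∈ insert 0 (insert 1 (cutDisk ‖toDiskAt a b‖⁻¹)) := by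
  set U := toDiskAt a z / toDiskAt a b with hUdef
  have hB := toDiskAt_ne_zero ha hb hab
  have hZ : geodesicExt a b U = z := geodesicExt_toDiskAt ha hb hab hz
  have hlt := norm_toDiskAt_div_lt ha hb hab hz
  have key : ∀ u : ℝ, (u : ℂ) = U → u ∈ Icc (0 : ℝ) 1 := by
    intro u hu
    have hline : z ∈ geodesicLine a b :=
      ⟨hz, u, by rw [geodesic_eq_geodesicExt, hu, hZ]⟩
    by_contra hcon
    refine h ⟨hline, ?_⟩
    rintro ⟨w, hw, hwz⟩
    have h1 : ‖toDiskAt a b * w‖ < 1 := by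
      refine norm_toDiskAt_mul_lt ha hb hab (lt_of_le_of_lt ?_ (one_lt_inv_norm_toDiskAt ha hb hab))
      rw [Complex.norm_real, Real.norm_of_nonneg hw.1]
      exact hw.2
    have h2 := toDiskAt_geodesicExt ha (one_sub_ne_zero_of_norm_lt h1)
    rw [← geodesic_eq_geodesicExt, hwz] at h2
    have h3 : (u : ℂ) = w := by rw [hu, hUdef, h2, mul_div_cancel_left₀ _ hB]
    exact hcon (by rwa [Complex.ofReal_inj.1 h3])
  by_cases h0 : U ∈ slitPlane
  · by_cases h1 : 1 - U ∈ slitPlane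
    · exact Or.inr (Or.inr ⟨hlt, h0, h1⟩)
    · rw [mem_slitPlane_iff] at h1
      push Not at h1
      simp only [sub_re, one_re, sub_im, one_im, zero_sub, neg_eq_zero] at h1
      have hu : (U.re : ℂ) = U := by apply Complex.ext <;> simp [h1.2]
      have h2 := key _ hu
      refine Or.inr (Or.inl ?_)
      rw [← hu, show U.re = 1 by linarith [h2.2, h1.1], ofReal_one]
  · rw [mem_slitPlane_iff] at h0
    push Not at h0
    have hu : (U.re : ℂ) = U := by apply Complex.ext <;> simp [h0.2]
    have h2 := key _ hu
    refine Or.inl ?_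
    rw [← hu, show U.re = 0 by linarith [h2.1, h0.1], ofReal_zero]

/-! ### Independence of the path -/

/-- The common value is `Φ 1 - Φ 0` for a primitive `Φ` in the coordinate `U`: each regular piece
contributes the increment of `Φ`, and the increments telescope. -/
theorem exists_integral_eq_of_isAdmissiblePath {a b : ℂ} (ha : 0 < a.im) (hb : 0 < b.im)
    (hab : b ≠ a) {r₁ r₂ : ℝ} (hr₁ : r₁ < 2) (hr₂ : r₂ < 2) {f : ℍ → ℂ}
    (hf : DifferentiableOn ℂ (fun z => f (ofComplex z)) {z | 0 < z.im}) :
    ∃ L : ℂ, ∀ γ : ℝ → ℂ, IsAdmissiblePath a b γ →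
      IntervalIntegrable (fun s => branchKernel r₁ r₂ f a b (γ s) * deriv γ s) volume 0 1 ∧
        pathIntegral γ (branchKernel r₁ r₂ f a b) = L := by
  have hH := differentiableOn_regularFactor ha hb hab (2 - r₁) (2 - r₂) hf
  have hR := one_lt_inv_norm_toDiskAt ha hb hab
  obtain ⟨Φ, hΦ, hΦ'⟩ := exists_primitive_betaIntegrand (α := 2 - r₁) (β := 2 - r₂)
    (by linarith) (by linarith) hR hH
  refine ⟨Φ 1 - Φ 0, fun γ hγ => ?_⟩
  obtain ⟨n, p, hp, hp0, hpn, hpiece⟩ := hγ.piecewise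
  have hB := toDiskAt_ne_zero ha hb hab
  set V : ℝ → ℂ := fun s => toDiskAt a (γ s) / toDiskAt a b with hV
  have hZV : ∀ s ∈ Icc (0 : ℝ) 1, γ s = geodesicExt a b (V s) := fun s hs =>
    (geodesicExt_toDiskAt ha hb hab (hγ.im_pos s hs)).symm
  have hV1 : ∀ s ∈ Icc (0 : ℝ) 1, 1 - toDiskAt a b * V s ≠ 0 := fun s hs =>
    one_sub_ne_zero_of_norm_lt (norm_toDiskAt_mul_lt ha hb hab
      (norm_toDiskAt_div_lt ha hb hab (hγ.im_pos s hs)))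
  have hpieces : ∀ k < n,
      IntervalIntegrable (fun s => branchKernel r₁ r₂ f a b (γ s) * deriv γ s) volume
        (p k) (p (k + 1)) ∧
      ∫ s in p k..p (k + 1), branchKernel r₁ r₂ f a b (γ s) * deriv γ s =
        Φ (V (p (k + 1))) - Φ (V (p k)) := by
    intro k hk
    obtain ⟨hγk, hγk'⟩ := hpiece k hk
    have hlt : p k < p (k + 1) := hp k.lt_succ_self
    have hsub : Icc (p k) (p (k + 1)) ⊆ Icc 0 1 := by
      refine Icc_subset_Icc ?_ ?_
      · rw [← hp0]; exact hp.monotone (Nat.zero_le k)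
      · rw [← hpn]; exact hp.monotone hk
    have hVk : ContDiffOn ℝ 1 V (Icc (p k) (p (k + 1))) := by
      have h1 : ContDiffOn ℝ 1 (fun s => (γ s - conj a)⁻¹) (Icc (p k) (p (k + 1))) :=
        (hγk.sub contDiffOn_const).inv fun s hs =>
          ne_zero_of_im_pos (sub_conj_im_pos ha (hγ.im_pos s (hsub hs)))
      exact (((hγk.sub contDiffOn_const).mul h1).mul contDiffOn_const :
        ContDiffOn ℝ 1 (fun s => (γ s - a) * (γ s - conj a)⁻¹ * (toDiskAt a b)⁻¹) _)
    refine integral_regular_piece (by linarith) (by linarith) hR hH hΦ hΦ' hlt hVk ?_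
      (fun s hs => toDiskAt_div_mem ha hb hab (hγ.im_pos s (hsub hs)) (hγ.avoids s (hsub hs))) ?_
    -- Regularity passes to the new coordinate: `γ` is `geodesicExt` composed with `V`, so a zero of
    -- `V'` would be a zero of `γ'`.
    · intro s hs h0
      have h1 : HasDerivWithinAt V 0 (Icc (p k) (p (k + 1))) s := by
        rw [← h0]
        exact (hVk.differentiableOn one_ne_zero s hs).hasDerivWithinAt
      have h2 := (hasDerivAt_geodesicExt (hV1 s (hsub hs))).comp_hasDerivWithinAt s h1
      rw [mul_zero] at h2
      have h3 : HasDerivWithinAt γ 0 (Icc (p k) (p (k + 1))) s :=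
        h2.congr (fun t ht => hZV t (hsub ht)) (hZV s (hsub hs))
      exact hγk' s hs (h3.derivWithin (uniqueDiffOn_Icc hlt s hs))
    · intro s hs hcut
      have hs' := Ioo_subset_Icc_self hs
      have hnhds : Icc (p k) (p (k + 1)) ∈ 𝓝 s := Icc_mem_nhds hs.1 hs.2
      have h1 : HasDerivAt V (deriv V s) s :=
        ((hVk.differentiableOn one_ne_zero s hs').differentiableAt hnhds).hasDerivAt
      have h2 := HasDerivAt.comp s (hasDerivAt_geodesicExt (hV1 s (hsub hs'))) h1
      have h3 : deriv γ s = toDiskAt a b * (a - conj a) / (1 - toDiskAt a b * V s) ^ 2 *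
          deriv V s :=
        (h2.congr_of_eventuallyEq (by
          filter_upwards [hnhds] with t ht
          exact hZV t (hsub ht))).deriv
      rw [h3, ← mul_assoc, branchKernel_eq ha hb hab (hγ.im_pos s (hsub hs')) f hcut]
  have hV0 : V 0 = 0 := by simp [hV, hγ.source, toDiskAt]
  have hV1' : V 1 = 1 := by simp only [hV, hγ.target]; exact div_self hB
  refine ⟨?_, ?_⟩
  · have h := IntervalIntegrable.trans_iterate fun k hk => (hpieces k hk).1
    rwa [hp0, hpn] at h
  · have h := intervalIntegral.sum_integral_adjacent_intervals fun k hk => (hpieces k hk).1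
    rw [hp0, hpn] at h
    rw [pathIntegral, ← h, Finset.sum_congr rfl fun k hk => (hpieces k (Finset.mem_range.1 hk)).2,
      Finset.sum_range_sub (fun k => Φ (V (p k))), hp0, hpn, hV0, hV1']

theorem toDiskAt_div_mul {a b z : ℂ} (ha : 0 < a.im) (hb : 0 < b.im) (hz : 0 < z.im) :
    toDiskAt a z / toDiskAt a b * ((z - conj a) / (b - conj a)) = (z - a) / (b - a) := by
  have h1 := ne_zero_of_im_pos (sub_conj_im_pos ha hz)
  have h2 := ne_zero_of_im_pos (sub_conj_im_pos ha hb)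
  unfold toDiskAt
  field_simp

theorem branchLog_eq_of_toDiskAt {a b z : ℂ} (ha : 0 < a.im) (hb : 0 < b.im) (hz : 0 < z.im)
    {u : ℝ} (hu : 0 < u) (h : toDiskAt a z / toDiskAt a b = u) :
    branchLog a b z = log ((z - a) / (b - a)) := by
  have hq := div_mem_slitPlane_of_im_pos (sub_conj_im_pos ha hz) (sub_conj_im_pos ha hb)
  rw [← toDiskAt_div_mul ha hb hz, branchLog, h, log_ofReal_mul hu (slitPlane_ne_zero hq),
    ofReal_log hu.le]

/-- With `q = (z - conj a)/(b - conj a)` the first logarithm is `log (s/q)`, so `log q` cancels.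
Hence the continued powers on the chord are the ordinary real powers of `s`. -/
theorem branchLog_eq_log {a b z : ℂ} (ha : 0 < a.im) (hb : 0 < b.im) (hz : 0 < z.im)
    {s : ℝ} (hs : 0 < s) (h : (z - a) / (b - a) = s) : branchLog a b z = Real.log s := by
  have hq := div_mem_slitPlane_of_im_pos (sub_conj_im_pos ha hz) (sub_conj_im_pos ha hb)
  have hq0 := slitPlane_ne_zero hq
  have hU : toDiskAt a z / toDiskAt a b = s * ((z - conj a) / (b - conj a))⁻¹ := by
    rw [← h, ← toDiskAt_div_mul ha hb hz, mul_inv_cancel_right₀ hq0]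
  rw [branchLog, hU, log_ofReal_mul hs (inv_ne_zero hq0), log_inv _ (slitPlane_arg_ne_pi hq)]
  ring

/-! ### The chord -/

theorem chord_im_pos {a b : ℂ} (ha : 0 < a.im) (hb : 0 < b.im) {s : ℝ} (hs : s ∈ Icc (0 : ℝ) 1) :
    0 < (a + s * (b - a)).im := by
  have e : (a + s * (b - a)).im = (1 - s) * a.im + s * b.im := by
    simp only [add_im, im_ofReal_mul, sub_im]; ring
  rw [e]
  rcases hs.1.eq_or_lt with rfl | h
  · simpa
  · nlinarith [mul_pos h hb, mul_nonneg (sub_nonneg.2 hs.2) ha.le]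

theorem chord_sub_div {a b : ℂ} (hab : b ≠ a) (s : ℝ) :
    (a + s * (b - a) - a) / (b - a) = s := by
  rw [add_sub_cancel_left, mul_div_cancel_right₀ _ (sub_ne_zero.2 hab)]

theorem chord_sub_div' {a b : ℂ} (hab : b ≠ a) (s : ℝ) :
    (a + s * (b - a) - b) / (a - b) = (1 - s : ℝ) := by
  rw [div_eq_iff (sub_ne_zero.2 hab.symm)]
  push_cast
  ring

theorem not_neg_of_mul_slitPlane {u s : ℝ} {q : ℂ} (hq : q ∈ slitPlane) (hs : 0 ≤ s)
    (h : (u : ℂ) * q = s) : 0 ≤ u := by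
  by_contra hu
  push Not at hu
  have h1 := congrArg Complex.re h
  have h2 := congrArg Complex.im h
  rw [re_ofReal_mul, ofReal_re] at h1
  rw [im_ofReal_mul, ofReal_im] at h2
  rw [mem_slitPlane_iff] at hq
  rcases hq with h3 | h3
  · nlinarith
  · exact h3 ((mul_eq_zero.1 h2).resolve_left hu.ne)

theorem real_toDiskAt_div_symm_pos {a b : ℂ} (ha : 0 < a.im) (hb : 0 < b.im) {u : ℝ}
    (hu : ‖toDiskAt a b * u‖ < 1) : 0 < 1 - Complex.normSq (toDiskAt a b) * u := by
  have h2 := norm_toDiskAt_lt_one ha hb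
  rw [norm_mul, Complex.norm_real, Real.norm_eq_abs] at hu
  rw [Complex.normSq_eq_norm_sq]
  nlinarith [norm_nonneg (toDiskAt a b), le_abs_self u, abs_nonneg u,
    mul_nonneg (norm_nonneg (toDiskAt a b)) (abs_nonneg u),
    mul_le_mul_of_nonneg_left (le_abs_self u) (sq_nonneg ‖toDiskAt a b‖)]

/-- At a common point of chord and line, the real coordinate `u` times an element of the slit plane
equals `s ≥ 0`, which excludes `u < 0`. The same argument with `a` and `b` exchanged excludes `u >
1`. -/
theorem isAdmissiblePath_chord {a b : ℂ} (ha : 0 < a.im) (hb : 0 < b.im) (hab : b ≠ a) :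
    IsAdmissiblePath a b fun s : ℝ => a + s * (b - a) := by
  have hsm : ContDiff ℝ 1 fun s : ℝ => a + s * (b - a) :=
    contDiff_const.add (ofRealCLM.contDiff.mul contDiff_const)
  refine ⟨by simp, by simp, hsm.continuous.continuousOn, fun s hs => chord_im_pos ha hb hs, ?_,
    1, fun k => k, Nat.strictMono_cast, by simp, by simp, fun k _ => ⟨hsm.contDiffOn, ?_⟩⟩
  · rintro s hs ⟨⟨hz, u, hu⟩, hseg⟩
    set z := a + s * (b - a) with hzdef
    have hB := toDiskAt_ne_zero ha hb hab
    rw [geodesic_eq_geodesicExt] at hu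
    -- With a vanishing denominator the quotient defining `geodesic` takes the default value `0`,
    -- which is not in the upper half-plane.
    have hne : 1 - toDiskAt a b * u ≠ 0 := by
      intro h
      rw [geodesicExt, h, div_zero] at hu
      rw [← hu] at hz
      simp at hz
    have hT : toDiskAt a z = toDiskAt a b * u := by rw [← hu, toDiskAt_geodesicExt ha hne]
    have hU : toDiskAt a z / toDiskAt a b = u := by rw [hT, mul_div_cancel_left₀ _ hB]
    have hlt : ‖toDiskAt a b * u‖ < 1 := by rw [← hT]; exact norm_toDiskAt_lt_one ha hz
    have h0 : 0 ≤ u := by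
      refine not_neg_of_mul_slitPlane (div_mem_slitPlane_of_im_pos (sub_conj_im_pos ha hz)
        (sub_conj_im_pos ha hb)) hs.1 ?_
      rw [← hU, toDiskAt_div_mul ha hb hz, hzdef, chord_sub_div hab]
    have hc := real_toDiskAt_div_symm_pos ha hb hlt
    have h1 : 0 ≤ (1 - u) * (1 - Complex.normSq (toDiskAt a b) * u)⁻¹ := by
      refine not_neg_of_mul_slitPlane (s := 1 - s) (div_mem_slitPlane_of_im_pos
        (sub_conj_im_pos hb hz) (sub_conj_im_pos hb ha)) (by linarith [hs.2]) ?_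
      have := toDiskAt_div_symm ha hb hab hz
      rw [hU] at this
      push_cast
      rw [← this, toDiskAt_div_mul hb ha hz, hzdef, chord_sub_div' hab]
      push_cast; rfl
    have h2 : 0 ≤ 1 - u := by
      by_contra hcon
      push Not at hcon
      exact absurd h1 (not_le.2 (mul_neg_of_neg_of_pos hcon (inv_pos.2 hc)))
    exact hseg ⟨u, ⟨h0, by linarith⟩, by rw [geodesic_eq_geodesicExt, hu]⟩
  · intro s hs
    have hd : HasDerivAt (fun s : ℝ => a + s * (b - a)) (b - a) s := by
      simpa using ((hasDerivAt_id s).ofReal_comp.mul_const (b - a)).const_add a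
    rw [hd.hasDerivWithinAt.derivWithin (uniqueDiffOn_Icc (by push_cast; linarith) s hs)]
    exact sub_ne_zero.2 hab

theorem pathIntegral_chord {a b : ℂ} (ha : 0 < a.im) (hb : 0 < b.im) (hab : b ≠ a) (r₁ r₂ : ℝ)
    (f : ℍ → ℂ) :
    pathIntegral (fun s : ℝ => a + s * (b - a)) (branchKernel r₁ r₂ f a b) =
      ∫ u in (0 : ℝ)..1, segmentKernel r₁ r₂ f a b u := by
  rw [pathIntegral, intervalIntegral.integral_of_le zero_le_one,
    intervalIntegral.integral_of_le zero_le_one, integral_Ioc_eq_integral_Ioo,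
    integral_Ioc_eq_integral_Ioo]
  refine setIntegral_congr_fun measurableSet_Ioo fun s hs => ?_
  have hd : HasDerivAt (fun s : ℝ => a + s * (b - a)) (b - a) s := by
    simpa using ((hasDerivAt_id s).ofReal_comp.mul_const (b - a)).const_add a
  have him := chord_im_pos ha hb (Ioo_subset_Icc_self hs)
  have h1 : 0 < 1 - s := by linarith [hs.2]
  have e1 := branchLog_eq_log ha hb him hs.1 (chord_sub_div hab s)
  have e2 := branchLog_eq_log hb ha him h1 (chord_sub_div' hab s)
  have h3 := sub_ne_zero.2 hab
  change branchKernel r₁ r₂ f a b (a + s * (b - a)) * deriv (fun s : ℝ => a + s * (b - a)) s = _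
  rw [hd.deriv, branchKernel, branchPow, branchPow, e1, e2, segmentKernel,
    Real.rpow_def_of_pos hs.1, Real.rpow_def_of_pos h1]
  push_cast
  rw [mul_comm (1 - (r₂ : ℂ)), mul_comm (1 - (r₁ : ℂ))]
  field_simp

/-! ### The geodesic segment -/

theorem norm_toDiskAt_mul_ofReal_lt {a b : ℂ} (ha : 0 < a.im) (hb : 0 < b.im) {s : ℝ}
    (hs : s ∈ Icc (0 : ℝ) 1) : ‖toDiskAt a b * s‖ < 1 := by
  rw [norm_mul, Complex.norm_real, Real.norm_of_nonneg hs.1]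
  nlinarith [norm_toDiskAt_lt_one ha hb, norm_nonneg (toDiskAt a b), hs.1, hs.2]

theorem hasDerivAt_geodesic {a b : ℂ} {s : ℝ} (hs : 1 - toDiskAt a b * s ≠ 0) :
    HasDerivAt (geodesic a b) (toDiskAt a b * (a - conj a) / (1 - toDiskAt a b * s) ^ 2) s :=
  (hasDerivAt_geodesicExt hs).comp_ofReal

theorem geodesic_im_pos {a b : ℂ} (ha : 0 < a.im) (hb : 0 < b.im) {s : ℝ}
    (hs : s ∈ Icc (0 : ℝ) 1) : 0 < (geodesic a b s).im :=
  geodesicExt_im_pos ha (norm_toDiskAt_mul_ofReal_lt ha hb hs)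

theorem contDiffOn_geodesic {a b : ℂ} (ha : 0 < a.im) (hb : 0 < b.im) :
    ContDiffOn ℝ 1 (geodesic a b) (Icc 0 1) := by
  have h1 : ContDiff ℝ 1 fun s : ℝ => toDiskAt a b * (s : ℂ) :=
    contDiff_const.mul ofRealCLM.contDiff
  have h2 : ContDiffOn ℝ 1 (fun s : ℝ => (1 - toDiskAt a b * (s : ℂ))⁻¹) (Icc 0 1) :=
    (contDiff_const.sub h1).contDiffOn.inv fun s hs =>
      one_sub_ne_zero_of_norm_lt (norm_toDiskAt_mul_ofReal_lt ha hb hs)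
  exact ((contDiff_const.sub (contDiff_const.mul h1)).contDiffOn.mul h2 :
    ContDiffOn ℝ 1 (fun s : ℝ => (a - conj a * (toDiskAt a b * (s : ℂ))) *
      (1 - toDiskAt a b * (s : ℂ))⁻¹) _)

theorem geodesic_zero (a b : ℂ) : geodesic a b 0 = a := by simp [geodesic]

theorem geodesic_one {a b : ℂ} (ha : 0 < a.im) (hb : 0 < b.im) (hab : b ≠ a) :
    geodesic a b 1 = b := by
  rw [geodesic_eq_geodesicExt, ofReal_one, ← div_self (toDiskAt_ne_zero ha hb hab),
    geodesicExt_toDiskAt ha hb hab hb]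

theorem isAdmissiblePath_geodesic {a b : ℂ} (ha : 0 < a.im) (hb : 0 < b.im) (hab : b ≠ a) :
    IsAdmissiblePath a b (geodesic a b) := by
  have hsm := contDiffOn_geodesic ha hb
  refine ⟨geodesic_zero a b, geodesic_one ha hb hab, hsm.continuousOn,
    fun s hs => geodesic_im_pos ha hb hs, fun s hs h => h.2 ⟨s, hs, rfl⟩,
    1, fun k => k, Nat.strictMono_cast, by simp, by simp, fun k hk => ?_⟩
  obtain rfl : k = 0 := by omega
  simp only [Nat.cast_zero, zero_add, Nat.cast_one]
  refine ⟨hsm, fun s hs => ?_⟩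
  have hne := one_sub_ne_zero_of_norm_lt (norm_toDiskAt_mul_ofReal_lt ha hb hs)
  rw [(hasDerivAt_geodesic hne).hasDerivWithinAt.derivWithin (uniqueDiffOn_Icc zero_lt_one s hs)]
  exact div_ne_zero (mul_ne_zero (toDiskAt_ne_zero ha hb hab) (self_sub_conj_ne_zero ha))
    (pow_ne_zero 2 hne)

/-- Inside the segment the coordinates from both ends are positive reals, so each sum of two
logarithms is a single principal logarithm. -/
theorem principalKernel_geodesic {a b : ℂ} (ha : 0 < a.im) (hb : 0 < b.im) (hab : b ≠ a)
    (r₁ r₂ : ℝ) (f : ℍ → ℂ) {s : ℝ} (hs : s ∈ Ioo (0 : ℝ) 1) :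
    principalKernel r₁ r₂ f a b (geodesic a b s) = branchKernel r₁ r₂ f a b (geodesic a b s) := by
  have hs' := Ioo_subset_Icc_self hs
  have hlt := norm_toDiskAt_mul_ofReal_lt ha hb hs'
  have hz := geodesic_im_pos ha hb hs'
  have hB := toDiskAt_ne_zero ha hb hab
  set z := geodesic a b s with hzdef
  have hT : toDiskAt a z = toDiskAt a b * s :=
    toDiskAt_geodesicExt ha (one_sub_ne_zero_of_norm_lt hlt)
  have hU : toDiskAt a z / toDiskAt a b = s := by rw [hT, mul_div_cancel_left₀ _ hB]
  have hc := real_toDiskAt_div_symm_pos ha hb hlt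
  have h1 : 0 < (1 - s) * (1 - Complex.normSq (toDiskAt a b) * s)⁻¹ :=
    mul_pos (by linarith [hs.2]) (inv_pos.2 hc)
  have hU' : toDiskAt b z / toDiskAt b a =
      ((1 - s) * (1 - Complex.normSq (toDiskAt a b) * s)⁻¹ : ℝ) := by
    rw [toDiskAt_div_symm ha hb hab hz, hU]
    push_cast; rfl
  have e1 := branchLog_eq_of_toDiskAt ha hb hz hs.1 hU
  have e2 := branchLog_eq_of_toDiskAt hb ha hz h1 hU'
  have e3 : (b - z) / (b - a) = (z - b) / (a - b) := by rw [← neg_sub, ← neg_sub a b, neg_div_neg_eq]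
  have hza : z ≠ a := by
    intro h
    rw [h] at hU
    simp only [toDiskAt, sub_self, zero_div] at hU
    exact hs.1.ne (by exact_mod_cast hU)
  have hzb : z ≠ b := by
    intro h
    rw [h] at hU'
    have : (1 - s) * (1 - Complex.normSq (toDiskAt a b) * s)⁻¹ = 0 := by
      rw [← Complex.ofReal_eq_zero, ← hU']; simp [toDiskAt]
    exact h1.ne' this
  rw [principalKernel, branchKernel, branchPow, branchPow, e1, e2, e3,
    cpow_def_of_ne_zero (div_ne_zero (sub_ne_zero.2 hza) (sub_ne_zero.2 hab)),
    cpow_def_of_ne_zero (div_ne_zero (sub_ne_zero.2 hzb) (sub_ne_zero.2 hab.symm))]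
  ring_nf

/-! ### All paths give the integral over the chord -/

theorem pathIntegral_branchKernel {a b : ℂ} (ha : 0 < a.im) (hb : 0 < b.im) (hab : b ≠ a)
    {r₁ r₂ : ℝ} (hr₁ : r₁ < 2) (hr₂ : r₂ < 2) {f : ℍ → ℂ}
    (hf : DifferentiableOn ℂ (fun z => f (ofComplex z)) {z | 0 < z.im}) {γ : ℝ → ℂ}
    (hγ : IsAdmissiblePath a b γ) :
    IntervalIntegrable (fun s => branchKernel r₁ r₂ f a b (γ s) * deriv γ s) volume 0 1 ∧
      pathIntegral γ (branchKernel r₁ r₂ f a b) =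
        ∫ u in (0 : ℝ)..1, segmentKernel r₁ r₂ f a b u := by
  obtain ⟨L, hL⟩ := exists_integral_eq_of_isAdmissiblePath ha hb hab hr₁ hr₂ hf
  refine ⟨(hL γ hγ).1, ?_⟩
  rw [(hL γ hγ).2, ← pathIntegral_chord ha hb hab, (hL _ (isAdmissiblePath_chord ha hb hab)).2]

theorem pathIntegral_principalKernel {a b : ℂ} (ha : 0 < a.im) (hb : 0 < b.im) (hab : b ≠ a)
    {r₁ r₂ : ℝ} (hr₁ : r₁ < 2) (hr₂ : r₂ < 2) {f : ℍ → ℂ}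
    (hf : DifferentiableOn ℂ (fun z => f (ofComplex z)) {z | 0 < z.im}) :
    IntervalIntegrable (fun s => principalKernel r₁ r₂ f a b (geodesic a b s) *
        deriv (geodesic a b) s) volume 0 1 ∧
      pathIntegral (geodesic a b) (principalKernel r₁ r₂ f a b) =
        ∫ u in (0 : ℝ)..1, segmentKernel r₁ r₂ f a b u := by
  have h := pathIntegral_branchKernel ha hb hab hr₁ hr₂ hf (isAdmissiblePath_geodesic ha hb hab)
  constructor
  · have h1 := h.1
    rw [intervalIntegrable_iff_integrableOn_Ioo_of_le zero_le_one] at h1 ⊢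
    refine h1.congr_fun (fun s hs => ?_) measurableSet_Ioo
    change _ * _ = _ * _
    rw [principalKernel_geodesic ha hb hab r₁ r₂ f hs]
  · rw [← h.2, pathIntegral, pathIntegral, intervalIntegral.integral_of_le zero_le_one,
      intervalIntegral.integral_of_le zero_le_one, integral_Ioc_eq_integral_Ioo,
      integral_Ioc_eq_integral_Ioo]
    refine setIntegral_congr_fun measurableSet_Ioo fun s hs => ?_
    rw [principalKernel_geodesic ha hb hab r₁ r₂ f hs]

/-! ### The arc from `ρ - 1` to `ρ` -/

theorem rho_eq : rho = 1 / 2 + (Real.sqrt 3 / 2 : ℝ) * I := by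
  rw [rho, show (Real.pi * I / 3 : ℂ) = ((Real.pi / 3 : ℝ) : ℂ) * I by push_cast; ring, exp_mul_I,
    ← ofReal_cos, ← ofReal_sin, Real.cos_pi_div_three, Real.sin_pi_div_three]
  push_cast
  ring

theorem rho_im_pos : 0 < rho.im := by
  rw [rho_eq]
  simp

theorem rho_sub_one_im_pos : 0 < (rho - 1).im := by
  simpa using rho_im_pos

theorem conj_rho : conj rho = 1 - rho := by
  rw [rho_eq, map_add, map_mul, conj_ofReal, conj_I, map_div₀, map_one, map_ofNat]
  ring

theorem rho_ne_zero : rho ≠ 0 := exp_ne_zero _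

/-- The point equals `-ρ · conj w / w` with `w = 2ρ - u`. Hence the arc lies on the unit circle and
cannot meet `iy` for `y > 1`, so `τ₁ ≠ τ₂` throughout. -/
theorem norm_geodesic_rho (u : ℝ) : ‖geodesic (rho - 1) rho u‖ = 1 := by
  have h0 := rho_ne_zero
  have hB : toDiskAt (rho - 1) rho = 1 / (2 * rho) := by
    rw [toDiskAt, map_sub, map_one, conj_rho]
    congr 1 <;> ring
  have hne : 2 * rho - u ≠ 0 := by
    refine ne_zero_of_im_pos ?_
    have := rho_im_pos
    simp only [sub_im, mul_im, re_ofNat, im_ofNat, ofReal_im]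
    linarith
  have hne' : 1 - 1 / (2 * rho) * (u : ℂ) = (2 * rho - u) / (2 * rho) := by
    field_simp
  have e : geodesic (rho - 1) rho u = -rho * (conj (2 * rho - u) / (2 * rho - u)) := by
    rw [geodesic, hB, hne', map_sub, map_sub, map_mul, map_one, conj_rho, conj_ofReal, map_ofNat]
    field_simp
    ring
  have hr : ‖rho‖ = 1 := by
    rw [rho, show (Real.pi * I / 3 : ℂ) = ((Real.pi / 3 : ℝ) : ℂ) * I by push_cast; ring,
      norm_exp_ofReal_mul_I]
  rw [e, norm_mul, norm_neg, hr, norm_div, Complex.norm_conj, div_self (norm_ne_zero_iff.2 hne),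
    one_mul]

theorem ne_of_mem_geodesicSegment_rho {τ : ℂ} (hτ : τ ∈ geodesicSegment (rho - 1) rho) {y : ℝ}
    (hy : 1 < y) : I * y ≠ τ := by
  obtain ⟨u, -, rfl⟩ := hτ
  intro h
  have := norm_geodesic_rho u
  rw [← h, norm_mul, norm_I, one_mul, Complex.norm_real, Real.norm_of_nonneg (by linarith)] at this
  linarith

theorem im_pos_of_mem_geodesicSegment_rho {τ : ℂ} (hτ : τ ∈ geodesicSegment (rho - 1) rho) :
    0 < τ.im := by
  obtain ⟨u, hu, rfl⟩ := hτ
  exact geodesic_im_pos rho_sub_one_im_pos rho_im_pos hu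

theorem I_mul_im_pos {y : ℝ} (hy : 0 < y) : 0 < (I * y).im := by simpa

/-! ### The densities of the triple integral -/

/-- The density of the integral over `τ₁`. -/
def leftDensity (f : ℍ → ℂ) (s : ℝ) : ℂ :=
  f (ofComplex (geodesic (rho - 1) rho s)) * deriv (geodesic (rho - 1) rho) s

/-- The density of the integral over `τ₂ = i y`. -/
def rightDensity (f : ℍ → ℂ) (y : ℝ) : ℂ := f (ofComplex (I * y)) * I

theorem continuousOn_leftDensity {f : ℍ → ℂ}
    (hf : ContinuousOn (fun z => f (ofComplex z)) {z | 0 < z.im}) :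
    ContinuousOn (leftDensity f) (Icc 0 1) := by
  have hne : ∀ s ∈ Icc (0 : ℝ) 1, 1 - toDiskAt (rho - 1) rho * s ≠ 0 := fun s hs =>
    one_sub_ne_zero_of_norm_lt
      (norm_toDiskAt_mul_ofReal_lt rho_sub_one_im_pos rho_im_pos hs)
  refine ContinuousOn.mul (hf.comp (contDiffOn_geodesic rho_sub_one_im_pos rho_im_pos).continuousOn
    fun s hs => geodesic_im_pos rho_sub_one_im_pos rho_im_pos hs) ?_
  refine ContinuousOn.congr (f := fun s : ℝ => toDiskAt (rho - 1) rho *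
    (rho - 1 - conj (rho - 1)) / (1 - toDiskAt (rho - 1) rho * s) ^ 2) ?_
    fun s hs => (hasDerivAt_geodesic (hne s hs)).deriv
  exact continuousOn_const.div (by fun_prop) fun s hs => pow_ne_zero 2 (hne s hs)

theorem continuousOn_rightDensity {f : ℍ → ℂ}
    (hf : ContinuousOn (fun z => f (ofComplex z)) {z | 0 < z.im}) :
    ContinuousOn (rightDensity f) (Ici 1) :=
  (hf.comp (by fun_prop : ContinuousOn (fun y : ℝ => I * (y : ℂ)) (Ici 1)) fun y hy =>
    I_mul_im_pos (zero_lt_one.trans_le hy)).mul continuousOn_const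

theorem tendsto_ofComplex_I_mul : Tendsto (fun y : ℝ => ofComplex (I * y)) atTop atImInfty := by
  rw [atImInfty, tendsto_comap_iff]
  refine tendsto_id.congr' ?_
  filter_upwards [eventually_gt_atTop 0] with y hy
  simp [ofComplex_apply_of_im_pos (I_mul_im_pos hy), UpperHalfPlane.im]

/-- The decay condition with exponent `k + 2` leaves `y⁻²` after multiplication by `y^k`. -/
theorem integrableOn_rightDensity {r : ℝ} {v : SL(2, ℤ) → ℂˣ} {f : ℍ → ℂ}
    (hf : f ∈ cuspForms r v) (k : ℕ) :
    IntegrableOn (fun y => ‖rightDensity f y‖ * y ^ k) (Ioi 1) := by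
  have hc := continuousOn_rightDensity (differentiableOn_of_mem_modularForms hf.1.1).continuousOn
  have hloc : LocallyIntegrableOn (fun y => ‖rightDensity f y‖ * y ^ k) (Ici 1) :=
    (hc.norm.mul (by fun_prop)).locallyIntegrableOn measurableSet_Ici
  have hO : (fun y => ‖rightDensity f y‖ * y ^ k) =O[atTop] fun y : ℝ => y ^ (-2 : ℝ) := by
    have h1 := ((hf.2 (k + 2)).comp_tendsto tendsto_ofComplex_I_mul).norm_left.mul
      (Asymptotics.isBigO_refl (fun y : ℝ => y ^ k) atTop)
    refine h1.congr' (Eventually.of_forall fun y => ?_) ?_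
    · simp [rightDensity]
    · filter_upwards [eventually_gt_atTop 0] with y hy
      have e : (ofComplex (I * y)).im = y := by
        simp [ofComplex_apply_of_im_pos (I_mul_im_pos hy), UpperHalfPlane.im]
      simp only [Function.comp_apply, e]
      rw [← Real.rpow_natCast, ← Real.rpow_add hy]
      congr 1
      ring
  exact (hloc.integrableOn_of_isBigO_atTop hO
    ⟨Ioi 1, Ioi_mem_atTop 1, integrableOn_Ioi_rpow_of_lt (by norm_num) one_pos⟩).mono_set
      Ioi_subset_Ici_self

theorem exists_tripleData {r₁ r₂ : ℝ} {v₁ v₂ : SL(2, ℤ) → ℂˣ} {f₁ f₂ : ℍ → ℂ}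
    (hf₁ : f₁ ∈ modularForms r₁ v₁) (hf₂ : f₂ ∈ cuspForms r₂ v₂) :
    ∃ δ, TripleData δ (geodesic (rho - 1) rho) (leftDensity f₁) (rightDensity f₂) := by
  have hγ := (contDiffOn_geodesic rho_sub_one_im_pos rho_im_pos).continuousOn
  have h1 := continuousOn_leftDensity (differentiableOn_of_mem_modularForms hf₁).continuousOn
  have h2 := continuousOn_rightDensity (differentiableOn_of_mem_modularForms hf₂.1.1).continuousOn
  obtain ⟨x, hx, hmin⟩ := isCompact_Icc.exists_isMinOn (nonempty_Icc.2 zero_le_one)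
    (continuous_im.comp_continuousOn hγ)
  -- The minimum height of the compact arc, capped at `1` so that it also bounds the height of `τ₂ =
  -- iy` and hence of the whole chord.
  refine ⟨min (geodesic (rho - 1) rho x).im 1,
    lt_min (geodesic_im_pos rho_sub_one_im_pos rho_im_pos hx) one_pos, min_le_right _ _,
    hγ.mono Ioo_subset_Icc_self, fun s hs => ?_, fun s _ => (norm_geodesic_rho s).le,
    h1.mono Ioo_subset_Icc_self,
    (h1.integrableOn_compact isCompact_Icc).mono_set Ioo_subset_Icc_self,
    h2.mono Ioi_subset_Ici_self, integrableOn_rightDensity hf₂⟩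
  exact (min_le_left _ _).trans (hmin (Ioo_subset_Icc_self hs))

theorem cupProduct_eq (r₁ r₂ : ℝ) (f₁ f₂ : ℍ → ℂ) (t : LowerHalfPlane) :
    cupProduct r₁ r₂ f₁ f₂ t =
      (∫ s in Ioo (0 : ℝ) 1, leftDensity f₁ s *
        (geodesic (rho - 1) rho s - t.1) ^ (-(2 - r₁ : ℝ) : ℂ)) *
      ∫ y in Ioi (1 : ℝ), rightDensity f₂ y * (I * y - t.1) ^ (-(2 - r₂ : ℝ) : ℂ) := by
  have e : ∀ r : ℝ, ((r - 2 : ℝ) : ℂ) = -(2 - r : ℝ) := fun r => by push_cast; ring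
  rw [cupProduct, eichler, eichlerToInfty, pathIntegral, integralToInfty,
    intervalIntegral.integral_of_le zero_le_one, integral_Ioc_eq_integral_Ioo, e, e]
  congr 1
  · refine setIntegral_congr_fun measurableSet_Ioo fun s _ => ?_
    rw [leftDensity]
    ring
  · refine setIntegral_congr_fun measurableSet_Ioi fun y _ => ?_
    rw [rightDensity]
    ring

theorem segmentKernel_eq (r₁ r₂ : ℝ) (f : ℍ → ℂ) (a b : ℂ) (u : ℝ) :
    segmentKernel r₁ r₂ f a b u =
      (betaKernel (2 - r₁) (2 - r₂) u : ℂ) * f (ofComplex (a + u * (b - a))) := by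
  rw [segmentKernel, betaKernel, show 2 - r₂ - 1 = 1 - r₂ by ring,
    show 2 - r₁ - 1 = 1 - r₁ by ring, mul_comm]

theorem outerIntegral_congr {f₁ f₂ : ℍ → ℂ} {K L : ℂ → ℂ → ℂ}
    (h : ∀ τ₁ ∈ geodesicSegment (rho - 1) rho, ∀ y : ℝ, 1 < y → K τ₁ (I * y) = L τ₁ (I * y)) :
    outerIntegral f₁ f₂ K = outerIntegral f₁ f₂ L := by
  rw [outerIntegral, outerIntegral, pathIntegral, pathIntegral]
  refine intervalIntegral.integral_congr fun s hs => ?_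
  rw [uIcc_of_le zero_le_one] at hs
  have e : integralToInfty (fun τ₂ => f₂ (ofComplex τ₂) * K (geodesic (rho - 1) rho s) τ₂) =
      integralToInfty fun τ₂ => f₂ (ofComplex τ₂) * L (geodesic (rho - 1) rho s) τ₂ := by
    refine setIntegral_congr_fun measurableSet_Ioi fun y hy => ?_
    change _ * K _ _ * _ = _ * L _ _ * _
    rw [h _ ⟨s, hs, rfl⟩ y hy]
  change _ * integralToInfty _ * _ = _ * integralToInfty _ * _
  rw [e]

theorem outerIntegral_segmentKernel {r₁ r₂ : ℝ} {f₁ f₂ f₃ : ℍ → ℂ}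
    (hint : IntegrableOn (fun p => tripleDensity (2 - r₁) (2 - r₂) (leftDensity f₁)
      (rightDensity f₂) p * f₃ (ofComplex (triplePoint (geodesic (rho - 1) rho) p)))
      tripleDomain) :
    outerIntegral f₁ f₂ (fun τ₁ τ₂ => ∫ u in (0 : ℝ)..1, segmentKernel r₁ r₂ f₃ τ₁ τ₂ u) =
      ∫ p in tripleDomain, tripleDensity (2 - r₁) (2 - r₂) (leftDensity f₁) (rightDensity f₂) p *
        f₃ (ofComplex (triplePoint (geodesic (rho - 1) rho) p)) := by
  rw [integral_tripleDomain hint, outerIntegral, pathIntegral,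
    intervalIntegral.integral_of_le zero_le_one, integral_Ioc_eq_integral_Ioo]
  refine setIntegral_congr_fun measurableSet_Ioo fun s _ => ?_
  rw [integralToInfty, mul_right_comm, ← integral_const_mul]
  refine setIntegral_congr_fun measurableSet_Ioi fun y _ => ?_
  change _ * (_ * (∫ u in (0 : ℝ)..1, segmentKernel r₁ r₂ f₃ _ _ u) * I) = _
  rw [intervalIntegral.integral_of_le (zero_le_one' ℝ), integral_Ioc_eq_integral_Ioo,
    mul_right_comm (f₂ _), ← mul_assoc, ← integral_const_mul]
  refine setIntegral_congr_fun measurableSet_Ioo fun u _ => ?_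
  change _ * segmentKernel r₁ r₂ f₃ _ _ u = _
  simp only [segmentKernel_eq, tripleDensity, leftDensity, rightDensity, triplePoint]
  ring

/-! ### The duality evaluated as the triple integral. -/

theorem exists_isDiskSeries_cupProduct {r₁ r₂ r₃ : ℝ} {v₁ v₂ v₃ : SL(2, ℤ) → ℂˣ}
    (hr : r₁ + r₂ + r₃ = 4) (hr₁ : r₁ < 2) (hr₂ : r₂ < 2) (hv₃ : IsMultiplierSystem r₃ v₃)
    {f₁ f₂ f₃ : ℍ → ℂ} (hf₁ : f₁ ∈ modularForms r₁ v₁) (hf₂ : f₂ ∈ cuspForms r₂ v₂)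
    (hf₃ : f₃ ∈ entireForms r₃ v₃) :
    ∃ a, IsDiskSeries r₃ (cupProduct r₁ r₂ f₁ f₂) a ∧
      Tendsto (analyticPairing r₃ f₃) (analyticNhds r₃ (cupProduct r₁ r₂ f₁ f₂))
        (𝓝 (tripleConst r₁ r₂ r₃ * ∫ p in tripleDomain,
          tripleDensity (2 - r₁) (2 - r₂) (leftDensity f₁) (rightDensity f₂) p *
            f₃ (ofComplex (triplePoint (geodesic (rho - 1) rho) p)))) := by
  obtain rfl : r₃ = (2 - r₁) + (2 - r₂) := by linarith
  have hα : 0 < 2 - r₁ := by linarith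
  have hβ : 0 < 2 - r₂ := by linarith
  have hr₃ : 0 < (2 - r₁) + (2 - r₂) := by positivity
  obtain ⟨δ, hT⟩ := exists_tripleData hf₁ hf₂
  have hM := hT.hasMoments hα hβ hr₃
    ((Real.Gamma ((2 - r₁) + (2 - r₂)) / (Real.Gamma (2 - r₁) * Real.Gamma (2 - r₂)) : ℝ) : ℂ)
  have hS := hM.isDiskSeries hr₃ fun x hx =>
    hT.diskMinus_eq_integral hα hβ (cupProduct_eq r₁ r₂ f₁ f₂) hx
  obtain ⟨C, hC0, hC⟩ := exists_norm_inDisk_plusPart_le hr₃ hv₃ hf₃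
  have hF := differentiableOn_inDisk (differentiableOn_plusPart
    (r := (2 - r₁) + (2 - r₂)) (differentiableOn_of_mem_modularForms hf₃.1))
  obtain ⟨C', N, hb⟩ := exists_norm_taylorCoeff_le hF hC0 hC
  refine ⟨_, hS, ?_⟩
  have hlim := hS.tendsto_analyticPairing hr₃ hF hb
  rw [hM.tsum_eq hr₃ hF hb] at hlim
  have e : ∀ p ∈ tripleDomain, ((Real.Gamma ((2 - r₁) + (2 - r₂)) /
        (Real.Gamma (2 - r₁) * Real.Gamma (2 - r₂)) : ℝ) : ℂ) *
        (tripleDensity (2 - r₁) (2 - r₂) (leftDensity f₁) (rightDensity f₂) p *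
          ((triplePoint (geodesic (rho - 1) rho) p + I) / (2 * I)) ^
            (-((2 - r₁) + (2 - r₂) : ℝ) : ℂ)) *
        inDisk (plusPart ((2 - r₁) + (2 - r₂)) f₃)
          (toDisk (triplePoint (geodesic (rho - 1) rho) p)) =
      tripleConst r₁ r₂ ((2 - r₁) + (2 - r₂)) *
        (tripleDensity (2 - r₁) (2 - r₂) (leftDensity f₁) (rightDensity f₂) p *
            f₃ (ofComplex (triplePoint (geodesic (rho - 1) rho) p))) := by
    intro p hp
    have h1 := cpow_mul_inDisk_plusPart ((2 - r₁) + (2 - r₂)) f₃ (hT.im_triplePoint_pos hp)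
    rw [tripleConst]
    linear_combination ((Real.Gamma ((2 - r₁) + (2 - r₂)) /
        (Real.Gamma (2 - r₁) * Real.Gamma (2 - r₂)) : ℝ) : ℂ) *
        tripleDensity (2 - r₁) (2 - r₂) (leftDensity f₁) (rightDensity f₂) p * h1
  rwa [setIntegral_congr_fun measurableSet_tripleDomain e, integral_const_mul] at hlim

/-- All chords stay above a fixed height `δ`, where `f₃` is bounded, so integrability of the density
is enough. -/
theorem integrableOn_tripleDensity_mul {r₁ r₂ r₃ : ℝ} {v₁ v₂ v₃ : SL(2, ℤ) → ℂˣ}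
    (hr₁ : r₁ < 2) (hr₂ : r₂ < 2) (hr₃ : 0 < r₃) (hv₃ : IsMultiplierSystem r₃ v₃)
    {f₁ f₂ f₃ : ℍ → ℂ} (hf₁ : f₁ ∈ modularForms r₁ v₁) (hf₂ : f₂ ∈ cuspForms r₂ v₂)
    (hf₃ : f₃ ∈ entireForms r₃ v₃) :
    IntegrableOn (fun p => tripleDensity (2 - r₁) (2 - r₂) (leftDensity f₁)
      (rightDensity f₂) p * f₃ (ofComplex (triplePoint (geodesic (rho - 1) rho) p)))
      tripleDomain := by
  obtain ⟨δ, hT⟩ := exists_tripleData hf₁ hf₂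
  obtain ⟨C, hC⟩ := exists_norm_le_of_le_im hr₃ hv₃ hf₃ hT.pos
  refine hT.integrableOn_mul_of_bounded (by linarith) (by linarith) (C := C) ?_ fun p hp => ?_
  · exact (differentiableOn_of_mem_modularForms hf₃.1).continuousOn.comp
      hT.continuousOn_triplePoint fun p hp => hT.im_triplePoint_pos hp
  · refine hC _ ?_
    rw [ofComplex_apply_of_im_pos (hT.im_triplePoint_pos hp)]
    exact hT.le_im_triplePoint hp

end ModularCup

end

theorem theorem1p1 (r₁ r₂ r₃ : ℝ) (v₁ v₂ v₃ : SL(2, ℤ) → ℂˣ)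
    (hr : r₁ + r₂ + r₃ = 4) (hr₁ : r₁ < 2) (hr₂ : 0 < r₂) (hr₂' : r₂ < 2)
    (hv₁ : ModularCup.IsMultiplierSystem r₁ v₁)
    (hv₂ : ModularCup.IsMultiplierSystem r₂ v₂)
    (hv₃ : ModularCup.IsMultiplierSystem r₃ v₃)
    (hv : v₁ * v₂ * v₃ = 1)
    (f₁ f₂ f₃ : ℍ → ℂ) (hf₁ : f₁ ∈ ModularCup.modularForms r₁ v₁)
    (hf₂ : f₂ ∈ ModularCup.cuspForms r₂ v₂) (hf₃ : f₃ ∈ ModularCup.entireForms r₃ v₃) :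
    -- the product of Eichler integrals is in the smooth module, and the extension by continuity
    -- of the duality, with which the trilinear form is defined, exists at this product
    ModularCup.cupProduct r₁ r₂ f₁ f₂ ∈ ModularCup.smoothModule r₃ ∧
    (ModularCup.analyticNhds r₃ (ModularCup.cupProduct r₁ r₂ f₁ f₂)).NeBot ∧
    Tendsto (ModularCup.analyticPairing r₃ f₃)
      (ModularCup.analyticNhds r₃ (ModularCup.cupProduct r₁ r₂ f₁ f₂))
      (𝓝 (ModularCup.trilinearForm r₁ r₂ r₃ f₁ f₂ f₃)) ∧
    -- the triple integral over `τ₁`, `τ₂ = i y`, `u` converges absolutely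
    IntegrableOn (fun p : ℝ × ℝ × ℝ =>
        f₁ (ofComplex (ModularCup.geodesic (ModularCup.rho - 1) ModularCup.rho p.1)) *
          deriv (ModularCup.geodesic (ModularCup.rho - 1) ModularCup.rho) p.1 *
          (f₂ (ofComplex (I * p.2.1)) * I) *
          ModularCup.segmentKernel r₁ r₂ f₃
            (ModularCup.geodesic (ModularCup.rho - 1) ModularCup.rho p.1) (I * p.2.1) p.2.2)
      (Ioo 0 1 ×ˢ Ioi 1 ×ˢ Ioo 0 1) ∧
    -- first formula
    (ModularCup.trilinearForm r₁ r₂ r₃ f₁ f₂ f₃ =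
      ModularCup.tripleConst r₁ r₂ r₃ * ModularCup.outerIntegral f₁ f₂ fun τ₁ τ₂ =>
        ∫ u in (0 : ℝ)..1, ModularCup.segmentKernel r₁ r₂ f₃ τ₁ τ₂ u) ∧
    -- second formula, `z` on the geodesic segment from `τ₁` to `τ₂`, principal powers
    (∀ τ₁ ∈ ModularCup.geodesicSegment (ModularCup.rho - 1) ModularCup.rho, ∀ y : ℝ, 1 < y →
      IntervalIntegrable (fun s => ModularCup.principalKernel r₁ r₂ f₃ τ₁ (I * y)
          (ModularCup.geodesic τ₁ (I * y) s) * deriv (ModularCup.geodesic τ₁ (I * y)) s)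
        volume 0 1) ∧
    (ModularCup.trilinearForm r₁ r₂ r₃ f₁ f₂ f₃ =
      ModularCup.tripleConst r₁ r₂ r₃ * ModularCup.outerIntegral f₁ f₂ fun τ₁ τ₂ =>
        ModularCup.pathIntegral (ModularCup.geodesic τ₁ τ₂)
          (ModularCup.principalKernel r₁ r₂ f₃ τ₁ τ₂)) ∧
    -- second formula, `z` on arbitrary admissible paths from `τ₁` to `τ₂`
    (∀ path : ℂ → ℂ → ℝ → ℂ,
      (∀ τ₁ ∈ ModularCup.geodesicSegment (ModularCup.rho - 1) ModularCup.rho, ∀ y : ℝ, 1 < y →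
        ModularCup.IsAdmissiblePath τ₁ (I * y) (path τ₁ (I * y))) →
      (∀ τ₁ ∈ ModularCup.geodesicSegment (ModularCup.rho - 1) ModularCup.rho, ∀ y : ℝ, 1 < y →
        IntervalIntegrable (fun s => ModularCup.branchKernel r₁ r₂ f₃ τ₁ (I * y)
            (path τ₁ (I * y) s) * deriv (path τ₁ (I * y)) s) volume 0 1) ∧
      ModularCup.trilinearForm r₁ r₂ r₃ f₁ f₂ f₃ =
        ModularCup.tripleConst r₁ r₂ r₃ * ModularCup.outerIntegral f₁ f₂ fun τ₁ τ₂ =>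
          ModularCup.pathIntegral (path τ₁ τ₂) (ModularCup.branchKernel r₁ r₂ f₃ τ₁ τ₂)) := by
  have hr₃ : 0 < r₃ := by linarith
  obtain ⟨a, hS, hlim⟩ :=
    ModularCup.exists_isDiskSeries_cupProduct hr hr₁ hr₂' hv₃ hf₁ hf₂ hf₃
  have hint := ModularCup.integrableOn_tripleDensity_mul hr₁ hr₂' hr₃ hv₃ hf₁ hf₂ hf₃
  have hne := hS.neBot
  have hd := ModularCup.differentiableOn_of_mem_modularForms hf₃.1
  have hval : ModularCup.trilinearForm r₁ r₂ r₃ f₁ f₂ f₃ =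
      ModularCup.tripleConst r₁ r₂ r₃ * ModularCup.outerIntegral f₁ f₂ fun τ₁ τ₂ =>
        ∫ u in (0 : ℝ)..1, ModularCup.segmentKernel r₁ r₂ f₃ τ₁ τ₂ u := by
    rw [ModularCup.outerIntegral_segmentKernel hint]
    -- The limit operator returns the limit because the filter is nontrivial, by `hne`.
    exact hlim.limUnder_eq
  have hpos : ∀ y : ℝ, 1 < y → 0 < (I * y).im := fun y hy =>
    ModularCup.I_mul_im_pos (zero_lt_one.trans hy)
  have hprin : ∀ τ₁ ∈ ModularCup.geodesicSegment (ModularCup.rho - 1) ModularCup.rho, ∀ y : ℝ,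
      1 < y → _ := fun τ₁ hτ y hy => ModularCup.pathIntegral_principalKernel
    (ModularCup.im_pos_of_mem_geodesicSegment_rho hτ) (hpos y hy)
    (ModularCup.ne_of_mem_geodesicSegment_rho hτ hy) hr₁ hr₂' hd
  refine ⟨hS.mem_smoothModule, hne, ?_, ?_, hval, fun τ₁ hτ y hy => (hprin τ₁ hτ y hy).1, ?_,
    fun path hpath => ?_⟩
  · rw [hval, ModularCup.outerIntegral_segmentKernel hint]
    exact hlim
  · refine hint.congr_fun (fun p _ => ?_) ModularCup.measurableSet_tripleDomain
    simp only [ModularCup.segmentKernel_eq, ModularCup.tripleDensity, ModularCup.leftDensity,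
      ModularCup.rightDensity, ModularCup.triplePoint]
    ring
  · rw [hval]
    congr 1
    exact ModularCup.outerIntegral_congr fun τ₁ hτ y hy => (hprin τ₁ hτ y hy).2.symm
  · have hbr : ∀ τ₁ ∈ ModularCup.geodesicSegment (ModularCup.rho - 1) ModularCup.rho, ∀ y : ℝ,
        1 < y → _ := fun τ₁ hτ y hy => ModularCup.pathIntegral_branchKernel
      (ModularCup.im_pos_of_mem_geodesicSegment_rho hτ) (hpos y hy)
      (ModularCup.ne_of_mem_geodesicSegment_rho hτ hy) hr₁ hr₂' hd (hpath τ₁ hτ y hy)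
    refine ⟨fun τ₁ hτ y hy => (hbr τ₁ hτ y hy).1, ?_⟩
    rw [hval]
    congr 1
    exact ModularCup.outerIntegral_congr fun τ₁ hτ y hy => (hbr τ₁ hτ y hy).2.symm
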